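/- Let $(V,\in)$ be any model of $\mathsf{ZF}+\mathsf{DC}$ (equivalently, by the completeness theorem: work in $\mathsf{ZF}+\mathsf{DC}$). Let $\mathbb P=\langle P,\le,\mathbb 1\rangle$ be a notion of forcing in $V$, that is, a preordered set with a maximum $\mathbb 1$. Call $p,q\in P$ compatible if they have a common extension $r\le p,q$; call $D\subseteq P$ predense if every $p\in P$ is compatible with some element of $D$, and predense below $q\in P$ if every $p\le q$ is compatible with some element of $D$. For an infinite (well-ordered) cardinal $\kappa$, let $H_\kappa$ be the set of all $x$ whose transitive closure does not map onto $\kappa$. If $M$ is a set and $q\in P$, then $q$ is called $M$-generic if for every $D\in M$ that is a predense subset of $\mathbb P$, the set $D\cap M$ is predense below $q$. Then the following two statements are equivalent in $V$: 1. ($\mathrm{ccc}_3$) Every predense subset of $\mathbb P$ contains a countable predense subset. 2. (Mekler's criterion) For all sufficiently large infinite cardinals $\kappa$, and for every countable elementary submodel $M\prec H_\kappa$ such that $\mathbb P\in M$, the maximum condition $\mathbb 1$ is $M$-generic. -/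

import Mathlib

/-! Structures for the language of set theory, the theory ZF + DC, and the notions about forcing
expressed inside such a structure. Throughout, `V` plays the role of the universe of sets: all
quantifiers in the definitions below range over elements of `V`, and every one of these
definitions is a first-order formula in the membership relation of `V`. -/

namespace ZFModel

/-- A structure for the language of set theory: a type with a binary relation. -/
class SetModel (V : Type*) where
  mem : V → V → Prop

infix:50 " ∈ᵛ " => ZFModel.SetModel.mem

/-! ### The first-order language of set theory -/

/-- The only non-logical symbol is the binary symbol for membership. -/
inductive SetRel : ℕ → Type
  | mem : SetRel 2

/-- The first-order language of set theory. -/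
def setLang : FirstOrder.Language := ⟨fun _ => Empty, SetRel⟩

instance instStructure (V : Type*) [SetModel V] : setLang.Structure V where
  funMap := fun f => Empty.elim f
  RelMap := fun r => match r with
    | SetRel.mem => fun v => v 0 ∈ᵛ v 1

section Basic

variable {V : Type*} [SetModel V]

/-! ### Elementary set-theoretic notions -/

/-- `a ⊆ b`. -/
def Sub (a b : V) : Prop := ∀ z, z ∈ᵛ a → z ∈ᵛ b

/-- `a = ∅`. -/
def IsEmptySet (a : V) : Prop := ∀ z, ¬ z ∈ᵛ a

/-- `p = {a, b}`. -/
def IsUPair (a b p : V) : Prop := ∀ z, z ∈ᵛ p ↔ (z = a ∨ z = b)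

/-- `p = ⟨a, b⟩ = {{a}, {a, b}}`. -/
def IsOPair (a b p : V) : Prop := ∃ u v, IsUPair a a u ∧ IsUPair a b v ∧ IsUPair u v p

/-- `y = x ∪ {x}`. -/
def IsSucc (x y : V) : Prop := ∀ z, z ∈ᵛ y ↔ (z ∈ᵛ x ∨ z = x)

/-- `c = a ∩ b`. -/
def IsInter (a b c : V) : Prop := ∀ z, z ∈ᵛ c ↔ (z ∈ᵛ a ∧ z ∈ᵛ b)

/-- `⟨x, y⟩ ∈ r`. -/
def Rel (r x y : V) : Prop := ∃ p, IsOPair x y p ∧ p ∈ᵛ r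

/-- `r ⊆ a × b`. -/
def IsRelOn (r a b : V) : Prop := ∀ p, p ∈ᵛ r → ∃ x y, x ∈ᵛ a ∧ y ∈ᵛ b ∧ IsOPair x y p

/-- `f` is a function from `a` to `b`. -/
def IsFun (f a b : V) : Prop := IsRelOn f a b ∧ ∀ x, x ∈ᵛ a → ∃! y, Rel f x y

/-- `f` is an injective function from `a` to `b`. -/
def IsInj (f a b : V) : Prop :=
  IsFun f a b ∧ ∀ x x' y, Rel f x y → Rel f x' y → x = x'

/-- `f` is a surjective function from `a` to `b`. -/
def IsSurj (f a b : V) : Prop := IsFun f a b ∧ ∀ y, y ∈ᵛ b → ∃ x, Rel f x y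

/-- `w` contains `∅` and is closed under successors. -/
def IsInductive (w : V) : Prop :=
  (∃ e, IsEmptySet e ∧ e ∈ᵛ w) ∧ ∀ x, x ∈ᵛ w → ∃ y, IsSucc x y ∧ y ∈ᵛ w

/-- `w = ω`, the least inductive set. -/
def IsOmega (w : V) : Prop := IsInductive w ∧ ∀ w', IsInductive w' → Sub w w'

/-- `n ∈ ω`. -/
def IsNat (n : V) : Prop := ∃ w, IsOmega w ∧ n ∈ᵛ w

/-- `a` is countable (finite sets included). -/
def IsCountable (a : V) : Prop := ∃ w f, IsOmega w ∧ IsInj f a w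

/-- `a` is a transitive set. -/
def IsTransitive (a : V) : Prop := ∀ x, x ∈ᵛ a → Sub x a

/-- `t` is the transitive closure of `x`. -/
def IsTC (x t : V) : Prop :=
  IsTransitive t ∧ Sub x t ∧ ∀ t', IsTransitive t' → Sub x t' → Sub t t'

/-- `a` is an ordinal: transitive and linearly ordered by membership (membership is well-founded
by the axiom of foundation). -/
def IsOrdinal (a : V) : Prop :=
  IsTransitive a ∧ ∀ x y, x ∈ᵛ a → y ∈ᵛ a → (x ∈ᵛ y ∨ x = y ∨ y ∈ᵛ x)

/-- `k` is an aleph: an infinite ordinal which is not in bijection with any smaller ordinal. -/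
def IsAleph (k : V) : Prop :=
  IsOrdinal k ∧ (∃ w, IsOmega w ∧ Sub w k) ∧
    ∀ b, b ∈ᵛ k → ¬ ∃ f, IsInj f b k ∧ IsSurj f b k

/-- `h = H_k`, the set of those `x` whose transitive closure does not map onto `k`. -/
def IsH (k h : V) : Prop :=
  ∀ x, x ∈ᵛ h ↔ ∃ t, IsTC x t ∧ ¬ ∃ f, IsSurj f t k

/-! ### First-order formulas and satisfaction, formalized inside `V` -/

/-- `x` is the von Neumann numeral `n`. -/
def IsNumeral : ℕ → V → Prop
  | 0, x => IsEmptySet x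
  | n + 1, x => ∃ y, IsNumeral n y ∧ IsSucc y x

/-- `c = ⟨n, y⟩`, where the numeral `n` serves as a tag. -/
def IsTagged (n : ℕ) (y c : V) : Prop := ∃ m, IsNumeral n m ∧ IsOPair m y c

/-- `c` is the code of the formula `x_i ∈ x_j`. -/
def CodeMem (i j c : V) : Prop := ∃ y, IsOPair i j y ∧ IsTagged 0 y c

/-- `c` is the code of the formula `x_i = x_j`. -/
def CodeEq (i j c : V) : Prop := ∃ y, IsOPair i j y ∧ IsTagged 1 y c

/-- `c` is the code of the negation of the formula coded by `a`. -/
def CodeNot (a c : V) : Prop := IsTagged 2 a c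

/-- `c` is the code of the conjunction of the formulas coded by `a` and `b`. -/
def CodeAnd (a b c : V) : Prop := ∃ y, IsOPair a b y ∧ IsTagged 3 y c

/-- `c` is the code of `∃ x_i φ`, where `a` is the code of `φ`. -/
def CodeEx (i a c : V) : Prop := ∃ y, IsOPair i a y ∧ IsTagged 4 y c

/-- `X` contains the atomic formulas and is closed under the formation rules. -/
def FormulaClosed (X : V) : Prop :=
  (∀ i j c, IsNat i → IsNat j → CodeMem i j c → c ∈ᵛ X) ∧
  (∀ i j c, IsNat i → IsNat j → CodeEq i j c → c ∈ᵛ X) ∧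
  (∀ a c, a ∈ᵛ X → CodeNot a c → c ∈ᵛ X) ∧
  (∀ a b c, a ∈ᵛ X → b ∈ᵛ X → CodeAnd a b c → c ∈ᵛ X) ∧
  (∀ i a c, IsNat i → a ∈ᵛ X → CodeEx i a c → c ∈ᵛ X)

/-- `c` is (in the sense of `V`) a formula of the language of set theory. -/
def IsFormula (c : V) : Prop := ∀ X, FormulaClosed X → c ∈ᵛ X

/-- `s` is an assignment of elements of `A` to the variables `x_i`, `i ∈ ω`. -/
def IsAssignment (s A : V) : Prop := ∃ w, IsOmega w ∧ IsFun s w A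

/-- `s'` is the assignment that sends `x_i` to `a` and agrees with `s` on all other variables. -/
def IsUpdate (s i a s' : V) : Prop :=
  ∀ j y, Rel s' j y ↔ ((j = i ∧ y = a) ∨ (j ≠ i ∧ Rel s j y))

/-- `S` is a satisfaction relation for the structure `(A, ∈)`: the pairs `⟨c, s⟩` in it, with `c` a
formula and `s` an assignment in `A`, obey Tarski's recursive clauses. -/
def IsSatRel (A S : V) : Prop :=
  ∀ s, IsAssignment s A →
    (∀ i j c, IsNat i → IsNat j → CodeMem i j c →
      (Rel S c s ↔ ∃ x y, Rel s i x ∧ Rel s j y ∧ x ∈ᵛ y)) ∧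
    (∀ i j c, IsNat i → IsNat j → CodeEq i j c →
      (Rel S c s ↔ ∃ x, Rel s i x ∧ Rel s j x)) ∧
    (∀ a c, IsFormula a → CodeNot a c → (Rel S c s ↔ ¬ Rel S a s)) ∧
    (∀ a b c, IsFormula a → IsFormula b → CodeAnd a b c →
      (Rel S c s ↔ (Rel S a s ∧ Rel S b s))) ∧
    (∀ i a c, IsNat i → IsFormula a → CodeEx i a c →
      (Rel S c s ↔ ∃ x s', x ∈ᵛ A ∧ IsAssignment s' A ∧ IsUpdate s i x s' ∧ Rel S a s'))

/-- `(A, ∈) ⊨ c[s]`, in the sense of `V`. -/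
def Satisfies (A c s : V) : Prop := ∃ S, IsSatRel A S ∧ Rel S c s

/-- `(M, ∈)` is an elementary submodel of `(N, ∈)`, in the sense of `V`. -/
def IsElementarySubmodel (M N : V) : Prop :=
  (∃ x, x ∈ᵛ M) ∧ Sub M N ∧
    ∀ c s, IsFormula c → IsAssignment s M → (Satisfies M c s ↔ Satisfies N c s)

end Basic

/-! ### The theory ZF + DC -/

/-- `V` is a model of (first-order) ZF. In the two schemes, `φ` is an arbitrary formula of the
language of set theory with variables indexed by `ℕ`, and `v` supplies the parameters. -/
structure ModelsZF (V : Type*) [SetModel V] : Prop where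
  extensionality : ∀ a b : V, (∀ z, z ∈ᵛ a ↔ z ∈ᵛ b) → a = b
  foundation : ∀ a : V, (∃ x, x ∈ᵛ a) → ∃ x, x ∈ᵛ a ∧ ∀ y, y ∈ᵛ x → ¬ y ∈ᵛ a
  pairing : ∀ a b : V, ∃ p, IsUPair a b p
  union : ∀ a : V, ∃ b : V, ∀ z, z ∈ᵛ b ↔ ∃ x, x ∈ᵛ a ∧ z ∈ᵛ x
  powerset : ∀ a : V, ∃ b : V, ∀ z, z ∈ᵛ b ↔ Sub z a
  infinity : ∃ w : V, IsInductive w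
  separation : ∀ (φ : setLang.Formula ℕ) (v : ℕ → V) (a : V),
    ∃ b : V, ∀ x, x ∈ᵛ b ↔ (x ∈ᵛ a ∧ φ.Realize (Function.update v 0 x))
  replacement : ∀ (φ : setLang.Formula ℕ) (v : ℕ → V) (a : V),
    (∀ x, x ∈ᵛ a → ∀ y y',
      φ.Realize (Function.update (Function.update v 0 x) 1 y) →
      φ.Realize (Function.update (Function.update v 0 x) 1 y') → y = y') →
    ∃ b : V, ∀ y, y ∈ᵛ b ↔
      ∃ x, x ∈ᵛ a ∧ φ.Realize (Function.update (Function.update v 0 x) 1 y)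

/-- `V` satisfies the principle of dependent choice: if `R` is a relation on a non-empty set `A`
such that every `x ∈ A` has some `y ∈ A` with `x R y`, then there is `f : ω → A` with
`f(n) R f(n + 1)` for all `n ∈ ω`. -/
def ModelsDC (V : Type*) [SetModel V] : Prop :=
  ∀ A R : V, (∃ x, x ∈ᵛ A) → (∀ x, x ∈ᵛ A → ∃ y, y ∈ᵛ A ∧ Rel R x y) →
    ∃ w f : V, IsOmega w ∧ IsFun f w A ∧
      ∀ n m x y, n ∈ᵛ w → IsSucc n m → Rel f n x → Rel f m y → Rel R x y

/-! ### Forcing notions -/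

/-- A notion of forcing in `V`: an element `code = ⟨carrier, ⟨le, one⟩⟩` of `V`, where `le` is a
preorder on the set `carrier` with maximum `one`. -/
structure Forcing (V : Type*) [SetModel V] where
  code : V
  carrier : V
  le : V
  one : V
  code_eq : ∃ y, IsOPair le one y ∧ IsOPair carrier y code
  le_rel : IsRelOn le carrier carrier
  refl : ∀ p, p ∈ᵛ carrier → Rel le p p
  trans : ∀ p q r, Rel le p q → Rel le q r → Rel le p r
  one_mem : one ∈ᵛ carrier
  le_one : ∀ p, p ∈ᵛ carrier → Rel le p one

namespace Forcing

variable {V : Type*} [SetModel V] (P : Forcing V)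

/-- `p` and `q` have a common extension. -/
def Compatible (p q : V) : Prop := ∃ r, r ∈ᵛ P.carrier ∧ Rel P.le r p ∧ Rel P.le r q

/-- `D` is a predense subset of the forcing. -/
def Predense (D : V) : Prop :=
  Sub D P.carrier ∧ ∀ p, p ∈ᵛ P.carrier → ∃ d, d ∈ᵛ D ∧ P.Compatible d p

/-- `D` is a subset of the forcing that is predense below the condition `q`. -/
def PredenseBelow (D q : V) : Prop :=
  Sub D P.carrier ∧
    ∀ p, p ∈ᵛ P.carrier → Rel P.le p q → ∃ d, d ∈ᵛ D ∧ P.Compatible d p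

/-- Every predense subset contains a countable predense subset. -/
def CCC3 : Prop :=
  ∀ D, P.Predense D → ∃ D₀, Sub D₀ D ∧ IsCountable D₀ ∧ P.Predense D₀

/-- The condition `q` is `M`-generic: for every predense `D ∈ M`, the set `D ∩ M` is predense
below `q`. -/
def IsGeneric (M q : V) : Prop :=
  ∀ D, D ∈ᵛ M → P.Predense D → ∃ X, IsInter D M X ∧ P.PredenseBelow X q

/-- Mekler's criterion: for all sufficiently large `k`, if `M` is a countable elementary submodel
of `H_k` with the forcing in `M`, then the maximum condition is `M`-generic. -/
def Mekler : Prop :=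
  ∃ k₀, IsAleph k₀ ∧ ∀ k, IsAleph k → Sub k₀ k →
    ∀ h M, IsH k h → IsCountable M → IsElementarySubmodel M h → P.code ∈ᵛ M →
      P.IsGeneric M P.one

end Forcing

end ZFModel

/-! Why the equivalence holds. From ($\mathrm{ccc}_3$) to Mekler's criterion no choice is needed.
Take $\kappa$ so large that $\mathbb P$, $\omega$ and every subset of $P\times\omega$ lie in
$H_\kappa$. Let $M\prec H_\kappa$ be countable with $\mathbb P\in M$, and let $D\in M$ be predense.
A countable predense $D_0\subseteq D$ has an injection into $\omega$, which belongs to $H_\kappa$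
and witnesses there that some injective relation has a predense part of $D$ in its domain. By
elementarity there is such a relation $g\in M$. Since $\omega\subseteq M$, each $d$ with $\langle
d,n\rangle\in g$ and $n\in\omega$ is determined by $g,n\in M$ and so lies in $M$. Hence $D\cap M$
contains that predense part. This is `Forcing.CCC3.mekler`.

Conversely, given a predense $D$, choose $\kappa$ large with $\mathbb P,D\in H_\kappa$. Dependent
choice gives a countable $M\prec H_\kappa$ containing $\mathbb P$ and $D$ (`lowenheim_skolem`). Then
$D\cap M$ is countable and predense below $\mathbb 1$, that is, predense. This is
`Forcing.Mekler.ccc3`.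

Three ingredients need care without full choice. Large alephs come from the ordinals onto which a
set maps (`exists_isAleph`). That $H_\kappa$ is a set follows from a rank argument: the ranks in a
transitive set that does not map onto $\kappa$ omit some value below $\kappa$, and then stay below
it (`exists_isH`). The Löwenheim-Skolem argument makes all its choices along one $\omega$-sequence,
whose stages are indexed by an explicit enumeration of the hereditarily finite sets (`enum`,
`dc_history`).

All of this happens inside an arbitrary model $V$, whose $\omega$ may be nonstandard. Separation and
replacement apply only to predicates definable with parameters, so definability is tracked by the
classes `DefType` and `Dfn`. Formulas and satisfaction are objects of $V$, and inductions on them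
are internal; the standard formulas `Fm` only serve to apply elementarity to specific statements. -/

namespace ZFModel

open FirstOrder Language

universe u v

set_option linter.unusedSectionVars false
set_option synthInstance.maxSize 1000
set_option synthInstance.maxHeartbeats 200000

/-! ### Definable predicates and functions -/

/-- A predicate of an environment that is first-order definable with parameters. -/
def DefPred {V : Type u} [SetModel V] (p : (ℕ → V) → Prop) : Prop :=
  ∃ (φ : setLang.Formula (ℕ ⊕ ℕ)) (w : ℕ → V), ∀ e, p e ↔ φ.Realize (Sum.elim e w)

/-- The environment `e` with `x` put in front. -/
def consEnv {V : Type u} (x : V) (e : ℕ → V) : ℕ → V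
  | 0 => x
  | n + 1 => e n

section DefPred

variable {V : Type u} [SetModel V]

theorem DefPred.congr {p q : (ℕ → V) → Prop} (h : DefPred p) (hpq : ∀ e, q e ↔ p e) :
    DefPred q := by
  obtain ⟨φ, w, hφ⟩ := h
  exact ⟨φ, w, fun e => (hpq e).trans (hφ e)⟩

theorem DefPred.reindex {p : (ℕ → V) → Prop} (h : DefPred p) (ρ : ℕ → ℕ) :
    DefPred (fun e => p (fun n => e (ρ n))) := by
  obtain ⟨φ, w, hφ⟩ := h
  refine ⟨φ.relabel (Sum.map ρ id), w, fun e => ?_⟩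
  change p _ ↔ _
  rw [hφ, Formula.realize_relabel]
  have : (Sum.elim (fun n => e (ρ n)) w : ℕ ⊕ ℕ → V) = Sum.elim e w ∘ Sum.map ρ id := by
    funext x; cases x <;> rfl
  rw [this]

theorem DefPred.const (c : Prop) [Nonempty V] : DefPred (fun _ : ℕ → V => c) := by
  by_cases h : c
  · exact ⟨⊤, fun _ => Classical.arbitrary V, fun e => by simp [h, Formula.Realize]⟩
  · exact ⟨⊥, fun _ => Classical.arbitrary V, fun e => by simp [h, Formula.Realize]⟩

theorem DefPred.not {p : (ℕ → V) → Prop} (h : DefPred p) : DefPred (fun e => ¬ p e) := by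
  obtain ⟨φ, w, hφ⟩ := h
  exact ⟨φ.not, w, fun e => by change ¬ p e ↔ _; rw [hφ, Formula.realize_not]⟩

theorem DefPred.and {p q : (ℕ → V) → Prop} (hp : DefPred p) (hq : DefPred q) :
    DefPred (fun e => p e ∧ q e) := by
  obtain ⟨φ, w, hφ⟩ := hp
  obtain ⟨ψ, w', hψ⟩ := hq
  -- The two parameter sequences are interleaved: `φ` reads the even places and `ψ` the odd ones.
  refine ⟨φ.relabel (Sum.map id (2 * ·)) ⊓ ψ.relabel (Sum.map id (2 * · + 1)),
    fun n => if n % 2 = 0 then w (n / 2) else w' (n / 2), fun e => ?_⟩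
  change p e ∧ q e ↔ _
  rw [hφ, hψ, Formula.realize_inf, Formula.realize_relabel, Formula.realize_relabel]
  refine and_congr (iff_of_eq (congrArg _ ?_)) (iff_of_eq (congrArg _ ?_))
  · funext x
    rcases x with x | x <;> simp
  · funext x
    rcases x with x | x
    · simp
    · simp [show (2 * x + 1) / 2 = x by omega]

theorem DefPred.exists {p : (ℕ → V) → Prop} (h : DefPred p) :
    DefPred (fun e => ∃ x, p (consEnv x e)) := by
  obtain ⟨φ, w, hφ⟩ := h
  refine ⟨Formula.iExs Unit (φ.relabel (fun x => match x with
    | Sum.inl 0 => Sum.inr ()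
    | Sum.inl (n + 1) => Sum.inl (Sum.inl n)
    | Sum.inr n => Sum.inl (Sum.inr n))), w, fun e => ?_⟩
  rw [Formula.realize_iExs]
  have key : ∀ x : V, p (consEnv x e) ↔ _ := fun x => hφ (consEnv x e)
  constructor
  · rintro ⟨x, hx⟩
    refine ⟨fun _ => x, ?_⟩
    rw [Formula.realize_relabel]
    convert (key x).1 hx using 1
    funext y
    rcases y with (_ | n) | n <;> rfl
  · rintro ⟨x, hx⟩
    refine ⟨x (), (key _).2 ?_⟩
    rw [Formula.realize_relabel] at hx
    convert hx using 1
    funext y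
    rcases y with (_ | n) | n <;> rfl

theorem DefPred.mem (i j : ℕ) [Nonempty V] : DefPred (fun e : ℕ → V => e i ∈ᵛ e j) := by
  let R : setLang.Relations 2 := SetRel.mem
  refine ⟨R.formula₂ (Term.var (Sum.inl i)) (Term.var (Sum.inl j)),
    fun _ => Classical.arbitrary V, fun e => ?_⟩
  rw [Formula.realize_rel₂]
  rfl

theorem DefPred.eq (i j : ℕ) [Nonempty V] : DefPred (fun e : ℕ → V => e i = e j) := by
  refine ⟨Term.equal (Term.var (Sum.inl i)) (Term.var (Sum.inl j)),
    fun _ => Classical.arbitrary V, fun e => ?_⟩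
  rw [Formula.realize_equal]
  rfl

theorem DefPred.eq_param (i : ℕ) (c : V) : DefPred (fun e : ℕ → V => e i = c) := by
  refine ⟨Term.equal (Term.var (Sum.inl i)) (Term.var (Sum.inr 0)), fun _ => c, fun e => ?_⟩
  rw [Formula.realize_equal]
  rfl

end DefPred

/-- Types whose families of elements indexed by environments have a notion of definability. -/
class DefType (V : Type u) [SetModel V] (F : Type v) where
  plot : ((ℕ → V) → F) → Prop
  reindex : ∀ {f} (ρ : ℕ → ℕ), plot f → plot (fun e => f (fun n => e (ρ n)))
  const : ∀ c, plot (fun _ => c)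

section Instances

variable (V : Type u) [SetModel V] [Nonempty V]

instance : DefType V Prop := ⟨DefPred, fun ρ h => h.reindex ρ, fun c => DefPred.const c⟩

/-- A family of elements counts as definable when its graph is: place 0 holds the value and the
remaining places hold the environment. -/
instance : DefType V V where
  plot f := DefPred (fun e => e 0 = f (fun n => e (n + 1)))
  reindex := by
    intro f ρ h
    exact (h.reindex (fun n => match n with | 0 => 0 | n + 1 => ρ n + 1))
  const c := DefPred.eq_param 0 c

instance {E F : Type*} [DefType V E] [DefType V F] : DefType V (E × F) where
  plot f := DefType.plot (fun e => (f e).1) ∧ DefType.plot (fun e => (f e).2)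
  reindex ρ h := ⟨DefType.reindex ρ h.1, DefType.reindex ρ h.2⟩
  const c := ⟨DefType.const c.1, DefType.const c.2⟩

end Instances

/-- A map is definable if it maps definable families to definable families. -/
class Dfn (V : Type u) [SetModel V] {E : Type*} {F : Type*} [DefType V E] [DefType V F]
    (f : E → F) : Prop where
  out : ∀ g : (ℕ → V) → E, DefType.plot g → DefType.plot (fun e => f (g e))

/-! ### Closure of definable maps under logical operations and description -/

section Dfn

variable {V : Type u} [SetModel V] [Nonempty V] {E F G : Type*} [DefType V E] [DefType V F]
  [DefType V G]

theorem Dfn.comp {f : F → G} {g : E → F} (hf : Dfn V f) (hg : Dfn V g) :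
    Dfn V (fun e => f (g e)) := ⟨fun h hh => hf.out _ (hg.out h hh)⟩

instance (c : F) : Dfn V (fun _ : E => c) := ⟨fun _ _ => DefType.const c⟩
instance (priority := high) dfn_fst (f : E → F × G) [hf : Dfn V f] : Dfn V (fun e => (f e).1) :=
  ⟨fun h hh => (hf.out h hh).1⟩
instance (priority := high) dfn_snd (f : E → F × G) [hf : Dfn V f] : Dfn V (fun e => (f e).2) :=
  ⟨fun h hh => (hf.out h hh).2⟩
instance (priority := high) : Dfn V (Prod.fst : F × G → F) := ⟨fun _ hh => hh.1⟩
instance (priority := high) : Dfn V (Prod.snd : F × G → G) := ⟨fun _ hh => hh.2⟩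
theorem Dfn.prod {f : E → F} {g : E → G} (hf : Dfn V f) (hg : Dfn V g) :
    Dfn V (fun e => (f e, g e)) :=
  ⟨fun h hh => ⟨hf.out h hh, hg.out h hh⟩⟩

instance dfn_not (p : E → Prop) [hp : Dfn V p] : Dfn V (fun e => ¬ p e) :=
  ⟨fun h hh => DefPred.not (hp.out h hh)⟩

instance dfn_and (p q : E → Prop) [hp : Dfn V p] [hq : Dfn V q] : Dfn V (fun e => p e ∧ q e) :=
  ⟨fun h hh => DefPred.and (hp.out h hh) (hq.out h hh)⟩

theorem Dfn.congr {f g : E → F} (hf : Dfn V f) (h : ∀ e, g e = f e) : Dfn V g := by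
  obtain rfl : g = f := funext h
  exact hf

instance dfn_or (p q : E → Prop) [hp : Dfn V p] [hq : Dfn V q] : Dfn V (fun e => p e ∨ q e) :=
  Dfn.congr (f := fun e => ¬ (¬ p e ∧ ¬ q e)) inferInstance (fun e => propext (by tauto))

instance dfn_imp (p q : E → Prop) [hp : Dfn V p] [hq : Dfn V q] : Dfn V (fun e => p e → q e) :=
  Dfn.congr (f := fun e => ¬ (p e ∧ ¬ q e)) inferInstance (fun e => propext (by tauto))

instance dfn_iff (p q : E → Prop) [hp : Dfn V p] [hq : Dfn V q] : Dfn V (fun e => p e ↔ q e) :=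
  Dfn.congr (f := fun e => (p e → q e) ∧ (q e → p e)) inferInstance
    (fun e => propext (by tauto))

instance dfn_exists (p : E → V → Prop) [hp : Dfn V (fun x : E × V => p x.1 x.2)] :
    Dfn V (fun e => ∃ x, p e x) := by
  refine ⟨fun h hh => ?_⟩
  have h1 : DefType.plot (V := V) (F := E × V) (fun e : ℕ → V => (h (fun n => e (n + 1)), e 0)) :=
    ⟨DefType.reindex (fun n => n + 1) hh, DefPred.eq 0 1⟩
  exact DefPred.exists (hp.out _ h1)

instance dfn_forall (p : E → V → Prop) [hp : Dfn V (fun x : E × V => p x.1 x.2)] :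
    Dfn V (fun e => ∀ x, p e x) :=
  Dfn.congr (f := fun e => ¬ ∃ x, ¬ p e x) inferInstance (fun e => propext (by simp))

instance dfn_eq (f g : E → V) [hf : Dfn V f] [hg : Dfn V g] : Dfn V (fun e => f e = g e) := by
  have base : Dfn V (fun x : V × V => x.1 = x.2) := by
    refine ⟨fun h hh => ?_⟩
    have h1 := hh.1
    have h2 := hh.2
    refine DefPred.congr (DefPred.exists (DefPred.and h1 h2)) (fun e => ?_)
    constructor
    · intro hx
      exact ⟨(h e).1, rfl, hx⟩
    · rintro ⟨x, hx, hy⟩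
      exact hx.symm.trans hy
  exact Dfn.comp (f := fun x : V × V => x.1 = x.2) (g := fun e => (f e, g e)) base (Dfn.prod hf hg)

instance dfn_mem (f g : E → V) [hf : Dfn V f] [hg : Dfn V g] : Dfn V (fun e => f e ∈ᵛ g e) := by
  have base : Dfn V (fun x : V × V => x.1 ∈ᵛ x.2) := by
    refine ⟨fun h hh => ?_⟩
    have h1 := hh.1
    -- Under both quantifiers place 0 holds the second value and place 1 the first, so the
    -- environment starts at place 2.
    have h2 := DefPred.reindex hh.2 (fun n => match n with | 0 => 0 | n + 1 => n + 2)
    refine DefPred.congr (DefPred.exists (DefPred.and h1 (DefPred.exists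
      (DefPred.and h2 (DefPred.mem 1 0))))) (fun e => ?_)
    constructor
    · intro hx
      exact ⟨(h e).1, rfl, (h e).2, rfl, hx⟩
    · rintro ⟨x, hx, y, hy, hxy⟩
      have hx' : x = (h e).1 := hx
      have hy' : y = (h e).2 := hy
      have hxy' : x ∈ᵛ y := hxy
      rwa [hx', hy'] at hxy'
  exact Dfn.comp (f := fun x : V × V => x.1 ∈ᵛ x.2) (g := fun e => (f e, g e)) base (Dfn.prod hf hg)

/-- A function with a definable graph is definable. -/
theorem Dfn.of_graph {f : E → V} (p : E → V → Prop) (hp : Dfn V (fun x : E × V => p x.1 x.2))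
    (h : ∀ e y, y = f e ↔ p e y) : Dfn V f := by
  refine ⟨fun g hg => ?_⟩
  have h1 : DefType.plot (V := V) (F := E × V) (fun e : ℕ → V => (g (fun n => e (n + 1)), e 0)) :=
    ⟨DefType.reindex (fun n => n + 1) hg, DefPred.eq 0 1⟩
  exact DefPred.congr (hp.out _ h1) (fun e => h _ _)

instance dfn_existsUnique (p : E → V → Prop) [hp : Dfn V (fun x : E × V => p x.1 x.2)] :
    Dfn V (fun e => ∃! x, p e x) := by
  have : Dfn V (fun x : (E × V) × V => p x.1.1 x.2) :=
    Dfn.comp (f := fun x : E × V => p x.1 x.2) (g := fun x : (E × V) × V => (x.1.1, x.2)) hp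
      (Dfn.prod inferInstance inferInstance)
  unfold ExistsUnique
  infer_instance

open Classical in
/-- The unique `x` such that `p x`, if there is one. -/
noncomputable def the (p : V → Prop) : V :=
  if h : ∃! x, p x then h.choose else Classical.arbitrary V

theorem the_spec {p : V → Prop} (h : ∃! x, p x) : p (the p) := by
  rw [the, dif_pos h]
  exact h.choose_spec.1

theorem the_eq {p : V → Prop} {x : V} (hx : p x) (h : ∀ y, p y → y = x) : the p = x :=
  h _ (the_spec ⟨x, hx, h⟩)

/-- Every set constructor below is a description of a set by its elements, so its definability
reduces to that of the describing predicate. -/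
instance dfn_the (p : E → V → Prop) [hp : Dfn V (fun x : E × V => p x.1 x.2)] :
    Dfn V (fun e => the (p e)) := by
  have : Dfn V (fun x : (E × V) × V => p x.1.1 x.2) :=
    Dfn.comp (f := fun x : E × V => p x.1 x.2) (g := fun x : (E × V) × V => (x.1.1, x.2)) hp
      (Dfn.prod inferInstance inferInstance)
  refine Dfn.of_graph (fun e y => ((∃! x, p e x) ∧ p e y) ∨
    ((¬ ∃! x, p e x) ∧ y = Classical.arbitrary V)) inferInstance (fun e y => ?_)
  by_cases h : ∃! x, p e x
  · simp only [h, true_and, not_true, false_and, or_false]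
    constructor
    · rintro rfl
      exact the_spec h
    · exact fun hy => h.unique hy (the_spec h)
  · simp only [h, false_and, not_false_iff, true_and, false_or]
    rw [the, dif_neg h]

instance dfn_ite (p : E → Prop) {d : ∀ e, Decidable (p e)} (f g : E → V)
    [hp : Dfn V p] [hf : Dfn V f] [hg : Dfn V g] :
    Dfn V (fun e => if p e then f e else g e) := by
  have hf' : Dfn V (fun x : E × V => f x.1) := Dfn.comp hf inferInstance
  have hg' : Dfn V (fun x : E × V => g x.1) := Dfn.comp hg inferInstance
  have hp' : Dfn V (fun x : E × V => p x.1) := Dfn.comp hp inferInstance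
  refine Dfn.of_graph (fun e y => (p e ∧ y = f e) ∨ (¬ p e ∧ y = g e)) inferInstance
    (fun e y => ?_)
  by_cases h : p e <;> simp [h]

end Dfn

section Comp
variable {V : Type u} [SetModel V] [Nonempty V] {E F A B C : Type*} [DefType V E] [DefType V F]
  [DefType V A] [DefType V B] [DefType V C]

theorem Dfn.comp₂ {q : A → B → F} (hq : Dfn V (fun x : A × B => q x.1 x.2))
    (f : E → A) (g : E → B) [Dfn V f] [Dfn V g] : Dfn V (fun e => q (f e) (g e)) :=
  Dfn.comp (f := fun x : A × B => q x.1 x.2) (g := fun e => (f e, g e)) hq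
    (Dfn.prod inferInstance inferInstance)

theorem Dfn.comp₃ {q : A → B → C → F} (hq : Dfn V (fun x : A × B × C => q x.1 x.2.1 x.2.2))
    (f : E → A) (g : E → B) (h : E → C) [Dfn V f] [Dfn V g] [Dfn V h] :
    Dfn V (fun e => q (f e) (g e) (h e)) :=
  Dfn.comp (f := fun x : A × B × C => q x.1 x.2.1 x.2.2) (g := fun e => (f e, g e, h e)) hq
    (Dfn.prod inferInstance (Dfn.prod inferInstance inferInstance))

/-- Definability of a map on `V`, in a form that is stable under eta-reduction. -/
abbrev Dfn₁ (p : V → F) : Prop := Dfn V (fun x : V × V => p x.2)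

theorem Dfn₁.comp {p : V → F} (hp : Dfn₁ p) {f : E → V} (hf : Dfn V f) :
    Dfn V (fun e => p (f e)) :=
  Dfn.comp (f := fun x : V × V => p x.2) (g := fun e => (f e, f e)) hp (Dfn.prod hf hf)

end Comp

/-! ### Basic set theory in a model of ZF -/

/-- `ModelsZF` as a type class. -/
class ZF (V : Type u) [SetModel V] : Prop where
  models : ModelsZF V

section ZF

variable {V : Type u} [SetModel V] [hZF : ZF V] {E : Type u}

instance ZF.nonempty : Nonempty V := ⟨hZF.models.infinity.choose⟩

variable [DefType V E]

theorem ext {a b : V} (h : ∀ z, z ∈ᵛ a ↔ z ∈ᵛ b) : a = b := hZF.models.extensionality a b h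

theorem exists_sep (p : V → Prop) [hp : Dfn₁ p] (a : V) :
    ∃ b, ∀ x, x ∈ᵛ b ↔ (x ∈ᵛ a ∧ p x) := by
  obtain ⟨φ, w, hφ⟩ := hp.out (fun e : ℕ → V => (e 0, e 0))
    ⟨DefPred.eq 0 1, DefPred.eq 0 1⟩
  -- Only constant environments matter here, so all environment variables collapse to variable 0,
  -- and parameter `n` becomes variable `n + 1`.
  obtain ⟨b, hb⟩ := hZF.models.separation (φ.relabel (Sum.elim (fun _ => 0) (fun n => n + 1)))
    (fun n => w (n - 1)) a
  refine ⟨b, fun x => (hb x).trans (and_congr_right fun _ => ?_)⟩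
  rw [Formula.realize_relabel, show p x ↔ _ from hφ (fun _ => x)]
  refine iff_of_eq (congrArg _ ?_)
  funext y
  rcases y with y | y <;> simp

theorem exists_image (F : V → V) [hF : Dfn₁ F] (a : V) :
    ∃ b, ∀ y, y ∈ᵛ b ↔ ∃ x, x ∈ᵛ a ∧ y = F x := by
  have : Dfn V (fun x : V × V => F x.1) := Dfn₁.comp hF inferInstance
  have h : Dfn V (fun x : V × V => x.2 = F x.1) := inferInstance
  obtain ⟨φ, w, hφ⟩ := h.out (fun e : ℕ → V => (e 0, e 1)) ⟨DefPred.eq 0 1, DefPred.eq 0 2⟩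
  have key : ∀ x y, (φ.relabel (fun x : ℕ ⊕ ℕ => match x with
      | Sum.inl 0 => 0
      | Sum.inl (n + 1) => 1
      | Sum.inr n => n + 2)).Realize
      (Function.update (Function.update (fun n => w (n - 2)) 0 x) 1 y) ↔ y = F x := by
    intro x y
    rw [Formula.realize_relabel,
      show y = F x ↔ _ from hφ (fun n => match n with | 0 => x | _ + 1 => y)]
    refine iff_of_eq (congrArg _ ?_)
    funext z
    rcases z with (_ | n) | n
    · simp [Function.update]
    · simp [Function.update]
    · simp [Function.update]
  obtain ⟨b, hb⟩ := hZF.models.replacement _ (fun n => w (n - 2)) a (fun x _ y y' h h' =>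
    ((key x y).1 h).trans ((key x y').1 h').symm)
  refine ⟨b, fun y => (hb y).trans (exists_congr fun x => and_congr_right fun _ => key x y)⟩

theorem the_set {p : V → Prop} (h : ∃ b : V, ∀ x, x ∈ᵛ b ↔ p x) (x : V) :
    x ∈ᵛ the (fun b : V => ∀ x, x ∈ᵛ b ↔ p x) ↔ p x := by
  obtain ⟨b, hb⟩ := h
  exact the_spec (p := fun b : V => ∀ x, x ∈ᵛ b ↔ p x)
    ⟨b, hb, fun c hc => ext fun z => (hc z).trans (hb z).symm⟩ x

/-- `{x ∈ a | p x}` -/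
noncomputable def sep (a : V) (p : V → Prop) : V := the (fun b => ∀ x, x ∈ᵛ b ↔ (x ∈ᵛ a ∧ p x))

@[simp] theorem mem_sep {a : V} {p : V → Prop} [Dfn₁ p] {x : V} :
    x ∈ᵛ sep a p ↔ (x ∈ᵛ a ∧ p x) := the_set (exists_sep p a) x

instance dfn_sep (a : E → V) (p : E → V → Prop) [ha : Dfn V a]
    [hp : Dfn V (fun x : E × V => p x.1 x.2)] : Dfn V (fun e => sep (a e) (p e)) := by
  unfold sep
  have h1 : Dfn V (fun x : (E × V) × V => p x.1.1 x.2) :=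
    Dfn.comp₂ hp (fun x : (E × V) × V => x.1.1) (fun x => x.2)
  have h2 : Dfn V (fun x : (E × V) × V => a x.1.1) := Dfn.comp ha inferInstance
  infer_instance

/-- `{F x | x ∈ a}` -/
noncomputable def image (F : V → V) (a : V) : V :=
  the (fun b => ∀ y, y ∈ᵛ b ↔ ∃ x, x ∈ᵛ a ∧ y = F x)

@[simp] theorem mem_image {F : V → V} [Dfn₁ F] {a y : V} :
    y ∈ᵛ image F a ↔ ∃ x, x ∈ᵛ a ∧ y = F x := the_set (exists_image F a) y

instance dfn_image (F : E → V → V) (a : E → V) [ha : Dfn V a]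
    [hF : Dfn V (fun x : E × V => F x.1 x.2)] : Dfn V (fun e => image (F e) (a e)) := by
  unfold image
  have h1 : Dfn V (fun x : ((E × V) × V) × V => F x.1.1.1 x.2) :=
    Dfn.comp₂ hF (fun x : ((E × V) × V) × V => x.1.1.1) (fun x => x.2)
  have h2 : Dfn V (fun x : ((E × V) × V) × V => a x.1.1.1) := Dfn.comp ha inferInstance
  infer_instance

variable (V) in
/-- The empty set. -/
noncomputable def emp : V := sep (Classical.arbitrary V) (fun _ => False)

@[simp] theorem mem_emp {x : V} : ¬ x ∈ᵛ emp V := by simp [emp]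

theorem eq_emp {a : V} (h : ∀ z, ¬ z ∈ᵛ a) : a = emp V := ext fun z => by simp [h z]

theorem ne_emp {a x : V} (h : x ∈ᵛ a) : a ≠ emp V := by rintro rfl; exact mem_emp h

theorem exists_mem {a : V} (h : a ≠ emp V) : ∃ x, x ∈ᵛ a := by
  by_contra hn
  exact h (eq_emp fun z hz => hn ⟨z, hz⟩)

/-- `{a, b}` -/
noncomputable def upair (a b : V) : V := the (fun p => ∀ z, z ∈ᵛ p ↔ (z = a ∨ z = b))

@[simp] theorem mem_upair {a b z : V} : z ∈ᵛ upair a b ↔ (z = a ∨ z = b) :=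
  the_set (hZF.models.pairing a b) z

instance dfn_upair (f g : E → V) [Dfn V f] [Dfn V g] : Dfn V (fun e => upair (f e) (g e)) :=
  Dfn.comp₂ (q := upair) (by unfold upair; infer_instance) f g

/-- `⋃ a` -/
noncomputable def sUnion (a : V) : V := the (fun b => ∀ z, z ∈ᵛ b ↔ ∃ x, x ∈ᵛ a ∧ z ∈ᵛ x)

@[simp] theorem mem_sUnion {a z : V} : z ∈ᵛ sUnion a ↔ ∃ x, x ∈ᵛ a ∧ z ∈ᵛ x :=
  the_set (hZF.models.union a) z

instance dfn_sUnion (f : E → V) [hf : Dfn V f] : Dfn V (fun e => sUnion (f e)) :=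
  Dfn₁.comp (p := sUnion) (by unfold sUnion; infer_instance) hf

/-- The power set of `a`. -/
noncomputable def pow (a : V) : V := the (fun b => ∀ z, z ∈ᵛ b ↔ Sub z a)

@[simp] theorem mem_pow {a z : V} : z ∈ᵛ pow a ↔ Sub z a := the_set (hZF.models.powerset a) z

instance dfn_subset (f g : E → V) [Dfn V f] [Dfn V g] : Dfn V (fun e => Sub (f e) (g e)) :=
  Dfn.comp₂ (q := Sub) (by unfold Sub; infer_instance) f g

instance dfn_pow (f : E → V) [hf : Dfn V f] : Dfn V (fun e => pow (f e)) :=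
  Dfn₁.comp (p := pow) (by unfold pow; infer_instance) hf

/-- `{a}` -/
noncomputable def sing (a : V) : V := upair a a

@[simp] theorem mem_sing {a z : V} : z ∈ᵛ sing a ↔ z = a := by simp [sing]

instance dfn_sing (f : E → V) [hf : Dfn V f] : Dfn V (fun e => sing (f e)) :=
  Dfn₁.comp (p := sing) (by unfold sing; infer_instance) hf

/-- `a ∪ b` -/
noncomputable def bun (a b : V) : V := sUnion (upair a b)

@[simp] theorem mem_bun {a b z : V} : z ∈ᵛ bun a b ↔ (z ∈ᵛ a ∨ z ∈ᵛ b) := by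
  simp [bun]

instance dfn_bun (f g : E → V) [Dfn V f] [Dfn V g] : Dfn V (fun e => bun (f e) (g e)) :=
  Dfn.comp₂ (q := bun) (by unfold bun; infer_instance) f g

/-- `x ∪ {x}` -/
noncomputable def suc (x : V) : V := bun x (sing x)

@[simp] theorem mem_suc {x z : V} : z ∈ᵛ suc x ↔ (z ∈ᵛ x ∨ z = x) := by simp [suc]

instance dfn_suc (f : E → V) [hf : Dfn V f] : Dfn V (fun e => suc (f e)) :=
  Dfn₁.comp (p := suc) (by unfold suc; infer_instance) hf

/-- `⟨a, b⟩` -/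
noncomputable def opair (a b : V) : V := upair (sing a) (upair a b)

instance dfn_opair (f g : E → V) [Dfn V f] [Dfn V g] : Dfn V (fun e => opair (f e) (g e)) :=
  Dfn.comp₂ (q := opair) (by unfold opair; infer_instance) f g

theorem upair_mem_opair (a b : V) : upair a b ∈ᵛ opair a b := mem_upair.2 (Or.inr rfl)

theorem isEmptySet_iff {a : V} : IsEmptySet a ↔ a = emp V :=
  ⟨eq_emp, by rintro rfl z; exact mem_emp⟩

theorem isUPair_iff {a b p : V} : IsUPair a b p ↔ p = upair a b :=
  ⟨fun h => ext fun z => by rw [h z, mem_upair], by rintro rfl z; exact mem_upair⟩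

theorem isOPair_iff {a b p : V} : IsOPair a b p ↔ p = opair a b := by
  simp only [IsOPair, isUPair_iff]
  constructor
  · rintro ⟨u, v, rfl, rfl, rfl⟩; rfl
  · rintro rfl; exact ⟨_, _, rfl, rfl, rfl⟩

theorem isSucc_iff {x y : V} : IsSucc x y ↔ y = suc x :=
  ⟨fun h => ext fun z => by rw [h z, mem_suc], by rintro rfl z; exact mem_suc⟩

theorem rel_iff {r x y : V} : Rel r x y ↔ opair x y ∈ᵛ r := by
  simp only [Rel, isOPair_iff, exists_eq_left]

theorem upair_eq {a b c d : V} (h : upair a b = upair c d) :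
    (a = c ∧ b = d) ∨ (a = d ∧ b = c) := by
  have h1 : a ∈ᵛ upair c d := h ▸ mem_upair.2 (Or.inl rfl)
  have h2 : b ∈ᵛ upair c d := h ▸ mem_upair.2 (Or.inr rfl)
  have h3 : c ∈ᵛ upair a b := h ▸ mem_upair.2 (Or.inl rfl)
  have h4 : d ∈ᵛ upair a b := h ▸ mem_upair.2 (Or.inr rfl)
  rw [mem_upair] at h1 h2 h3 h4
  grind

@[simp] theorem opair_inj {a b c d : V} : opair a b = opair c d ↔ (a = c ∧ b = d) := by
  constructor
  · intro h
    rcases upair_eq h with ⟨h1, h2⟩ | ⟨h1, h2⟩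
    · have := upair_eq h1
      have := upair_eq h2
      grind
    · have := upair_eq h1
      have := upair_eq h2
      grind
  · rintro ⟨rfl, rfl⟩; rfl

theorem exists_minimal (a : V) (h : ∃ x, x ∈ᵛ a) : ∃ x, x ∈ᵛ a ∧ ∀ y, y ∈ᵛ x → ¬ y ∈ᵛ a :=
  hZF.models.foundation a h

theorem mem_irrefl (x : V) : ¬ x ∈ᵛ x := by
  intro h
  obtain ⟨y, hy, hy'⟩ := exists_minimal (sing x) ⟨x, by simp⟩
  rw [mem_sing] at hy
  subst hy
  exact hy' y h (by simp)

theorem mem_asymm {x y : V} (h : x ∈ᵛ y) : ¬ y ∈ᵛ x := by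
  intro h'
  obtain ⟨z, hz, hz'⟩ := exists_minimal (upair x y) ⟨x, by simp⟩
  rcases mem_upair.1 hz with rfl | rfl
  · exact hz' _ h' (by simp)
  · exact hz' _ h (by simp)

/-- Induction along membership inside a transitive set. -/
theorem mem_induction {t : V} (ht : IsTransitive t) (p : V → Prop) [hp : Dfn₁ p]
    (h : ∀ x, x ∈ᵛ t → (∀ y, y ∈ᵛ x → p y) → p x) : ∀ x, x ∈ᵛ t → p x := by
  by_contra hn
  push Not at hn
  obtain ⟨x, hx, hpx⟩ := hn
  obtain ⟨y, hy, hy'⟩ := exists_minimal (sep t (fun x => ¬ p x)) ⟨x, by simp [hx, hpx]⟩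
  rw [mem_sep] at hy
  refine hy.2 (h y hy.1 fun z hz => ?_)
  by_contra hpz
  exact hy' z hz (mem_sep.2 ⟨ht y hy.1 z hz, hpz⟩)

/-! ### Cartesian products, functions -/

/-- `a × b` -/
noncomputable def prod (a b : V) : V :=
  sep (pow (pow (bun a b))) (fun p => ∃ x y, x ∈ᵛ a ∧ y ∈ᵛ b ∧ p = opair x y)

theorem mem_prod {a b p : V} : p ∈ᵛ prod a b ↔ ∃ x y, x ∈ᵛ a ∧ y ∈ᵛ b ∧ p = opair x y := by
  rw [prod, mem_sep, and_iff_right_iff_imp]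
  rintro ⟨x, y, hx, hy, rfl⟩
  rw [mem_pow]
  intro z hz
  rw [mem_pow]
  intro w hw
  rw [opair, mem_upair] at hz
  rcases hz with rfl | rfl
  · rw [mem_sing] at hw
    subst hw
    simp [hx]
  · rw [mem_upair] at hw
    rcases hw with rfl | rfl <;> simp [hx, hy]

@[simp] theorem opair_mem_prod {a b x y : V} : opair x y ∈ᵛ prod a b ↔ (x ∈ᵛ a ∧ y ∈ᵛ b) := by
  simp only [mem_prod, opair_inj]
  constructor
  · rintro ⟨x', y', h1, h2, rfl, rfl⟩; exact ⟨h1, h2⟩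
  · rintro ⟨h1, h2⟩; exact ⟨_, _, h1, h2, rfl, rfl⟩

instance dfn_cartesian (f g : E → V) [Dfn V f] [Dfn V g] : Dfn V (fun e => prod (f e) (g e)) :=
  Dfn.comp₂ (q := prod) (by unfold prod; infer_instance) f g

theorem isRelOn_iff {r a b : V} : IsRelOn r a b ↔ Sub r (prod a b) := by
  simp only [IsRelOn, isOPair_iff, Sub, mem_prod]

/-- The value of the function `f` at `x`. -/
noncomputable def app (f x : V) : V := the (fun y => opair x y ∈ᵛ f)

instance dfn_app (f g : E → V) [Dfn V f] [Dfn V g] : Dfn V (fun e => app (f e) (g e)) :=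
  Dfn.comp₂ (q := app) (by unfold app; infer_instance) f g

/-- The function `F`, restricted to the set `a`. -/
noncomputable def graph (a : V) (F : V → V) : V := image (fun x => opair x (F x)) a

instance dfn_graph (a : E → V) (F : E → V → V) [ha : Dfn V a]
    [hF : Dfn V (fun x : E × V => F x.1 x.2)] : Dfn V (fun e => graph (a e) (F e)) := by
  unfold graph
  infer_instance

@[simp] theorem mem_graph {a z : V} {F : V → V} [hF : Dfn₁ F] :
    z ∈ᵛ graph a F ↔ ∃ x, x ∈ᵛ a ∧ z = opair x (F x) := by
  have : ∀ {E : Type u} [DefType V E] (f : E → V) [Dfn V f], Dfn V (fun e => F (f e)) :=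
    fun f hf => Dfn₁.comp hF hf
  simp [graph]

theorem opair_mem_graph {a x y : V} {F : V → V} [Dfn₁ F] :
    opair x y ∈ᵛ graph a F ↔ (x ∈ᵛ a ∧ y = F x) := by
  simp only [mem_graph, opair_inj]
  constructor
  · rintro ⟨x', h1, rfl, rfl⟩; exact ⟨h1, rfl⟩
  · rintro ⟨h1, rfl⟩; exact ⟨_, h1, rfl, rfl⟩

theorem app_graph {a x : V} {F : V → V} [Dfn₁ F] (hx : x ∈ᵛ a) : app (graph a F) x = F x :=
  the_eq (opair_mem_graph.2 ⟨hx, rfl⟩) fun _ hy => (opair_mem_graph.1 hy).2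

theorem graph_congr {a : V} {F G : V → V} [Dfn₁ F] [Dfn₁ G] (h : ∀ x, x ∈ᵛ a → F x = G x) :
    graph a F = graph a G := by
  refine ext fun z => ?_
  simp only [mem_graph]
  exact exists_congr fun x => and_congr_right fun hx => by rw [h x hx]

theorem isFun_graph {a b : V} {F : V → V} [Dfn₁ F] (h : ∀ x, x ∈ᵛ a → F x ∈ᵛ b) :
    IsFun (graph a F) a b := by
  refine ⟨isRelOn_iff.2 fun z hz => ?_, fun x hx => ?_⟩
  · obtain ⟨x, hx, rfl⟩ := mem_graph.1 hz
    simp [hx, h x hx]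
  · simp only [rel_iff, opair_mem_graph, hx, true_and]
    exact ⟨F x, rfl, fun y hy => hy⟩

theorem IsFun.opair_app_mem {f a b x : V} (h : IsFun f a b) (hx : x ∈ᵛ a) :
    opair x (app f x) ∈ᵛ f := by
  have := h.2 x hx
  simp only [rel_iff] at this
  exact the_spec (p := fun y => opair x y ∈ᵛ f) this

theorem IsFun.opair_mem_iff {f a b x y : V} (h : IsFun f a b) :
    opair x y ∈ᵛ f ↔ (x ∈ᵛ a ∧ y = app f x) := by
  constructor
  · intro hxy
    have hx : x ∈ᵛ a := (opair_mem_prod.1 (isRelOn_iff.1 h.1 _ hxy)).1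
    refine ⟨hx, ?_⟩
    exact (h.2 x hx).unique (rel_iff.2 hxy) (rel_iff.2 (h.opair_app_mem hx))
  · rintro ⟨hx, rfl⟩
    exact h.opair_app_mem hx

theorem IsFun.app_mem {f a b x : V} (h : IsFun f a b) (hx : x ∈ᵛ a) : app f x ∈ᵛ b :=
  (opair_mem_prod.1 (isRelOn_iff.1 h.1 _ (h.opair_app_mem hx))).2

theorem IsFun.eq_graph {f a b : V} (h : IsFun f a b) : f = graph a (app f) := by
  refine ext fun z => ?_
  rw [mem_graph]
  constructor
  · intro hz
    obtain ⟨x, y, hx, hy, rfl⟩ := mem_prod.1 (isRelOn_iff.1 h.1 _ hz)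
    exact ⟨x, hx, by rw [← (h.opair_mem_iff.1 hz).2]⟩
  · rintro ⟨x, hx, rfl⟩
    exact h.opair_app_mem hx

theorem IsFun.eq_of_app {f g a b c : V} (hf : IsFun f a b) (hg : IsFun g a c)
    (h : ∀ x, x ∈ᵛ a → app f x = app g x) : f = g := by
  rw [hf.eq_graph, hg.eq_graph]
  exact graph_congr h

theorem IsFun.mono {f a b c : V} (hf : IsFun f a b) (h : Sub b c) : IsFun f a c := by
  rw [hf.eq_graph]
  exact isFun_graph fun x hx => h _ (hf.app_mem hx)

instance dfn_isRelOn (f g h : E → V) [Dfn V f] [Dfn V g] [Dfn V h] :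
    Dfn V (fun e => IsRelOn (f e) (g e) (h e)) :=
  Dfn.congr (f := fun e => Sub (f e) (prod (g e) (h e))) inferInstance
    fun _ => propext isRelOn_iff

instance dfn_rel (f g h : E → V) [Dfn V f] [Dfn V g] [Dfn V h] :
    Dfn V (fun e => Rel (f e) (g e) (h e)) :=
  Dfn.congr (f := fun e => opair (g e) (h e) ∈ᵛ f e) inferInstance
    fun _ => propext rel_iff

instance dfn_isFun (f g h : E → V) [Dfn V f] [Dfn V g] [Dfn V h] :
    Dfn V (fun e => IsFun (f e) (g e) (h e)) :=
  Dfn.comp₃ (q := IsFun) (by unfold IsFun; infer_instance) f g h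

theorem isInj_iff {f a b : V} : IsInj f a b ↔ IsFun f a b ∧
    ∀ x, x ∈ᵛ a → ∀ y, y ∈ᵛ a → app f x = app f y → x = y := by
  refine and_congr_right fun h => ?_
  simp only [rel_iff, h.opair_mem_iff]
  constructor
  · intro H x hx y hy hxy
    exact H x y _ ⟨hx, rfl⟩ ⟨hy, hxy⟩
  · rintro H x x' y ⟨hx, rfl⟩ ⟨hx', hy⟩
    exact H x hx x' hx' hy

theorem isSurj_iff {f a b : V} : IsSurj f a b ↔ IsFun f a b ∧
    ∀ y, y ∈ᵛ b → ∃ x, x ∈ᵛ a ∧ y = app f x := by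
  refine and_congr_right fun h => ?_
  simp only [rel_iff, h.opair_mem_iff]

instance dfn_isSurj (f g h : E → V) [Dfn V f] [Dfn V g] [Dfn V h] :
    Dfn V (fun e => IsSurj (f e) (g e) (h e)) :=
  Dfn.comp₃ (q := IsSurj) (by unfold IsSurj; infer_instance) f g h

/-- The set of functions from `a` to `b`. -/
noncomputable def funs (a b : V) : V := sep (pow (prod a b)) (fun f => IsFun f a b)

@[simp] theorem mem_funs {a b f : V} : f ∈ᵛ funs a b ↔ IsFun f a b := by
  rw [funs, mem_sep, mem_pow, ← isRelOn_iff]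
  exact ⟨fun h => h.2, fun h => ⟨h.1, h⟩⟩

/-! ### Natural numbers -/

theorem isInductive_iff {w : V} : IsInductive w ↔ emp V ∈ᵛ w ∧ ∀ x, x ∈ᵛ w → suc x ∈ᵛ w := by
  simp only [IsInductive, isEmptySet_iff, isSucc_iff, exists_eq_left]

instance dfn_isInductive (f : E → V) [hf : Dfn V f] : Dfn V (fun e => IsInductive (f e)) :=
  Dfn.congr (f := fun e => emp V ∈ᵛ f e ∧ ∀ x, x ∈ᵛ f e → suc x ∈ᵛ f e)
    (Dfn₁.comp (p := fun w => emp V ∈ᵛ w ∧ ∀ x, x ∈ᵛ w → suc x ∈ᵛ w) inferInstance hf)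
    fun _ => propext isInductive_iff

variable (V) in
/-- The set of natural numbers. -/
noncomputable def omega : V :=
  sep hZF.models.infinity.choose (fun x => ∀ w, IsInductive w → x ∈ᵛ w)

theorem mem_omega {x : V} : x ∈ᵛ omega V ↔ ∀ w, IsInductive w → x ∈ᵛ w := by
  rw [omega, mem_sep, and_iff_right_iff_imp]
  exact fun h => h _ hZF.models.infinity.choose_spec

@[simp] theorem emp_mem_omega : emp V ∈ᵛ omega V :=
  mem_omega.2 fun _ hw => (isInductive_iff.1 hw).1

theorem suc_mem_omega {n : V} (h : n ∈ᵛ omega V) : suc n ∈ᵛ omega V :=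
  mem_omega.2 fun w hw => (isInductive_iff.1 hw).2 _ (mem_omega.1 h w hw)

theorem isOmega_omega : IsOmega (omega V) :=
  ⟨isInductive_iff.2 ⟨emp_mem_omega, fun _ => suc_mem_omega⟩, fun w hw _ hx => mem_omega.1 hx w hw⟩

theorem isOmega_iff {w : V} : IsOmega w ↔ w = omega V := by
  constructor
  · intro h
    exact ext fun z => ⟨fun hz => h.2 _ isOmega_omega.1 z hz,
      fun hz => isOmega_omega.2 _ h.1 z hz⟩
  · rintro rfl
    exact isOmega_omega

theorem isNat_iff {n : V} : IsNat n ↔ n ∈ᵛ omega V := by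
  simp only [IsNat, isOmega_iff, exists_eq_left]

theorem nat_induction (p : V → Prop) [Dfn₁ p] (h0 : p (emp V))
    (hs : ∀ n, n ∈ᵛ omega V → p n → p (suc n)) : ∀ n, n ∈ᵛ omega V → p n := by
  intro n hn
  have : IsInductive (sep (omega V) p) := by
    rw [isInductive_iff]
    refine ⟨by simp [h0], fun x hx => ?_⟩
    rw [mem_sep] at hx ⊢
    exact ⟨suc_mem_omega hx.1, hs x hx.1 hx.2⟩
  exact (mem_sep.1 (mem_omega.1 hn _ this)).2

theorem isTransitive_omega : IsTransitive (omega V) := by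
  intro n hn
  revert n
  refine nat_induction (fun n => Sub n (omega V)) (fun z hz => (mem_emp hz).elim)
    fun n hn ih z hz => ?_
  rcases mem_suc.1 hz with h | rfl
  · exact ih z h
  · exact hn

theorem isTransitive_nat {n : V} (hn : n ∈ᵛ omega V) : IsTransitive n := by
  refine nat_induction (fun n => ∀ x, x ∈ᵛ n → Sub x n) (by simp) (fun n hn ih x hx z hz => ?_)
    n hn
  rcases mem_suc.1 hx with h | rfl
  · exact mem_suc.2 (Or.inl (ih x h z hz))
  · exact mem_suc.2 (Or.inl hz)

theorem nat_cases {n : V} (hn : n ∈ᵛ omega V) : n = emp V ∨ ∃ m, m ∈ᵛ omega V ∧ n = suc m := by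
  exact nat_induction (fun n => n = emp V ∨ ∃ m, m ∈ᵛ omega V ∧ n = suc m) (Or.inl rfl)
    (fun n hn _ => Or.inr ⟨n, hn, rfl⟩) n hn

/-- Least element of a non-empty definable set of natural numbers. -/
theorem nat_least (p : V → Prop) [Dfn₁ p] (h : ∃ n, n ∈ᵛ omega V ∧ p n) :
    ∃ n, n ∈ᵛ omega V ∧ p n ∧ ∀ m, m ∈ᵛ n → ¬ p m := by
  obtain ⟨n, hn, hp⟩ := h
  obtain ⟨m, hm, hm'⟩ := exists_minimal (sep (omega V) p) ⟨n, mem_sep.2 ⟨hn, hp⟩⟩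
  rw [mem_sep] at hm
  exact ⟨m, hm.1, hm.2, fun k hk hpk => hm' k hk
    (mem_sep.2 ⟨isTransitive_omega m hm.1 k hk, hpk⟩)⟩

theorem emp_mem_suc {n : V} (hn : n ∈ᵛ omega V) : emp V ∈ᵛ suc n := by
  exact nat_induction (fun n => emp V ∈ᵛ suc n) (by simp)
    (fun n hn ih => mem_suc.2 (Or.inl ih)) n hn

theorem nat_trichotomy {m n : V} (hm : m ∈ᵛ omega V) (hn : n ∈ᵛ omega V) :
    m ∈ᵛ n ∨ m = n ∨ n ∈ᵛ m := by
  refine nat_induction (fun n => m ∈ᵛ n ∨ m = n ∨ n ∈ᵛ m) ?_ (fun n hn ih => ?_) n hn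
  · have := emp_mem_suc hm
    rw [mem_suc] at this
    tauto
  · simp only [mem_suc]
    rcases ih with h | rfl | h
    · exact Or.inl (Or.inl h)
    · exact Or.inl (Or.inr rfl)
    · right
      have : ∀ m, m ∈ᵛ omega V → n ∈ᵛ m → suc n = m ∨ suc n ∈ᵛ m := by
        refine nat_induction (fun m => n ∈ᵛ m → suc n = m ∨ suc n ∈ᵛ m)
          (fun h => (mem_emp h).elim) fun m hm ih h => ?_
        simp only [mem_suc] at h ⊢
        rcases h with h | rfl
        · rcases ih h with h | h
          · exact Or.inr (Or.inr h)
          · exact Or.inr (Or.inl h)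
        · exact Or.inl rfl
      exact (this m hm h).imp Eq.symm id

theorem suc_mem_suc {m n : V} (hn : n ∈ᵛ omega V) (h : m ∈ᵛ n) : suc m ∈ᵛ suc n := by
  have hm := isTransitive_omega n hn m h
  rcases nat_trichotomy (suc_mem_omega hm) (suc_mem_omega hn) with h1 | h1 | h1
  · exact h1
  · have : n ∈ᵛ suc m := h1 ▸ mem_suc.2 (Or.inr rfl)
    rcases mem_suc.1 this with h2 | rfl
    · exact (mem_asymm h h2).elim
    · exact (mem_irrefl _ h).elim
  · rcases mem_suc.1 h1 with h2 | h2
    · have : n ∈ᵛ m := isTransitive_nat hm _ h2 _ (mem_suc.2 (Or.inr rfl))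
      exact (mem_asymm h this).elim
    · exact (mem_irrefl n (isTransitive_nat hn m h n (h2 ▸ mem_suc.2 (Or.inr rfl)))).elim

theorem sUnion_suc {n : V} (hn : n ∈ᵛ omega V) : sUnion (suc n) = n := by
  refine ext fun z => ?_
  simp only [mem_sUnion, mem_suc]
  constructor
  · rintro ⟨x, hx | rfl, hz⟩
    · exact isTransitive_nat hn x hx z hz
    · exact hz
  · exact fun hz => ⟨n, Or.inr rfl, hz⟩

theorem suc_ne_emp (n : V) : suc n ≠ emp V := ne_emp (mem_suc.2 (Or.inr rfl))

end ZF

/-! ### Recursion -/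

section Recursion

variable {V : Type u} [SetModel V] [hZF : ZF V]

open Classical in
/-- Recursion along a definable relation that is well-founded on a set `X`. -/
theorem wf_recursion (X : V) (r : V → V → Prop) [hr : Dfn V (fun x : V × V => r x.1 x.2)]
    (hwf : ∀ b, Sub b X → (∃ x, x ∈ᵛ b) → ∃ x, x ∈ᵛ b ∧ ∀ y, y ∈ᵛ b → ¬ r y x)
    (G : V → V → V) [hG : Dfn V (fun x : V × V => G x.1 x.2)] :
    ∃ f, ∀ x, x ∈ᵛ X → app f x = G x (graph (sep X (fun y => r y x)) (app f)) := by
  have hr' : ∀ {E : Type u} [DefType V E] (f g : E → V) [Dfn V f] [Dfn V g],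
    Dfn V (fun e => r (f e) (g e)) := fun f g _ _ => Dfn.comp₂ hr f g
  have hG' : ∀ {E : Type u} [DefType V E] (f g : E → V) [Dfn V f] [Dfn V g],
    Dfn V (fun e => G (f e) (g e)) := fun f g _ _ => Dfn.comp₂ hG f g
  -- `A h d` says that `h` obeys the recursion on the downward closed set `d`. What `h` does outside
  -- `d` is irrelevant.
  let A : V → V → Prop := fun h d => Sub d X ∧
    (∀ x, x ∈ᵛ d → ∀ y, y ∈ᵛ X → r y x → y ∈ᵛ d) ∧
    ∀ x, x ∈ᵛ d → app h x = G x (graph (sep X (fun y => r y x)) (app h))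
  have hA : ∀ {E : Type u} [DefType V E] (f g : E → V) [Dfn V f] [Dfn V g],
    Dfn V (fun e => A (f e) (g e)) := fun f g _ _ =>
      Dfn.comp₂ (q := A) (by unfold A; infer_instance) f g
  have agree : ∀ h d h' d', A h d → A h' d' → ∀ x, x ∈ᵛ d → x ∈ᵛ d' → app h x = app h' x := by
    intro h d h' d' H H'
    by_contra hn
    push Not at hn
    obtain ⟨x, hx, hx', hne⟩ := hn
    obtain ⟨x, hx, hmin⟩ := hwf (sep X (fun x => x ∈ᵛ d ∧ x ∈ᵛ d' ∧ app h x ≠ app h' x))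
      (fun z hz => (mem_sep.1 hz).1) ⟨x, mem_sep.2 ⟨H.1 x hx, hx, hx', hne⟩⟩
    rw [mem_sep] at hx
    obtain ⟨hxX, hxd, hxd', hne⟩ := hx
    apply hne
    rw [H.2.2 x hxd, H'.2.2 x hxd']
    congr 1
    refine graph_congr fun y hy => ?_
    rw [mem_sep] at hy
    by_contra hyne
    exact hmin y (mem_sep.2 ⟨hy.1, H.2.1 x hxd y hy.1 hy.2, H'.2.1 x hxd' y hy.1 hy.2, hyne⟩) hy.2
  let F : V → V := fun x => the (fun y => ∃ h d, A h d ∧ x ∈ᵛ d ∧ y = app h x)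
  have hF' : ∀ {E : Type u} [DefType V E] (f : E → V) [Dfn V f], Dfn V (fun e => F (f e)) :=
    fun f hf => Dfn₁.comp (p := F) (by unfold F; infer_instance) hf
  have hF : ∀ h d x, A h d → x ∈ᵛ d → F x = app h x := fun h d x H hx =>
    the_eq (p := fun y => ∃ h d, A h d ∧ x ∈ᵛ d ∧ y = app h x) ⟨h, d, H, hx, rfl⟩
      fun y ⟨h', d', H', hx', hy⟩ => hy.trans (agree h' d' h d H' H x hx' hx)
  let D : V := sep X (fun x => ∃ h d, A h d ∧ x ∈ᵛ d)
  have hDX : Sub D X := fun x hx => (mem_sep.1 hx).1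
  have hf : ∀ x, x ∈ᵛ X → app (graph X F) x = F x := fun x hx => app_graph hx
  have hclosed : ∀ x, x ∈ᵛ D → ∀ y, y ∈ᵛ X → r y x → y ∈ᵛ D := by
    intro x hx y hy hyx
    obtain ⟨hxX, h, d, H, hxd⟩ := mem_sep.1 hx
    exact mem_sep.2 ⟨hy, h, d, H, H.2.1 x hxd y hy hyx⟩
  have hrec : ∀ x, x ∈ᵛ D →
      app (graph X F) x = G x (graph (sep X (fun y => r y x)) (app (graph X F))) := by
    intro x hx
    obtain ⟨hxX, h, d, H, hxd⟩ := mem_sep.1 hx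
    rw [hf x hxX, hF h d x H hxd, H.2.2 x hxd]
    congr 1
    refine graph_congr fun y hy => ?_
    rw [mem_sep] at hy
    rw [hf y hy.1, hF h d y H (H.2.1 x hxd y hy.1 hy.2)]
  refine ⟨graph X F, fun x hx => hrec x ?_⟩
  by_contra hxD
  obtain ⟨x, hx, hmin⟩ := hwf (sep X (fun x => ¬ x ∈ᵛ D)) (fun z hz => (mem_sep.1 hz).1)
    ⟨x, mem_sep.2 ⟨hx, hxD⟩⟩
  obtain ⟨hxX, hxD⟩ := mem_sep.1 hx
  have hpred : ∀ y, y ∈ᵛ X → r y x → y ∈ᵛ D := by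
    intro y hy hyx
    by_contra hyD
    exact hmin y (mem_sep.2 ⟨hy, hyD⟩) hyx
  -- All predecessors of the minimal bad `x` are covered by approximations, so one more value gives
  -- an approximation at `x` itself, a contradiction.
  let h := graph (bun D (sing x))
    (fun y => if y = x then G x (graph (sep X (fun y => r y x)) (app (graph X F))) else F y)
  have h1 : app h x = G x (graph (sep X (fun y => r y x)) (app (graph X F))) := by
    rw [app_graph (by simp)]
    simp
  have h2 : ∀ y, y ∈ᵛ D → app h y = app (graph X F) y := by
    intro y hy
    rw [app_graph (by simp [hy]), hf y (hDX y hy), if_neg]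
    rintro rfl
    exact hxD hy
  refine hxD (mem_sep.2 ⟨hxX, h, bun D (sing x), ⟨?_, ?_, ?_⟩, by simp⟩)
  · intro z hz
    rcases mem_bun.1 hz with hz | hz
    · exact hDX z hz
    · rw [mem_sing.1 hz]; exact hxX
  · intro z hz y hy hyz
    rcases mem_bun.1 hz with hz | hz
    · exact mem_bun.2 (Or.inl (hclosed z hz y hy hyz))
    · rw [mem_sing.1 hz] at hyz
      exact mem_bun.2 (Or.inl (hpred y hy hyz))
  · intro z hz
    rcases mem_bun.1 hz with hz | hz
    · rw [h2 z hz, hrec z hz]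
      congr 1
      refine graph_congr fun y hy => ?_
      rw [mem_sep] at hy
      rw [h2 y (hclosed z hz y hy.1 hy.2)]
    · rw [mem_sing.1 hz, h1]
      congr 1
      refine graph_congr fun y hy => ?_
      rw [mem_sep] at hy
      rw [h2 y (hpred y hy.1 hy.2)]

/-- Recursion along membership on a transitive set. -/
theorem mem_recursion (X : V) (hX : IsTransitive X) (G : V → V → V)
    [hG : Dfn V (fun x : V × V => G x.1 x.2)] :
    ∃ f, ∀ x, x ∈ᵛ X → app f x = G x (graph x (app f)) := by
  obtain ⟨f, hf⟩ := wf_recursion X (fun y x => y ∈ᵛ x) (fun b _ hb => by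
    obtain ⟨x, hx, hx'⟩ := exists_minimal b hb
    exact ⟨x, hx, fun y hy hyx => hx' y hyx hy⟩) G
  refine ⟨f, fun x hx => ?_⟩
  rw [hf x hx]
  congr 2
  exact ext fun z => by rw [mem_sep]; exact ⟨fun h => h.2, fun h => ⟨hX x hx z h, h⟩⟩

open Classical in
theorem nat_recursion (a : V) (F : V → V) [hF : Dfn₁ F] :
    ∃ f, app f (emp V) = a ∧ ∀ n, n ∈ᵛ omega V → app f (suc n) = F (app f n) := by
  have hF' : ∀ {E : Type u} [DefType V E] (f : E → V) [Dfn V f], Dfn V (fun e => F (f e)) :=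
    fun f hf => Dfn₁.comp hF hf
  -- The predecessor of a nonzero natural number is its union.
  obtain ⟨f, hf⟩ := mem_recursion (omega V) isTransitive_omega
    (fun n h => if n = emp V then a else F (app h (sUnion n)))
  refine ⟨f, by rw [hf _ emp_mem_omega, if_pos rfl], fun n hn => ?_⟩
  rw [hf _ (suc_mem_omega hn), if_neg (suc_ne_emp n), sUnion_suc hn, app_graph (by simp)]

/-! ### Transitive closure -/

/-- The closure is the union of the sets obtained from `x` by iterating `sUnion`. -/
theorem exists_isTC (x : V) : ∃ t, IsTC x t := by
  obtain ⟨f, hf0, hf⟩ := nat_recursion x (sUnion : V → V)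
  have ht : ∀ z, z ∈ᵛ sUnion (image (app f) (omega V)) ↔ ∃ n, n ∈ᵛ omega V ∧ z ∈ᵛ app f n := by
    intro z
    simp only [mem_sUnion, mem_image]
    constructor
    · rintro ⟨_, ⟨n, hn, rfl⟩, hz⟩; exact ⟨n, hn, hz⟩
    · rintro ⟨n, hn, hz⟩; exact ⟨_, ⟨n, hn, rfl⟩, hz⟩
  refine ⟨sUnion (image (app f) (omega V)), fun y hy z hz => ?_, fun y hy => ?_, ?_⟩
  · obtain ⟨n, hn, hy⟩ := (ht y).1 hy
    refine (ht z).2 ⟨suc n, suc_mem_omega hn, ?_⟩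
    rw [hf n hn, mem_sUnion]
    exact ⟨y, hy, hz⟩
  · exact (ht y).2 ⟨emp V, emp_mem_omega, by rwa [hf0]⟩
  · intro t' ht' hx y hy
    obtain ⟨n, hn, hy⟩ := (ht y).1 hy
    refine nat_induction (fun n => Sub (app f n) t') (by rwa [hf0]) (fun n hn ih => ?_) n hn y hy
    rw [hf n hn]
    intro z hz
    obtain ⟨w, hw, hz⟩ := mem_sUnion.1 hz
    exact ht' w (ih w hw) z hz

theorem IsTC.sub {x y t s : V} (hx : IsTC x t) (hy : IsTC y s) (h : x ∈ᵛ y) : Sub t s :=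
  hx.2.2 s hy.1 (hy.1 x (hy.2.1 x h))

variable {E : Type u} [DefType V E]

instance dfn_isTransitive (f : E → V) [hf : Dfn V f] : Dfn V (fun e => IsTransitive (f e)) :=
  Dfn₁.comp (p := IsTransitive) (by unfold IsTransitive; infer_instance) hf

instance dfn_isTC (f g : E → V) [Dfn V f] [Dfn V g] : Dfn V (fun e => IsTC (f e) (g e)) :=
  Dfn.comp₂ (q := IsTC) (by unfold IsTC; infer_instance) f g

instance dfn_isOrdinal (f : E → V) [hf : Dfn V f] : Dfn V (fun e => IsOrdinal (f e)) :=
  Dfn₁.comp (p := IsOrdinal) (by unfold IsOrdinal; infer_instance) hf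

/-! ### Surjections -/

open Classical in
theorem surj_mono {a b c d f : V} (hf : IsSurj f a c) (hab : Sub a b) (hdc : Sub d c)
    (hd : ∃ x, x ∈ᵛ d) : ∃ g, IsSurj g b d := by
  obtain ⟨x₀, hx₀⟩ := hd
  rw [isSurj_iff] at hf
  -- Arguments outside `a`, and those whose value leaves `d`, are sent to `x₀`; this is why `d` must
  -- be nonempty.
  refine ⟨graph b (fun x => if x ∈ᵛ a ∧ app f x ∈ᵛ d then app f x else x₀), isSurj_iff.2 ⟨?_, ?_⟩⟩
  · refine isFun_graph fun x _ => ?_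
    split_ifs with h
    · exact h.2
    · exact hx₀
  · intro y hy
    obtain ⟨x, hx, rfl⟩ := hf.2 y (hdc y hy)
    exact ⟨x, hab x hx, by rw [app_graph (hab x hx), if_pos ⟨hx, hy⟩]⟩

theorem isSurj_id (a : V) : IsSurj (graph a (fun x => x)) a a :=
  isSurj_iff.2 ⟨isFun_graph fun _ h => h, fun y hy => ⟨y, hy, by rw [app_graph hy]⟩⟩

theorem surj_comp {a b c f g : V} (hf : IsSurj f a b) (hg : IsSurj g b c) :
    ∃ h, IsSurj h a c := by
  rw [isSurj_iff] at hf hg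
  refine ⟨graph a (fun x => app g (app f x)), isSurj_iff.2
    ⟨isFun_graph fun x hx => hg.1.app_mem (hf.1.app_mem hx), fun z hz => ?_⟩⟩
  obtain ⟨y, hy, rfl⟩ := hg.2 z hz
  obtain ⟨x, hx, rfl⟩ := hf.2 y hy
  exact ⟨x, hx, by rw [app_graph hx]⟩

/-! ### Ordinals -/

theorem mem_no_cycle {x y z : V} (h1 : x ∈ᵛ y) (h2 : y ∈ᵛ z) : ¬ z ∈ᵛ x := by
  intro h3
  obtain ⟨w, hw, hw'⟩ := exists_minimal (bun (upair x y) (sing z)) ⟨x, by simp⟩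
  simp only [mem_bun, mem_upair, mem_sing] at hw hw'
  rcases hw with (rfl | rfl) | rfl
  · exact hw' z h3 (by simp)
  · exact hw' x h1 (by simp)
  · exact hw' y h2 (by simp)

theorem IsOrdinal.mem {a b : V} (ha : IsOrdinal a) (hb : b ∈ᵛ a) : IsOrdinal b := by
  refine ⟨fun x hx z hz => ?_, fun x y hx hy => ha.2 x y (ha.1 b hb x hx) (ha.1 b hb y hy)⟩
  have hxa := ha.1 b hb x hx
  rcases ha.2 z b (ha.1 x hxa z hz) hb with h | rfl | h
  · exact h
  · exact (mem_asymm hx hz).elim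
  · exact (mem_no_cycle hz hx h).elim

/-- A membership-minimal element of `a` outside `c` has exactly the elements of `c`. -/
theorem IsOrdinal.mem_of_ssub {a c : V} (ha : IsOrdinal a) (hc : IsTransitive c) (h : Sub c a)
    (hne : c ≠ a) : c ∈ᵛ a := by
  obtain ⟨x, hx, hmin⟩ := exists_minimal (sep a (fun x => ¬ x ∈ᵛ c)) (by
    by_contra hn
    refine hne (ext fun z => ⟨h z, fun hz => ?_⟩)
    by_contra hzc
    exact hn ⟨z, mem_sep.2 ⟨hz, hzc⟩⟩)
  obtain ⟨hxa, hxc⟩ := mem_sep.1 hx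
  obtain rfl : c = x := by
    refine ext fun z => ⟨fun hz => ?_, fun hz => ?_⟩
    · rcases ha.2 z x (h z hz) hxa with h1 | rfl | h1
      · exact h1
      · exact (hxc hz).elim
      · exact (hxc (hc z hz x h1)).elim
    · by_contra hzc
      exact hmin z hz (mem_sep.2 ⟨ha.1 x hxa z hz, hzc⟩)
  exact hxa

/-- The intersection is a transitive subset of both ordinals. If it were proper in both, it would
belong to both and hence to itself. -/
theorem IsOrdinal.trichotomy {a b : V} (ha : IsOrdinal a) (hb : IsOrdinal b) :
    a ∈ᵛ b ∨ a = b ∨ b ∈ᵛ a := by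
  let c := sep a (fun x => x ∈ᵛ b)
  have hc : IsTransitive c := by
    intro x hx z hz
    obtain ⟨hx1, hx2⟩ := mem_sep.1 hx
    exact mem_sep.2 ⟨ha.1 x hx1 z hz, hb.1 x hx2 z hz⟩
  have hca : Sub c a := fun z hz => (mem_sep.1 hz).1
  have hcb : Sub c b := fun z hz => (mem_sep.1 hz).2
  by_cases h1 : c = a
  · by_cases h2 : c = b
    · exact Or.inr (Or.inl (h1.symm.trans h2))
    · exact Or.inl (h1 ▸ hb.mem_of_ssub hc hcb h2)
  · by_cases h2 : c = b
    · exact Or.inr (Or.inr (h2 ▸ ha.mem_of_ssub hc hca h1))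
    · exact (mem_irrefl c (mem_sep.2 ⟨ha.mem_of_ssub hc hca h1, hb.mem_of_ssub hc hcb h2⟩)).elim

theorem isOrdinal_omega : IsOrdinal (omega V) :=
  ⟨isTransitive_omega, fun _ _ hx hy => nat_trichotomy hx hy⟩

/-- Two surjections onto ordinals which induce the same prewellorder have the same range. -/
theorem ordinal_eq_of_surj {T a b f g : V} (ha : IsOrdinal a) (hb : IsOrdinal b)
    (hf : IsSurj f T a) (hg : IsSurj g T b)
    (h : ∀ x, x ∈ᵛ T → ∀ y, y ∈ᵛ T → (app f x ∈ᵛ app f y ↔ app g x ∈ᵛ app g y)) : a = b := by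
  rw [isSurj_iff] at hf hg
  -- By induction on the value, `f` and `g` agree pointwise: each value is the set of the values
  -- below it.
  have key : ∀ c, c ∈ᵛ a → ∀ x, x ∈ᵛ T → app f x = c → app g x = c := by
    refine mem_induction ha.1 (fun c => ∀ x, x ∈ᵛ T → app f x = c → app g x = c) ?_
    rintro c hc ih x hx rfl
    refine ext fun z => ⟨fun hz => ?_, fun hz => ?_⟩
    · obtain ⟨y, hy, rfl⟩ := hg.2 z (hb.1 _ (hg.1.app_mem hx) z hz)
      have := (h y hy x hx).2 hz
      rwa [ih _ this y hy rfl]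
    · obtain ⟨y, hy, rfl⟩ := hf.2 z (ha.1 _ hc z hz)
      rw [← ih _ hz y hy rfl]
      exact (h y hy x hx).1 hz
  refine ext fun z => ⟨fun hz => ?_, fun hz => ?_⟩
  · obtain ⟨x, hx, rfl⟩ := hf.2 z hz
    rw [← key _ hz x hx rfl]
    exact hg.1.app_mem hx
  · obtain ⟨x, hx, rfl⟩ := hg.2 z hz
    rw [key _ (hf.1.app_mem hx) x hx rfl]
    exact hf.1.app_mem hx

/-- The ordinals onto which `T` can be mapped form a set. -/
theorem exists_surj_ordinals (T : V) :
    ∃ K : V, ∀ a, a ∈ᵛ K ↔ (IsOrdinal a ∧ ∃ f, IsSurj f T a) := by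
  -- `R f` is the strict prewellorder that `f` induces on `T`. It determines the ordinal, so these
  -- ordinals form part of an image of the power set of `T × T`, and replacement applies.
  let R : V → V := fun f =>
    sep (prod T T) (fun p => ∃ x y, p = opair x y ∧ app f x ∈ᵛ app f y)
  have hR : ∀ {E : Type u} [DefType V E] (f : E → V) [Dfn V f], Dfn V (fun e => R (f e)) :=
    fun f hf => Dfn₁.comp (p := R) (by unfold R; infer_instance) hf
  let F : V → V := fun r => the (fun a => IsOrdinal a ∧ ∃ f, IsSurj f T a ∧ r = R f)
  have hF : Dfn₁ F := by unfold F; infer_instance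
  refine ⟨sep (image F (pow (prod T T))) (fun a => IsOrdinal a ∧ ∃ f, IsSurj f T a), fun a => ?_⟩
  rw [mem_sep, and_iff_right_iff_imp]
  rintro ⟨ha, f, hf⟩
  rw [mem_image]
  refine ⟨R f, mem_pow.2 fun z hz => (mem_sep.1 hz).1, Eq.symm ?_⟩
  refine the_eq (p := fun a => IsOrdinal a ∧ ∃ g, IsSurj g T a ∧ R f = R g) ⟨ha, f, hf, rfl⟩ ?_
  rintro b ⟨hb, g, hg, hfg⟩
  refine ordinal_eq_of_surj hb ha hg hf fun x hx y hy => ?_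
  have h1 : opair x y ∈ᵛ R f ↔ opair x y ∈ᵛ R g := by rw [hfg]
  simp only [R, mem_sep, opair_mem_prod, hx, hy, true_and, opair_inj] at h1
  grind

/-- There are arbitrarily large alephs onto which `T` cannot be mapped. -/
theorem exists_isAleph (T : V) (hT : Sub (omega V) T) :
    ∃ k, IsAleph k ∧ (¬ ∃ f, IsSurj f T k) ∧ ∀ a, IsOrdinal a → Sub a T → a ∈ᵛ k := by
  obtain ⟨K, hK⟩ := exists_surj_ordinals T
  -- The nonempty set `T` has no map into `∅`, so `∅` is missing from `K` and has to be added to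
  -- obtain an ordinal.
  have hmem : ∀ a, a ∈ᵛ bun K (sing (emp V)) ↔ a ∈ᵛ K ∨ a = emp V := by simp
  have hord : ∀ a, a ∈ᵛ bun K (sing (emp V)) → IsOrdinal a := by
    intro a ha
    rcases (hmem a).1 ha with h | rfl
    · exact ((hK a).1 h).1
    · exact isOrdinal_omega.mem emp_mem_omega
  have hk : IsOrdinal (bun K (sing (emp V))) := by
    refine ⟨fun a ha z hz => ?_, fun x y hx hy => (hord x hx).trichotomy (hord y hy)⟩
    rcases (hmem a).1 ha with h | rfl
    · by_cases hz0 : z = emp V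
      · exact (hmem z).2 (Or.inr hz0)
      · obtain ⟨ho, f, hf⟩ := (hK a).1 h
        exact (hmem z).2 (Or.inl ((hK z).2 ⟨ho.mem hz, surj_mono hf (fun _ h => h) (ho.1 z hz)
          (exists_mem hz0)⟩))
    · exact (mem_emp hz).elim
  have hns : ¬ ∃ f, IsSurj f T (bun K (sing (emp V))) := fun h =>
    mem_irrefl _ ((hmem _).2 (Or.inl ((hK _).2 ⟨hk, h⟩)))
  have hlarge : ∀ a, IsOrdinal a → Sub a T → a ∈ᵛ bun K (sing (emp V)) := by
    intro a ha haT
    by_cases h0 : a = emp V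
    · exact (hmem a).2 (Or.inr h0)
    · exact (hmem a).2 (Or.inl ((hK a).2
        ⟨ha, surj_mono (isSurj_id a) haT (fun _ h => h) (exists_mem h0)⟩))
  refine ⟨_, ⟨hk, ⟨omega V, isOmega_omega, hk.1 _ (hlarge _ isOrdinal_omega hT)⟩, ?_⟩, hns, hlarge⟩
  -- A surjection from a smaller ordinal, composed with one from `T`, would map `T` onto the new
  -- ordinal.
  rintro b hb ⟨f, -, hf⟩
  rcases (hmem b).1 hb with h | rfl
  · obtain ⟨g, hg⟩ := ((hK b).1 h).2
    exact hns (surj_comp hg hf)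
  · obtain ⟨x, hx, -⟩ := (isSurj_iff.1 hf).2 _ hb
    exact mem_emp hx

/-! ### The sets `H_k` -/

open Classical in
-- It suffices to place every transitive set that does not map onto `k` inside level `k` of the
-- cumulative hierarchy; separation does the rest. Only the rank function is used, so no choice
-- enters.
theorem exists_isH (k : V) (hk : IsAleph k) : ∃ h, IsH k h := by
  have hok := hk.1
  have hk0 : emp V ∈ᵛ k := by
    obtain ⟨w, hw, hwk⟩ := hk.2.1
    rw [isOmega_iff] at hw
    subst hw
    exact hwk _ emp_mem_omega
  -- `C` is the cumulative hierarchy below `k`, and `U` below is its level `k`.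
  obtain ⟨C, hC⟩ := mem_recursion k hok.1
    (fun b h => sUnion (image (fun c => pow (app h c)) b))
  replace hC : ∀ b, b ∈ᵛ k → ∀ z, z ∈ᵛ app C b ↔ ∃ c, c ∈ᵛ b ∧ Sub z (app C c) := by
    intro b hb z
    rw [hC b hb]
    simp only [mem_sUnion, mem_image]
    constructor
    · rintro ⟨_, ⟨c, hc, rfl⟩, hz⟩
      rw [app_graph hc, mem_pow] at hz
      exact ⟨c, hc, hz⟩
    · rintro ⟨c, hc, hz⟩
      exact ⟨_, ⟨c, hc, rfl⟩, by rwa [app_graph hc, mem_pow]⟩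
  let U := sUnion (image (fun c => pow (app C c)) k)
  have hU : ∀ z, z ∈ᵛ U ↔ ∃ c, c ∈ᵛ k ∧ Sub z (app C c) := by
    intro z
    simp only [U, mem_sUnion, mem_image]
    constructor
    · rintro ⟨_, ⟨c, hc, rfl⟩, hz⟩; exact ⟨c, hc, mem_pow.1 hz⟩
    · rintro ⟨c, hc, hz⟩; exact ⟨_, ⟨c, hc, rfl⟩, mem_pow.2 hz⟩
  -- `Q x b` says that `x` has rank `b`, with `b` below `k`.
  let Q : V → V → Prop := fun x b => b ∈ᵛ k ∧ Sub x (app C b) ∧ ∀ c, c ∈ᵛ b → ¬ Sub x (app C c)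
  have hQ : ∀ {E : Type u} [DefType V E] (f g : E → V) [Dfn V f] [Dfn V g],
    Dfn V (fun e => Q (f e) (g e)) := fun f g _ _ =>
      Dfn.comp₂ (q := Q) (by unfold Q; infer_instance) f g
  have hQex : ∀ x, x ∈ᵛ U → ∃ b, Q x b := by
    intro x hx
    obtain ⟨c, hc, hxc⟩ := (hU x).1 hx
    obtain ⟨b, hb, hmin⟩ := exists_minimal (sep k (fun b => Sub x (app C b)))
      ⟨c, mem_sep.2 ⟨hc, hxc⟩⟩
    obtain ⟨hb1, hb2⟩ := mem_sep.1 hb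
    exact ⟨b, hb1, hb2, fun d hd hxd => hmin d hd (mem_sep.2 ⟨hok.1 b hb1 d hd, hxd⟩)⟩
  have hQuniq : ∀ x b b', Q x b → Q x b' → b = b' := by
    intro x b b' h h'
    rcases hok.2 b b' h.1 h'.1 with h1 | h1 | h1
    · exact (h'.2.2 b h1 h.2.1).elim
    · exact h1
    · exact (h.2.2 b' h1 h'.2.1).elim
  have main : ∀ t, IsTransitive t → (¬ ∃ f, IsSurj f t k) → Sub t U := by
    intro t ht hns
    -- If every `b ∈ k` were a rank of an element of `t`, the rank map would send `t` onto `k`;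
    -- elements without a rank below `k` go to `∅`.
    have hmiss : ∃ b, b ∈ᵛ k ∧ ∀ x, x ∈ᵛ t → ¬ Q x b := by
      by_contra hn
      push Not at hn
      refine hns ⟨graph t (fun x => if ∃ b, Q x b then the (fun b => Q x b) else emp V),
        isSurj_iff.2 ⟨isFun_graph fun x hx => ?_, fun b hb => ?_⟩⟩
      · split_ifs with h
        · obtain ⟨b, hb⟩ := h
          rw [the_eq hb fun b' hb' => hQuniq x b' b hb' hb]
          exact hb.1
        · exact hk0
      · obtain ⟨x, hx, hxb⟩ := hn b hb
        refine ⟨x, hx, ?_⟩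
        rw [app_graph hx, if_pos ⟨b, hxb⟩, the_eq hxb fun b' hb' => hQuniq x b' b hb' hxb]
    obtain ⟨b, hb, hmiss⟩ := hmiss
    -- Ranks in a transitive set cannot jump over the omitted value `b`: if all elements of `x` have
    -- rank below `b`, then `x` has rank at most `b`.
    have hbelow : ∀ x, x ∈ᵛ t → ∀ c, Q x c → c ∈ᵛ b := by
      refine mem_induction ht (fun x => ∀ c, Q x c → c ∈ᵛ b) fun x hx ih c hc => ?_
      rcases hok.2 c b hc.1 hb with h | rfl | h
      · exact h
      · exact (hmiss x hx hc).elim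
      · refine (hc.2.2 b h fun z hz => ?_).elim
        obtain ⟨d, hd, hzd⟩ := (hC c hc.1 z).1 (hc.2.1 z hz)
        obtain ⟨d', hd'⟩ := hQex z ((hU z).2 ⟨d, hok.1 c hc.1 d hd, hzd⟩)
        exact (hC b hb z).2 ⟨d', ih z hz d' hd', hd'.2.1⟩
    refine mem_induction ht (fun x => x ∈ᵛ U) fun y hy ih => ?_
    refine (hU y).2 ⟨b, hb, fun z hz => ?_⟩
    obtain ⟨d, hd⟩ := hQex z (ih z hz)
    exact (hC b hb z).2 ⟨d, hbelow z (ht y hy z hz) d hd, hd.2.1⟩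
  refine ⟨sep (pow U) (fun x => ∃ t, IsTC x t ∧ ¬ ∃ f, IsSurj f t k), fun x => ?_⟩
  rw [mem_sep, and_iff_right_iff_imp]
  rintro ⟨t, ht, hns⟩
  exact mem_pow.2 fun z hz => main t ht.1 hns z (ht.2.1 z hz)

theorem IsH.transitive {k h : V} (hh : IsH k h) (hk : ∃ x, x ∈ᵛ k) : IsTransitive h := by
  intro x hx y hy
  obtain ⟨t, ht, hns⟩ := (hh x).1 hx
  obtain ⟨s, hs⟩ := exists_isTC y
  refine (hh y).2 ⟨s, hs, ?_⟩
  rintro ⟨f, hf⟩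
  exact hns (surj_mono hf (hs.sub ht hy) (fun _ h => h) hk)

/-- `H_k` contains every transitive set that cannot be mapped onto a nonempty subset of `k`. -/
theorem IsH.sub_of_not_surj {k k₀ h T : V} (hh : IsH k h) (hk : Sub k₀ k) (hk₀ : ∃ x, x ∈ᵛ k₀)
    (hT : IsTransitive T) (hns : ¬ ∃ f, IsSurj f T k₀) : Sub T h := by
  intro x hx
  obtain ⟨t, ht⟩ := exists_isTC x
  refine (hh x).2 ⟨t, ht, ?_⟩
  rintro ⟨f, hf⟩
  exact hns (surj_mono hf (ht.2.2 T hT (hT x hx)) hk hk₀)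

end Recursion

section HF

variable {V : Type u} [SetModel V] [hZF : ZF V] {E : Type u} [DefType V E]

/-! ### Hereditarily finite sets -/

/-- The least natural number not in `b`. -/
noncomputable def leastOut (b : V) : V :=
  the (fun k => k ∈ᵛ omega V ∧ (¬ k ∈ᵛ b) ∧ ∀ j, j ∈ᵛ k → j ∈ᵛ b)

instance dfn_leastOut (f : E → V) [hf : Dfn V f] : Dfn V (fun e => leastOut (f e)) :=
  Dfn₁.comp (p := leastOut) (by unfold leastOut; infer_instance) hf

theorem leastOut_eq {b k : V} (hk : k ∈ᵛ omega V) (hkb : ¬ k ∈ᵛ b) (h : Sub k b) :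
    leastOut b = k := by
  refine the_eq (p := fun k => k ∈ᵛ omega V ∧ (¬ k ∈ᵛ b) ∧ ∀ j, j ∈ᵛ k → j ∈ᵛ b) ⟨hk, hkb, h⟩ ?_
  rintro l ⟨hl, hlb, h'⟩
  rcases nat_trichotomy hk hl with h1 | h1 | h1
  · exact (hkb (h' k h1)).elim
  · exact h1.symm
  · exact (hlb (h l h1)).elim

theorem leastOut_spec {b n : V} (hn : n ∈ᵛ omega V) (hb : Sub b n) :
    leastOut b ∈ᵛ suc n ∧ (¬ leastOut b ∈ᵛ b) ∧ Sub (leastOut b) b := by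
  obtain ⟨k, hk, hkb, hmin⟩ := nat_least (fun k => ¬ k ∈ᵛ b)
    ⟨n, hn, fun h => mem_irrefl n (hb n h)⟩
  have h : Sub k b := fun j hj => by
    by_contra hjb
    exact hmin j hj hjb
  rw [leastOut_eq hk hkb h]
  refine ⟨mem_suc.2 ?_, hkb, h⟩
  rcases nat_trichotomy hk hn with h1 | h1 | h1
  · exact Or.inl h1
  · exact Or.inr h1
  · exact (mem_irrefl n (hb n (h n h1))).elim

/-- The successor operation on sets of natural numbers, regarded as binary expansions. -/
noncomputable def binNext (b : V) : V :=
  bun (sing (leastOut b)) (sep b (fun j => ¬ j ∈ᵛ leastOut b))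

instance dfn_binNext (f : E → V) [hf : Dfn V f] : Dfn V (fun e => binNext (f e)) :=
  Dfn₁.comp (p := binNext) (by unfold binNext; infer_instance) hf

/-- An enumeration of the bounded sets of natural numbers. -/
theorem exists_enum_bounded : ∃ B : V, (∀ n, n ∈ᵛ omega V → Sub (app B n) n) ∧
    ∀ k, k ∈ᵛ omega V → ∀ a, Sub a k → ∃ n, n ∈ᵛ omega V ∧ app B n = a := by
  obtain ⟨B, hB0, hB⟩ := nat_recursion (emp V) (binNext : V → V)
  have hsub : ∀ n, n ∈ᵛ omega V → Sub (app B n) n := by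
    refine nat_induction (fun n => Sub (app B n) n) ?_ fun n hn ih z hz => ?_
    · rw [hB0]
      exact fun z hz => hz
    · rw [hB n hn, binNext, mem_bun, mem_sing, mem_sep] at hz
      rcases hz with rfl | hz
      · exact (leastOut_spec hn ih).1
      · exact mem_suc.2 (Or.inl (ih z hz.1))
  refine ⟨B, hsub, ?_⟩
  -- `B` is a binary counter. Starting from a state whose lowest `k` bits are 0, it runs through all
  -- patterns of these bits and leaves the higher ones alone.
  have key : ∀ k, k ∈ᵛ omega V → ∀ n, n ∈ᵛ omega V → (∀ j, j ∈ᵛ k → ¬ j ∈ᵛ app B n) →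
      ∀ a, Sub a k → ∃ m, m ∈ᵛ omega V ∧ app B m = bun (app B n) a := by
    refine nat_induction (fun k => ∀ n, n ∈ᵛ omega V → (∀ j, j ∈ᵛ k → ¬ j ∈ᵛ app B n) →
      ∀ a, Sub a k → ∃ m, m ∈ᵛ omega V ∧ app B m = bun (app B n) a) ?_ fun k hk ih => ?_
    · intro n hn _ a ha
      refine ⟨n, hn, ext fun z => ?_⟩
      rw [mem_bun]
      exact ⟨Or.inl, fun h => h.elim id fun h => (mem_emp (ha z h)).elim⟩
    · intro n hn hdisj a ha
      by_cases hka : k ∈ᵛ a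
      -- To set bit `k`, the counter first fills all lower bits. The next step carries into bit `k`
      -- and clears them, and the induction hypothesis applies again.
      · obtain ⟨m, hm, hBm⟩ := ih n hn (fun j hj => hdisj j (mem_suc.2 (Or.inl hj))) k
          (fun _ h => h)
        have hkn : ¬ k ∈ᵛ app B n := hdisj k (mem_suc.2 (Or.inr rfl))
        have hlo : leastOut (app B m) = k := by
          refine leastOut_eq hk ?_ fun j hj => ?_
          · rw [hBm, mem_bun]
            rintro (h | h)
            · exact hkn h
            · exact mem_irrefl k h
          · rw [hBm, mem_bun]
            exact Or.inr hj
        have hBs : ∀ z, z ∈ᵛ app B (suc m) ↔ z = k ∨ z ∈ᵛ app B n := by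
          intro z
          rw [hB m hm, binNext, hlo, mem_bun, mem_sing, mem_sep, hBm, mem_bun]
          have := fun h => hdisj z (mem_suc.2 (Or.inl h))
          tauto
        obtain ⟨l, hl, hBl⟩ := ih (suc m) (suc_mem_omega hm) (fun j hj h => by
          rcases (hBs j).1 h with rfl | h
          · exact mem_irrefl _ hj
          · exact hdisj j (mem_suc.2 (Or.inl hj)) h) (sep a (fun j => j ∈ᵛ k))
          (fun z hz => (mem_sep.1 hz).2)
        refine ⟨l, hl, ext fun z => ?_⟩
        rw [hBl, mem_bun, hBs, mem_sep, mem_bun]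
        have := fun h => mem_suc.1 (ha z h)
        grind
      · refine ih n hn (fun j hj => hdisj j (mem_suc.2 (Or.inl hj))) a fun z hz => ?_
        rcases mem_suc.1 (ha z hz) with h | rfl
        · exact h
        · exact (hka hz).elim
  intro k hk a ha
  obtain ⟨n, hn, h⟩ := key k hk (emp V) emp_mem_omega (fun j _ => by rw [hB0]; exact mem_emp) a ha
  refine ⟨n, hn, h.trans (ext fun z => ?_)⟩
  rw [mem_bun, hB0]
  exact ⟨fun h => h.elim (fun h => (mem_emp h).elim) id, Or.inr⟩

/-- Ackermann's coding: set number `n` consists of the sets whose numbers are the positions of the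
ones in the binary expansion of `n`. Elements thus have smaller numbers than the set, and adjoining
one element is again a finite bit pattern. -/
theorem exists_enum : ∃ g : V, app g (emp V) = emp V ∧
    (∀ n, n ∈ᵛ omega V → ∀ x, x ∈ᵛ app g n → ∃ m, m ∈ᵛ n ∧ x = app g m) ∧
    ∀ n, n ∈ᵛ omega V → ∀ m, m ∈ᵛ omega V →
      ∃ l, l ∈ᵛ omega V ∧ app g l = bun (app g n) (sing (app g m)) := by
  obtain ⟨B, hBsub, hB⟩ := exists_enum_bounded (V := V)
  obtain ⟨g, hg⟩ := mem_recursion (omega V) isTransitive_omega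
    (fun n h => image (app h) (app B n))
  have hmem : ∀ n, n ∈ᵛ omega V → ∀ x, x ∈ᵛ app g n ↔ ∃ m, m ∈ᵛ app B n ∧ x = app g m := by
    intro n hn x
    rw [hg n hn, mem_image]
    refine exists_congr fun m => and_congr_right fun hm => ?_
    rw [app_graph (hBsub n hn m hm)]
  refine ⟨g, eq_emp fun z hz => ?_, fun n hn x hx => ?_, fun n hn m hm => ?_⟩
  · obtain ⟨m, hm, -⟩ := (hmem _ emp_mem_omega z).1 hz
    exact mem_emp (hBsub _ emp_mem_omega m hm)
  · obtain ⟨m, hm, hx⟩ := (hmem n hn x).1 hx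
    exact ⟨m, hBsub n hn m hm, hx⟩
  · have hbd : ∃ k, k ∈ᵛ omega V ∧ Sub (bun (app B n) (sing m)) k := by
      have hmt := isTransitive_nat hm
      have hnt := isTransitive_nat hn
      rcases nat_trichotomy hm hn with h | rfl | h
      · refine ⟨n, hn, fun z hz => ?_⟩
        rcases mem_bun.1 hz with hz | hz
        · exact hBsub n hn z hz
        · rwa [mem_sing.1 hz]
      all_goals
        refine ⟨suc m, suc_mem_omega hm, fun z hz => mem_suc.2 ?_⟩
        rcases mem_bun.1 hz with hz | hz
      · exact Or.inl (hBsub m hn z hz)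
      · exact Or.inr (mem_sing.1 hz)
      · exact Or.inl (hmt n h z (hBsub n hn z hz))
      · exact Or.inr (mem_sing.1 hz)
    obtain ⟨k, hk, hbk⟩ := hbd
    obtain ⟨l, hl, hBl⟩ := hB k hk _ hbk
    refine ⟨l, hl, ext fun z => ?_⟩
    rw [hmem l hl, hBl, mem_bun, mem_sing, hmem n hn]
    simp only [mem_bun, mem_sing]
    constructor
    · rintro ⟨j, hj | rfl, hz⟩
      · exact Or.inl ⟨j, hj, hz⟩
      · exact Or.inr hz
    · rintro (⟨j, hj, hz⟩ | hz)
      · exact ⟨j, Or.inl hj, hz⟩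
      · exact ⟨m, Or.inr rfl, hz⟩

variable (V) in
/-- An enumeration of the hereditarily finite sets. -/
noncomputable def enum : V := exists_enum.choose

variable (V) in
/-- The set of hereditarily finite sets. -/
noncomputable def HF : V := image (app (enum V)) (omega V)

theorem mem_HF {x : V} : x ∈ᵛ HF V ↔ ∃ n, n ∈ᵛ omega V ∧ x = app (enum V) n := mem_image

theorem emp_mem_HF : emp V ∈ᵛ HF V :=
  mem_HF.2 ⟨emp V, emp_mem_omega, exists_enum.choose_spec.1.symm⟩

theorem insert_mem_HF {x y : V} (hx : x ∈ᵛ HF V) (hy : y ∈ᵛ HF V) : bun x (sing y) ∈ᵛ HF V := by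
  obtain ⟨n, hn, rfl⟩ := mem_HF.1 hx
  obtain ⟨m, hm, rfl⟩ := mem_HF.1 hy
  obtain ⟨l, hl, h⟩ := exists_enum.choose_spec.2.2 n hn m hm
  exact mem_HF.2 ⟨l, hl, h.symm⟩

theorem upair_mem_HF {x y : V} (hx : x ∈ᵛ HF V) (hy : y ∈ᵛ HF V) : upair x y ∈ᵛ HF V := by
  convert insert_mem_HF (insert_mem_HF emp_mem_HF hx) hy using 1
  exact ext fun z => by simp

theorem opair_mem_HF {x y : V} (hx : x ∈ᵛ HF V) (hy : y ∈ᵛ HF V) : opair x y ∈ᵛ HF V :=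
  upair_mem_HF (upair_mem_HF hx hx) (upair_mem_HF hx hy)

theorem omega_sub_HF : Sub (omega V) (HF V) :=
  nat_induction (fun n => n ∈ᵛ HF V) emp_mem_HF fun _ _ ih => insert_mem_HF ih ih

/-- The elements of hereditarily finite sets are enumerated before these sets. -/
theorem enum_image_transitive {n : V} (hn : n ∈ᵛ omega V) :
    IsTransitive (image (app (enum V)) n) := by
  intro x hx y hy
  rw [mem_image] at hx ⊢
  obtain ⟨m, hm, rfl⟩ := hx
  obtain ⟨l, hl, rfl⟩ := exists_enum.choose_spec.2.1 m (isTransitive_omega n hn m hm) y hy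
  exact ⟨l, isTransitive_nat hn m hm l hl, rfl⟩

theorem enum_sub {n : V} (hn : n ∈ᵛ omega V) :
    Sub (app (enum V) n) (image (app (enum V)) n) := by
  intro y hy
  rw [mem_image]
  exact exists_enum.choose_spec.2.1 n hn y hy

/-- The index of an element is smaller than the index of the set, so by induction the number `i`
cannot appear before stage `i`. -/
theorem nat_sub_index {i : V} (hi : i ∈ᵛ omega V) :
    ∀ n, n ∈ᵛ omega V → app (enum V) n = i → Sub i n := by
  refine nat_induction (fun i => ∀ n, n ∈ᵛ omega V → app (enum V) n = i → Sub i n)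
    (fun n _ _ z hz => (mem_emp hz).elim) (fun i hi ih n hn h => ?_) i hi
  obtain ⟨l, hl, hil⟩ := exists_enum.choose_spec.2.1 n hn i (by
    change i ∈ᵛ app (enum V) n
    rw [h]; simp)
  have hlo := isTransitive_omega n hn l hl
  have hin : i ∈ᵛ n := by
    have hsub := ih l hlo hil.symm
    rcases nat_trichotomy hi hlo with h1 | rfl | h1
    · exact isTransitive_nat hn l hl i h1
    · exact hl
    · exact (mem_irrefl l (hsub l h1)).elim
  intro z hz
  rcases mem_suc.1 hz with hz | rfl
  · exact isTransitive_nat hn i hin z hz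
  · exact hin

/-- Natural numbers enumerated before stage `n` are less than `n`. -/
theorem nat_mem_of_mem_image {n i : V} (hn : n ∈ᵛ omega V) (hi : i ∈ᵛ omega V)
    (h : i ∈ᵛ image (app (enum V)) n) : i ∈ᵛ n := by
  obtain ⟨l, hl, hil⟩ := mem_image.1 h
  have hlo := isTransitive_omega n hn l hl
  have hsub := nat_sub_index hi l hlo hil.symm
  rcases nat_trichotomy hi hlo with h1 | rfl | h1
  · exact isTransitive_nat hn l hl i h1
  · exact hl
  · exact (mem_irrefl l (hsub l h1)).elim

/-! ### Codes of formulas -/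

variable (V) in
/-- The von Neumann numerals. -/
noncomputable def num : ℕ → V
  | 0 => emp V
  | n + 1 => suc (num n)

theorem isNumeral_iff {n : ℕ} {x : V} : IsNumeral n x ↔ x = num V n := by
  induction n generalizing x with
  | zero => exact isEmptySet_iff
  | succ n ih => simp only [IsNumeral, ih, isSucc_iff, exists_eq_left, num]

theorem num_mem_omega (n : ℕ) : num V n ∈ᵛ omega V := by
  induction n with
  | zero => exact emp_mem_omega
  | succ n ih => exact suc_mem_omega ih

theorem num_mem_num {m n : ℕ} (h : m < n) : num V m ∈ᵛ num V n := by
  induction n with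
  | zero => omega
  | succ n ih =>
    rcases Nat.lt_succ_iff_lt_or_eq.1 h with h | rfl
    · exact mem_suc.2 (Or.inl (ih h))
    · exact mem_suc.2 (Or.inr rfl)

@[simp] theorem num_inj {m n : ℕ} : num V m = num V n ↔ m = n := by
  refine ⟨fun h => ?_, fun h => by rw [h]⟩
  rcases lt_trichotomy m n with h1 | h1 | h1
  · exact (mem_irrefl (num V n) (by have := num_mem_num (V := V) h1; rwa [h] at this)).elim
  · exact h1
  · exact (mem_irrefl (num V n) (by have := num_mem_num (V := V) h1; rwa [h] at this)).elim

/-- The code of `x_i ∈ x_j`. -/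
noncomputable def cMem (i j : V) : V := opair (num V 0) (opair i j)
/-- The code of `x_i = x_j`. -/
noncomputable def cEq (i j : V) : V := opair (num V 1) (opair i j)
/-- The code of a negation. -/
noncomputable def cNot (a : V) : V := opair (num V 2) a
/-- The code of a conjunction. -/
noncomputable def cAnd (a b : V) : V := opair (num V 3) (opair a b)
/-- The code of an existential formula. -/
noncomputable def cEx (i a : V) : V := opair (num V 4) (opair i a)

instance dfn_cMem (f g : E → V) [Dfn V f] [Dfn V g] : Dfn V (fun e => cMem (f e) (g e)) := by
  unfold cMem; infer_instance
instance dfn_cEq (f g : E → V) [Dfn V f] [Dfn V g] : Dfn V (fun e => cEq (f e) (g e)) := by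
  unfold cEq; infer_instance
instance dfn_cNot (f : E → V) [Dfn V f] : Dfn V (fun e => cNot (f e)) := by
  unfold cNot; infer_instance
instance dfn_cAnd (f g : E → V) [Dfn V f] [Dfn V g] : Dfn V (fun e => cAnd (f e) (g e)) := by
  unfold cAnd; infer_instance
instance dfn_cEx (f g : E → V) [Dfn V f] [Dfn V g] : Dfn V (fun e => cEx (f e) (g e)) := by
  unfold cEx; infer_instance

theorem isTagged_iff {n : ℕ} {y c : V} : IsTagged n y c ↔ c = opair (num V n) y := by
  simp only [IsTagged, isNumeral_iff, isOPair_iff, exists_eq_left]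

theorem codeMem_iff {i j c : V} : CodeMem i j c ↔ c = cMem i j := by
  simp only [CodeMem, isTagged_iff, isOPair_iff, exists_eq_left, cMem]
theorem codeEq_iff {i j c : V} : CodeEq i j c ↔ c = cEq i j := by
  simp only [CodeEq, isTagged_iff, isOPair_iff, exists_eq_left, cEq]
theorem codeNot_iff {a c : V} : CodeNot a c ↔ c = cNot a := by
  simp only [CodeNot, isTagged_iff, cNot]
theorem codeAnd_iff {a b c : V} : CodeAnd a b c ↔ c = cAnd a b := by
  simp only [CodeAnd, isTagged_iff, isOPair_iff, exists_eq_left, cAnd]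
theorem codeEx_iff {i a c : V} : CodeEx i a c ↔ c = cEx i a := by
  simp only [CodeEx, isTagged_iff, isOPair_iff, exists_eq_left, cEx]

theorem formulaClosed_iff {X : V} : FormulaClosed X ↔
    (∀ i j, i ∈ᵛ omega V → j ∈ᵛ omega V → cMem i j ∈ᵛ X) ∧
    (∀ i j, i ∈ᵛ omega V → j ∈ᵛ omega V → cEq i j ∈ᵛ X) ∧
    (∀ a, a ∈ᵛ X → cNot a ∈ᵛ X) ∧
    (∀ a b, a ∈ᵛ X → b ∈ᵛ X → cAnd a b ∈ᵛ X) ∧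
    (∀ i a, i ∈ᵛ omega V → a ∈ᵛ X → cEx i a ∈ᵛ X) := by
  simp only [FormulaClosed, isNat_iff, codeMem_iff, codeEq_iff, codeNot_iff, codeAnd_iff,
    codeEx_iff]
  constructor
  · rintro ⟨h1, h2, h3, h4, h5⟩
    exact ⟨fun i j hi hj => h1 i j _ hi hj rfl, fun i j hi hj => h2 i j _ hi hj rfl,
      fun a ha => h3 a _ ha rfl, fun a b ha hb => h4 a b _ ha hb rfl,
      fun i a hi ha => h5 i a _ hi ha rfl⟩
  · rintro ⟨h1, h2, h3, h4, h5⟩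
    refine ⟨?_, ?_, ?_, ?_, ?_⟩
    · rintro i j _ hi hj rfl; exact h1 i j hi hj
    · rintro i j _ hi hj rfl; exact h2 i j hi hj
    · rintro a _ ha rfl; exact h3 a ha
    · rintro a b _ ha hb rfl; exact h4 a b ha hb
    · rintro i a _ hi ha rfl; exact h5 i a hi ha

/-- Being a formula is defined by an intersection over closed sets; one such set must exist for the
formulas to form a set. -/
theorem formulaClosed_HF : FormulaClosed (HF V) := by
  have h : ∀ n, num V n ∈ᵛ HF V := fun n => omega_sub_HF _ (num_mem_omega n)
  have h' : ∀ i, i ∈ᵛ omega V → i ∈ᵛ HF V := omega_sub_HF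
  rw [formulaClosed_iff]
  exact ⟨fun i j hi hj => opair_mem_HF (h 0) (opair_mem_HF (h' i hi) (h' j hj)),
    fun i j hi hj => opair_mem_HF (h 1) (opair_mem_HF (h' i hi) (h' j hj)),
    fun a ha => opair_mem_HF (h 2) ha,
    fun a b ha hb => opair_mem_HF (h 3) (opair_mem_HF ha hb),
    fun i a hi ha => opair_mem_HF (h 4) (opair_mem_HF (h' i hi) ha)⟩

instance dfn_formulaClosed (f : E → V) [hf : Dfn V f] : Dfn V (fun e => FormulaClosed (f e)) :=
  Dfn.congr (Dfn₁.comp (p := fun X => (∀ i j, i ∈ᵛ omega V → j ∈ᵛ omega V → cMem i j ∈ᵛ X) ∧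
    (∀ i j, i ∈ᵛ omega V → j ∈ᵛ omega V → cEq i j ∈ᵛ X) ∧
    (∀ a, a ∈ᵛ X → cNot a ∈ᵛ X) ∧
    (∀ a b, a ∈ᵛ X → b ∈ᵛ X → cAnd a b ∈ᵛ X) ∧
    (∀ i a, i ∈ᵛ omega V → a ∈ᵛ X → cEx i a ∈ᵛ X)) inferInstance hf)
    fun _ => propext formulaClosed_iff

instance dfn_isFormula (f : E → V) [hf : Dfn V f] : Dfn V (fun e => IsFormula (f e)) :=
  Dfn₁.comp (p := IsFormula) (by unfold IsFormula; infer_instance) hf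

variable (V) in
/-- The set of formulas. -/
noncomputable def Fml : V := sep (HF V) IsFormula

theorem isFormula_iff {c : V} : IsFormula c ↔ c ∈ᵛ Fml V := by
  rw [Fml, mem_sep]
  exact ⟨fun h => ⟨h _ formulaClosed_HF, h⟩, fun h => h.2⟩

theorem Fml_sub_HF : Sub (Fml V) (HF V) := fun _ h => (mem_sep.1 h).1

theorem formulaClosed_Fml : FormulaClosed (Fml V) := by
  rw [formulaClosed_iff]
  simp only [← isFormula_iff]
  refine ⟨fun i j hi hj X hX => ?_, fun i j hi hj X hX => ?_, fun a ha X hX => ?_,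
    fun a b ha hb X hX => ?_, fun i a hi ha X hX => ?_⟩
  all_goals have H := formulaClosed_iff.1 hX
  · exact H.1 i j hi hj
  · exact H.2.1 i j hi hj
  · exact H.2.2.1 a (ha X hX)
  · exact H.2.2.2.1 a b (ha X hX) (hb X hX)
  · exact H.2.2.2.2 i a hi (ha X hX)

theorem cMem_mem {i j : V} (hi : i ∈ᵛ omega V) (hj : j ∈ᵛ omega V) : cMem i j ∈ᵛ Fml V :=
  (formulaClosed_iff.1 formulaClosed_Fml).1 i j hi hj
theorem cEq_mem {i j : V} (hi : i ∈ᵛ omega V) (hj : j ∈ᵛ omega V) : cEq i j ∈ᵛ Fml V :=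
  (formulaClosed_iff.1 formulaClosed_Fml).2.1 i j hi hj
theorem cNot_mem {a : V} (ha : a ∈ᵛ Fml V) : cNot a ∈ᵛ Fml V :=
  (formulaClosed_iff.1 formulaClosed_Fml).2.2.1 a ha
theorem cAnd_mem {a b : V} (ha : a ∈ᵛ Fml V) (hb : b ∈ᵛ Fml V) : cAnd a b ∈ᵛ Fml V :=
  (formulaClosed_iff.1 formulaClosed_Fml).2.2.2.1 a b ha hb
theorem cEx_mem {i a : V} (hi : i ∈ᵛ omega V) (ha : a ∈ᵛ Fml V) : cEx i a ∈ᵛ Fml V :=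
  (formulaClosed_iff.1 formulaClosed_Fml).2.2.2.2 i a hi ha

/-- The formulas with property `p` form a set closed under the formation rules. The induction is
internal to `V`, so it also covers nonstandard codes. -/
theorem formula_induction (p : V → Prop) [Dfn₁ p]
    (hMem : ∀ i j, i ∈ᵛ omega V → j ∈ᵛ omega V → p (cMem i j))
    (hEq : ∀ i j, i ∈ᵛ omega V → j ∈ᵛ omega V → p (cEq i j))
    (hNot : ∀ a, a ∈ᵛ Fml V → p a → p (cNot a))
    (hAnd : ∀ a b, a ∈ᵛ Fml V → b ∈ᵛ Fml V → p a → p b → p (cAnd a b))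
    (hEx : ∀ i a, i ∈ᵛ omega V → a ∈ᵛ Fml V → p a → p (cEx i a)) :
    ∀ c, c ∈ᵛ Fml V → p c := by
  intro c hc
  have : FormulaClosed (sep (Fml V) p) := by
    rw [formulaClosed_iff]
    simp only [mem_sep]
    exact ⟨fun i j hi hj => ⟨cMem_mem hi hj, hMem i j hi hj⟩,
      fun i j hi hj => ⟨cEq_mem hi hj, hEq i j hi hj⟩,
      fun a ha => ⟨cNot_mem ha.1, hNot a ha.1 ha.2⟩,
      fun a b ha hb => ⟨cAnd_mem ha.1 hb.1, hAnd a b ha.1 hb.1 ha.2 hb.2⟩,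
      fun i a hi ha => ⟨cEx_mem hi ha.1, hEx i a hi ha.1 ha.2⟩⟩
  exact (mem_sep.1 (isFormula_iff.2 hc _ this)).2

/-! ### Satisfaction -/

open Classical in
/-- The assignment `s`, changed to `x` at `i`. -/
noncomputable def upd (s i x : V) : V := graph (omega V) (fun j => if j = i then x else app s j)

open Classical in
instance dfn_upd (f g h : E → V) [Dfn V f] [Dfn V g] [Dfn V h] :
    Dfn V (fun e => upd (f e) (g e) (h e)) :=
  Dfn.comp₃ (q := upd) (by unfold upd; infer_instance) f g h

open Classical in
theorem app_upd {s i x j : V} (hj : j ∈ᵛ omega V) :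
    app (upd s i x) j = if j = i then x else app s j := by
  rw [upd, app_graph hj]

theorem upd_isFun {s i x A : V} (hs : IsFun s (omega V) A) (hx : x ∈ᵛ A) :
    IsFun (upd s i x) (omega V) A := by
  refine isFun_graph fun j hj => ?_
  split_ifs
  · exact hx
  · exact hs.app_mem hj

theorem isUpdate_iff {s i x s' A : V} (hi : i ∈ᵛ omega V) (hs : IsFun s (omega V) A) (hx : x ∈ᵛ A)
    (hs' : IsFun s' (omega V) A) : IsUpdate s i x s' ↔ s' = upd s i x := by
  simp only [IsUpdate, rel_iff, hs.opair_mem_iff, hs'.opair_mem_iff]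
  constructor
  · intro h
    refine hs'.eq_of_app (upd_isFun hs hx) fun j hj => ?_
    have := (h j (app s' j)).1 ⟨hj, rfl⟩
    rw [app_upd hj]
    split_ifs <;> tauto
  · rintro rfl j y
    constructor
    · rintro ⟨hj, rfl⟩
      rw [app_upd hj]
      split_ifs <;> tauto
    · rintro (⟨rfl, rfl⟩ | ⟨hne, hj, rfl⟩)
      · exact ⟨hi, by rw [app_upd hi, if_pos rfl]⟩
      · exact ⟨hj, by rw [app_upd hj, if_neg hne]⟩

theorem isAssignment_iff {s A : V} : IsAssignment s A ↔ IsFun s (omega V) A := by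
  simp only [IsAssignment, isOmega_iff, exists_eq_left]

theorem isSatRel_iff {A S : V} : IsSatRel A S ↔ ∀ s, IsFun s (omega V) A →
    (∀ i j, i ∈ᵛ omega V → j ∈ᵛ omega V → (opair (cMem i j) s ∈ᵛ S ↔ app s i ∈ᵛ app s j)) ∧
    (∀ i j, i ∈ᵛ omega V → j ∈ᵛ omega V → (opair (cEq i j) s ∈ᵛ S ↔ app s i = app s j)) ∧
    (∀ a, a ∈ᵛ Fml V → (opair (cNot a) s ∈ᵛ S ↔ ¬ opair a s ∈ᵛ S)) ∧
    (∀ a b, a ∈ᵛ Fml V → b ∈ᵛ Fml V →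
      (opair (cAnd a b) s ∈ᵛ S ↔ (opair a s ∈ᵛ S ∧ opair b s ∈ᵛ S))) ∧
    (∀ i a, i ∈ᵛ omega V → a ∈ᵛ Fml V →
      (opair (cEx i a) s ∈ᵛ S ↔ ∃ x, x ∈ᵛ A ∧ opair a (upd s i x) ∈ᵛ S)) := by
  simp only [IsSatRel, isAssignment_iff, isNat_iff, codeMem_iff, codeEq_iff, codeNot_iff,
    codeAnd_iff, codeEx_iff, isFormula_iff, rel_iff]
  refine forall_congr' fun s => forall_congr' fun hs => ?_
  refine and_congr ?_ (and_congr ?_ (and_congr ?_ (and_congr ?_ ?_)))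
  · refine forall_congr' fun i => forall_congr' fun j => ?_
    have : i ∈ᵛ omega V → j ∈ᵛ omega V →
        ((∃ x y, opair i x ∈ᵛ s ∧ opair j y ∈ᵛ s ∧ x ∈ᵛ y) ↔ app s i ∈ᵛ app s j) := by
      intro hi hj
      simp only [hs.opair_mem_iff, hi, hj, true_and]
      exact ⟨by rintro ⟨_, _, rfl, rfl, h⟩; exact h, fun h => ⟨_, _, rfl, rfl, h⟩⟩
    grind
  · refine forall_congr' fun i => forall_congr' fun j => ?_
    have : i ∈ᵛ omega V → j ∈ᵛ omega V →
        ((∃ x, opair i x ∈ᵛ s ∧ opair j x ∈ᵛ s) ↔ app s i = app s j) := by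
      intro hi hj
      simp only [hs.opair_mem_iff, hi, hj, true_and]
      exact ⟨by rintro ⟨_, rfl, h⟩; exact h, fun h => ⟨_, rfl, h⟩⟩
    grind
  · grind
  · grind
  · refine forall_congr' fun i => forall_congr' fun a => ?_
    have : i ∈ᵛ omega V →
        ((∃ x s', x ∈ᵛ A ∧ IsFun s' (omega V) A ∧ IsUpdate s i x s' ∧ opair a s' ∈ᵛ S) ↔
          ∃ x, x ∈ᵛ A ∧ opair a (upd s i x) ∈ᵛ S) := by
      intro hi
      refine exists_congr fun x => ?_
      constructor
      · rintro ⟨s', hx, hs', hu, h⟩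
        rw [isUpdate_iff hi hs hx hs'] at hu
        subst hu
        exact ⟨hx, h⟩
      · rintro ⟨hx, h⟩
        exact ⟨_, hx, upd_isFun hs hx, (isUpdate_iff hi hs hx (upd_isFun hs hx)).2 rfl, h⟩
    grind

/-- The immediate subformula relation is well-founded. -/
theorem subformula_wf (b : V) (hb : Sub b (Fml V)) (hne : ∃ x, x ∈ᵛ b) :
    ∃ c, c ∈ᵛ b ∧ ∀ a, a ∈ᵛ b → ¬ (c = cNot a ∨ (∃ d, c = cAnd a d ∨ c = cAnd d a) ∨
      ∃ i, c = cEx i a) := by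
  by_contra hn
  push Not at hn
  obtain ⟨x, hx⟩ := hne
  refine formula_induction (fun c => ¬ c ∈ᵛ b) ?_ ?_ ?_ ?_ ?_ x (hb x hx) hx
  · intro i j hi hj h
    obtain ⟨a, ha, h⟩ := hn _ h
    simp [cMem, cNot, cAnd, cEx] at h
  · intro i j hi hj h
    obtain ⟨a, ha, h⟩ := hn _ h
    simp [cEq, cNot, cAnd, cEx] at h
  · intro a _ ih h
    obtain ⟨a', ha', h⟩ := hn _ h
    simp [cNot, cAnd, cEx] at h
    exact ih (h ▸ ha')
  · intro a d _ _ ih1 ih2 h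
    obtain ⟨a', ha', h⟩ := hn _ h
    simp [cNot, cAnd, cEx] at h
    obtain ⟨e, h | h⟩ := h
    · exact ih1 (h.1 ▸ ha')
    · exact ih2 (h.2 ▸ ha')
  · intro i a _ _ ih h
    obtain ⟨a', ha', h⟩ := hn _ h
    simp [cNot, cAnd, cEx] at h
    exact ih (h ▸ ha')

/-- The clauses of the satisfaction recursion only consult values at subformulas, so the restricted
function can be replaced by any `h` with these values. -/
theorem wf_recursion' (X : V) (r : V → V → Prop) [hr : Dfn V (fun x : V × V => r x.1 x.2)]
    (hwf : ∀ b, Sub b X → (∃ x, x ∈ᵛ b) → ∃ x, x ∈ᵛ b ∧ ∀ y, y ∈ᵛ b → ¬ r y x)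
    (G : V → V → V) [hG : Dfn V (fun x : V × V => G x.1 x.2)] :
    ∃ f, ∀ x, x ∈ᵛ X → ∃ h, (∀ y, y ∈ᵛ X → r y x → app h y = app f y) ∧ app f x = G x h := by
  obtain ⟨f, hf⟩ := wf_recursion X r hwf G
  have hr' : ∀ {E : Type u} [DefType V E] (f g : E → V) [Dfn V f] [Dfn V g],
    Dfn V (fun e => r (f e) (g e)) := fun f g _ _ => Dfn.comp₂ hr f g
  exact ⟨f, fun x hx => ⟨_, fun y hy hyx => app_graph (mem_sep.2 ⟨hy, hyx⟩), hf x hx⟩⟩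

/-- By recursion on subformulas each code receives the set of assignments that satisfy it. The tags
of codes are distinct, so exactly one disjunct applies to each formula. -/
theorem exists_isSatRel (A : V) : ∃ S, IsSatRel A S := by
  obtain ⟨f, hf⟩ := wf_recursion' (Fml V)
    (fun a c => c = cNot a ∨ (∃ d, c = cAnd a d ∨ c = cAnd d a) ∨ ∃ i, c = cEx i a) subformula_wf
    (fun c h => sep (funs (omega V) A) (fun s =>
      (∃ i j, c = cMem i j ∧ app s i ∈ᵛ app s j) ∨ (∃ i j, c = cEq i j ∧ app s i = app s j) ∨
      (∃ a, c = cNot a ∧ ¬ s ∈ᵛ app h a) ∨ (∃ a b, c = cAnd a b ∧ s ∈ᵛ app h a ∧ s ∈ᵛ app h b) ∨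
      (∃ i a, c = cEx i a ∧ ∃ x, x ∈ᵛ A ∧ upd s i x ∈ᵛ app h a)))
  refine ⟨sep (prod (Fml V) (funs (omega V) A)) (fun p => ∃ c s, p = opair c s ∧ s ∈ᵛ app f c), ?_⟩
  have hmem : ∀ c s, c ∈ᵛ Fml V → IsFun s (omega V) A → (opair c s ∈ᵛ sep (prod (Fml V)
      (funs (omega V) A)) (fun p => ∃ c s, p = opair c s ∧ s ∈ᵛ app f c) ↔ s ∈ᵛ app f c) := by
    intro c s hc hs
    simp only [mem_sep, opair_mem_prod, hc, mem_funs, hs, opair_inj, true_and]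
    exact ⟨by rintro ⟨c, s, ⟨rfl, rfl⟩, h⟩; exact h, fun h => ⟨_, _, ⟨rfl, rfl⟩, h⟩⟩
  rw [isSatRel_iff]
  intro s hs
  refine ⟨fun i j hi hj => ?_, fun i j hi hj => ?_, fun a ha => ?_, fun a b ha hb => ?_,
    fun i a hi ha => ?_⟩
  · obtain ⟨h, -, hfc⟩ := hf _ (cMem_mem hi hj)
    rw [hmem _ _ (cMem_mem hi hj) hs, hfc, mem_sep, mem_funs]
    simp [hs, cMem, cEq, cNot, cAnd, cEx]
  · obtain ⟨h, -, hfc⟩ := hf _ (cEq_mem hi hj)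
    rw [hmem _ _ (cEq_mem hi hj) hs, hfc, mem_sep, mem_funs]
    simp [hs, cMem, cEq, cNot, cAnd, cEx]
  · obtain ⟨h, hh, hfc⟩ := hf _ (cNot_mem ha)
    rw [hmem _ _ (cNot_mem ha) hs, hmem _ _ ha hs, hfc, mem_sep, mem_funs,
      ← hh a ha (Or.inl rfl)]
    simp [hs, cMem, cEq, cNot, cAnd, cEx]
  · obtain ⟨h, hh, hfc⟩ := hf _ (cAnd_mem ha hb)
    rw [hmem _ _ (cAnd_mem ha hb) hs, hmem _ _ ha hs, hmem _ _ hb hs, hfc, mem_sep, mem_funs,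
      ← hh a ha (Or.inr (Or.inl ⟨b, Or.inl rfl⟩)), ← hh b hb (Or.inr (Or.inl ⟨a, Or.inr rfl⟩))]
    simp [hs, cMem, cEq, cNot, cAnd, cEx]
  · obtain ⟨h, hh, hfc⟩ := hf _ (cEx_mem hi ha)
    have : (∃ x, x ∈ᵛ A ∧ opair a (upd s i x) ∈ᵛ sep (prod (Fml V)
        (funs (omega V) A)) (fun p => ∃ c s, p = opair c s ∧ s ∈ᵛ app f c)) ↔
        ∃ x, x ∈ᵛ A ∧ upd s i x ∈ᵛ app h a := by
      refine exists_congr fun x => and_congr_right fun hx => ?_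
      rw [hmem _ _ ha (upd_isFun hs hx), hh a ha (Or.inr (Or.inr ⟨i, rfl⟩))]
    rw [this, hmem _ _ (cEx_mem hi ha) hs, hfc, mem_sep, mem_funs]
    simp [hs, cMem, cEq, cNot, cAnd, cEx]

/-- Satisfaction relations are unique on formulas, so the existential quantifier in `Satisfies` may
be evaluated with any one of them. -/
theorem IsSatRel.agree {A S S' : V} (h : IsSatRel A S) (h' : IsSatRel A S') :
    ∀ c, c ∈ᵛ Fml V → ∀ s, IsFun s (omega V) A → (opair c s ∈ᵛ S ↔ opair c s ∈ᵛ S') := by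
  rw [isSatRel_iff] at h h'
  refine formula_induction
    (fun c => ∀ s, IsFun s (omega V) A → (opair c s ∈ᵛ S ↔ opair c s ∈ᵛ S')) ?_ ?_ ?_ ?_ ?_
  · intro i j hi hj s hs
    rw [(h s hs).1 i j hi hj, (h' s hs).1 i j hi hj]
  · intro i j hi hj s hs
    rw [(h s hs).2.1 i j hi hj, (h' s hs).2.1 i j hi hj]
  · intro a ha ih s hs
    rw [(h s hs).2.2.1 a ha, (h' s hs).2.2.1 a ha, ih s hs]
  · intro a b ha hb iha ihb s hs
    rw [(h s hs).2.2.2.1 a b ha hb, (h' s hs).2.2.2.1 a b ha hb, iha s hs, ihb s hs]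
  · intro i a hi ha ih s hs
    rw [(h s hs).2.2.2.2 i a hi ha, (h' s hs).2.2.2.2 i a hi ha]
    exact exists_congr fun x => and_congr_right fun hx => ih _ (upd_isFun hs hx)

instance dfn_satisfies (A : V) (f g : E → V) [Dfn V f] [Dfn V g] :
    Dfn V (fun e => Satisfies A (f e) (g e)) := by
  have : Dfn V (fun x : (V × V) × V => IsSatRel A x.2) :=
    Dfn.congr (Dfn₁.comp (p := fun S => ∀ s, IsFun s (omega V) A →
      (∀ i j, i ∈ᵛ omega V → j ∈ᵛ omega V → (opair (cMem i j) s ∈ᵛ S ↔ app s i ∈ᵛ app s j)) ∧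
      (∀ i j, i ∈ᵛ omega V → j ∈ᵛ omega V → (opair (cEq i j) s ∈ᵛ S ↔ app s i = app s j)) ∧
      (∀ a, a ∈ᵛ Fml V → (opair (cNot a) s ∈ᵛ S ↔ ¬ opair a s ∈ᵛ S)) ∧
      (∀ a b, a ∈ᵛ Fml V → b ∈ᵛ Fml V →
        (opair (cAnd a b) s ∈ᵛ S ↔ (opair a s ∈ᵛ S ∧ opair b s ∈ᵛ S))) ∧
      (∀ i a, i ∈ᵛ omega V → a ∈ᵛ Fml V →
        (opair (cEx i a) s ∈ᵛ S ↔ ∃ x, x ∈ᵛ A ∧ opair a (upd s i x) ∈ᵛ S))) inferInstance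
      (inferInstanceAs (Dfn V fun x : (V × V) × V => x.2)))
      fun _ => propext isSatRel_iff
  exact Dfn.comp₂ (q := Satisfies A) (by unfold Satisfies; infer_instance) f g

theorem IsSatRel.satisfies_iff {A S c s : V} (h : IsSatRel A S) (hc : c ∈ᵛ Fml V)
    (hs : IsFun s (omega V) A) : Satisfies A c s ↔ opair c s ∈ᵛ S := by
  simp only [Satisfies, rel_iff]
  exact ⟨fun ⟨S', h', H⟩ => (h'.agree h c hc s hs).1 H, fun H => ⟨S, h, H⟩⟩

section Clauses

variable {A s i j a b : V}

theorem satisfies_cMem (hs : IsFun s (omega V) A) (hi : i ∈ᵛ omega V)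
    (hj : j ∈ᵛ omega V) :
    Satisfies A (cMem i j) s ↔ app s i ∈ᵛ app s j := by
  obtain ⟨S, hS⟩ := exists_isSatRel A
  rw [hS.satisfies_iff (cMem_mem hi hj) hs]
  exact (isSatRel_iff.1 hS s hs).1 i j hi hj

theorem satisfies_cEq (hs : IsFun s (omega V) A) (hi : i ∈ᵛ omega V) (hj : j ∈ᵛ omega V) :
    Satisfies A (cEq i j) s ↔ app s i = app s j := by
  obtain ⟨S, hS⟩ := exists_isSatRel A
  rw [hS.satisfies_iff (cEq_mem hi hj) hs]
  exact (isSatRel_iff.1 hS s hs).2.1 i j hi hj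

theorem satisfies_cNot (hs : IsFun s (omega V) A) (ha : a ∈ᵛ Fml V) : Satisfies A (cNot a) s ↔ ¬ Satisfies A a s := by
  obtain ⟨S, hS⟩ := exists_isSatRel A
  rw [hS.satisfies_iff (cNot_mem ha) hs, hS.satisfies_iff ha hs]
  exact (isSatRel_iff.1 hS s hs).2.2.1 a ha

theorem satisfies_cAnd (hs : IsFun s (omega V) A) (ha : a ∈ᵛ Fml V) (hb : b ∈ᵛ Fml V) :
    Satisfies A (cAnd a b) s ↔ (Satisfies A a s ∧ Satisfies A b s) := by
  obtain ⟨S, hS⟩ := exists_isSatRel A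
  rw [hS.satisfies_iff (cAnd_mem ha hb) hs, hS.satisfies_iff ha hs, hS.satisfies_iff hb hs]
  exact (isSatRel_iff.1 hS s hs).2.2.2.1 a b ha hb

theorem satisfies_cEx (hs : IsFun s (omega V) A) (hi : i ∈ᵛ omega V) (ha : a ∈ᵛ Fml V) :
    Satisfies A (cEx i a) s ↔ ∃ x, x ∈ᵛ A ∧ Satisfies A a (upd s i x) := by
  obtain ⟨S, hS⟩ := exists_isSatRel A
  rw [hS.satisfies_iff (cEx_mem hi ha) hs, (isSatRel_iff.1 hS s hs).2.2.2.2 i a hi ha]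
  exact exists_congr fun x => and_congr_right fun hx =>
    (hS.satisfies_iff ha (upd_isFun hs hx)).symm

end Clauses

end HF

section LS

variable {V : Type u} [SetModel V] [hZF : ZF V] {E : Type u} [DefType V E]

/-! ### Dependent choice -/

theorem IsFun.dom_unique {f a a' b b' : V} (h : IsFun f a b) (h' : IsFun f a' b') : a = a' :=
  ext fun _ => ⟨fun hz => (h'.opair_mem_iff.1 (h.opair_app_mem hz)).1,
    fun hz => (h.opair_mem_iff.1 (h'.opair_app_mem hz)).1⟩

open Classical in
/-- Dependent choice, where every choice may depend on the sequence of all previous choices. -/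
theorem dc_history (hDC : ModelsDC V) (X : V) (Q : V → V → V → Prop)
    [hQ : Dfn V (fun x : V × V × V => Q x.1 x.2.1 x.2.2)]
    (h : ∀ n, n ∈ᵛ omega V → ∀ t, IsFun t n X → ∃ x, x ∈ᵛ X ∧ Q n t x) :
    ∃ s, IsFun s (omega V) X ∧ ∀ n, n ∈ᵛ omega V → Q n (graph n (app s)) (app s n) := by
  have hQ' : ∀ {E : Type u} [DefType V E] (f g h : E → V) [Dfn V f] [Dfn V g] [Dfn V h],
    Dfn V (fun e => Q (f e) (g e) (h e)) := fun f g h _ _ _ => Dfn.comp₃ hQ f g h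
  -- Dependent choice is applied to the finite sequences that have obeyed `Q` so far, related by
  -- one-step end extension.
  let good : V → V → Prop := fun n t => n ∈ᵛ omega V ∧ IsFun t n X ∧
    ∀ m, m ∈ᵛ n → Q m (graph m (app t)) (app t m)
  have hgood : ∀ {E : Type u} [DefType V E] (f g : E → V) [Dfn V f] [Dfn V g],
    Dfn V (fun e => good (f e) (g e)) := fun f g _ _ =>
      Dfn.comp₂ (q := good) (by unfold good; infer_instance) f g
  let A : V := sep (pow (prod (omega V) X)) (fun t => ∃ n, good n t)
  have hA : ∀ t, t ∈ᵛ A ↔ ∃ n, good n t := by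
    intro t
    rw [mem_sep, and_iff_right_iff_imp]
    rintro ⟨n, hn, ht, -⟩
    rw [mem_pow]
    intro z hz
    obtain ⟨x, y, hx, hy, rfl⟩ := mem_prod.1 (isRelOn_iff.1 ht.1 z hz)
    exact opair_mem_prod.2 ⟨isTransitive_omega n hn x hx, hy⟩
  let R : V := sep (prod A A) (fun p => ∃ t t' n, p = opair t t' ∧ n ∈ᵛ omega V ∧ IsFun t n X ∧
    IsFun t' (suc n) X ∧ ∀ m, m ∈ᵛ n → app t' m = app t m)
  have hR : ∀ t t', opair t t' ∈ᵛ R ↔ (t ∈ᵛ A ∧ t' ∈ᵛ A) ∧ ∃ n, n ∈ᵛ omega V ∧ IsFun t n X ∧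
      IsFun t' (suc n) X ∧ ∀ m, m ∈ᵛ n → app t' m = app t m := by
    intro t t'
    rw [mem_sep, opair_mem_prod]
    refine and_congr_right fun _ => ?_
    constructor
    · rintro ⟨t, t', n, h, hn⟩
      obtain ⟨rfl, rfl⟩ := opair_inj.1 h
      exact ⟨n, hn⟩
    · rintro ⟨n, hn⟩
      exact ⟨t, t', n, rfl, hn⟩
  have hext : ∀ t, t ∈ᵛ A → ∃ t', t' ∈ᵛ A ∧ Rel R t t' := by
    intro t htA
    obtain ⟨n, hn, ht, hQt⟩ := (hA t).1 htA
    obtain ⟨x, hx, hQx⟩ := h n hn t ht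
    let t' := graph (suc n) (fun m => if m = n then x else app t m)
    have h1 : app t' n = x := by
      rw [app_graph (by simp), if_pos rfl]
    have h2 : ∀ m, m ∈ᵛ n → app t' m = app t m := by
      intro m hm
      rw [app_graph (by simp [hm]), if_neg]
      rintro rfl
      exact mem_irrefl _ hm
    have h3 : IsFun t' (suc n) X := by
      refine isFun_graph fun m hm => ?_
      split_ifs with h
      · exact hx
      · exact ht.app_mem ((mem_suc.1 hm).resolve_right h)
    have h4 : t' ∈ᵛ A := by
      refine (hA t').2 ⟨suc n, suc_mem_omega hn, h3, fun m hm => ?_⟩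
      rcases mem_suc.1 hm with hm | rfl
      · rw [h2 m hm, graph_congr fun i hi => h2 i (isTransitive_nat hn m hm i hi)]
        exact hQt m hm
      · rw [h1, graph_congr fun i hi => h2 i hi, ← ht.eq_graph]
        exact hQx
    exact ⟨t', h4, rel_iff.2 ((hR t t').2 ⟨⟨htA, h4⟩, n, hn, ht, h3, h2⟩)⟩
  have hne : ∃ t, t ∈ᵛ A := by
    refine ⟨graph (emp V) (fun x => x), (hA _).2 ⟨emp V, emp_mem_omega,
      isFun_graph fun x hx => (mem_emp hx).elim, fun m hm => (mem_emp hm).elim⟩⟩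
  obtain ⟨w, f, hw, hf, hchain⟩ := hDC A R hne hext
  obtain rfl := isOmega_iff.1 hw
  have hstep : ∀ m, m ∈ᵛ omega V → opair (app f m) (app f (suc m)) ∈ᵛ R := fun m hm =>
    rel_iff.1 (hchain m (suc m) _ _ hm (isSucc_iff.2 rfl) (rel_iff.2 (hf.opair_app_mem hm))
      (rel_iff.2 (hf.opair_app_mem (suc_mem_omega hm))))
  -- The chain may start with a sequence of any finite length, so only a lower bound on the lengths
  -- is available.
  have hdom : ∀ m, m ∈ᵛ omega V → ∃ n, good n (app f m) ∧ Sub m n := by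
    refine nat_induction (fun m => ∃ n, good n (app f m) ∧ Sub m n) ?_ ?_
    · obtain ⟨n, hn⟩ := (hA _).1 (hf.app_mem emp_mem_omega)
      exact ⟨n, hn, fun z hz => (mem_emp hz).elim⟩
    · rintro m hm ⟨n, hn, hmn⟩
      obtain ⟨-, n', hn', h1, h2, -⟩ := (hR _ _).1 (hstep m hm)
      obtain ⟨n'', hn''⟩ := (hA _).1 (hf.app_mem (suc_mem_omega hm))
      obtain rfl := h2.dom_unique hn''.2.1
      obtain rfl := h1.dom_unique hn.2.1
      refine ⟨_, hn'', fun z hz => ?_⟩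
      rcases mem_suc.1 hz with hz | rfl
      · exact mem_suc.2 (Or.inl (hmn z hz))
      · rcases nat_trichotomy hm hn' with h | h | h
        · exact mem_suc.2 (Or.inl h)
        · exact mem_suc.2 (Or.inr h)
        · exact (mem_irrefl _ (hmn _ h)).elim
  have hcoh : ∀ m', m' ∈ᵛ omega V → ∀ m, m ∈ᵛ suc m' → ∀ n, IsFun (app f m) n X →
      ∀ j, j ∈ᵛ n → ∃ n', IsFun (app f m') n' X ∧ j ∈ᵛ n' ∧ app (app f m') j = app (app f m) j := by
    refine nat_induction (fun m' => ∀ m, m ∈ᵛ suc m' → ∀ n, IsFun (app f m) n X →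
      ∀ j, j ∈ᵛ n → ∃ n', IsFun (app f m') n' X ∧ j ∈ᵛ n' ∧
        app (app f m') j = app (app f m) j) ?_ ?_
    · intro m hm n hn j hj
      rcases mem_suc.1 hm with hm | rfl
      · exact (mem_emp hm).elim
      · exact ⟨n, hn, hj, rfl⟩
    · intro m' hm' ih m hm n hn j hj
      rcases mem_suc.1 hm with hm | rfl
      · obtain ⟨n', hn', hj', h'⟩ := ih m hm n hn j hj
        obtain ⟨-, n'', hn'', h1, h2, h3⟩ := (hR _ _).1 (hstep m' hm')
        obtain rfl := h1.dom_unique hn'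
        exact ⟨suc n'', h2, mem_suc.2 (Or.inl hj'), (h3 j hj').trans h'⟩
      · exact ⟨n, hn, hj, rfl⟩
  -- Entry `j` of the limit is read off sequence `j + 1`, which is long enough; by coherence every
  -- later sequence gives the same entry.
  have hs : ∀ j, j ∈ᵛ omega V →
      app (graph (omega V) (fun j => app (app f (suc j)) j)) j = app (app f (suc j)) j :=
    fun j hj => app_graph hj
  refine ⟨graph (omega V) (fun j => app (app f (suc j)) j), isFun_graph fun j hj => ?_,
    fun m hm => ?_⟩
  · obtain ⟨n, hn, hjn⟩ := hdom (suc j) (suc_mem_omega hj)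
    exact hn.2.1.app_mem (hjn j (by simp))
  · obtain ⟨n, hn, hmn⟩ := hdom (suc m) (suc_mem_omega hm)
    have hQm := hn.2.2 m (hmn m (by simp))
    rw [hs m hm]
    convert hQm using 1
    refine graph_congr fun i hi => ?_
    have hio := isTransitive_omega m hm i hi
    rw [hs i hio]
    obtain ⟨n', hn', hin'⟩ := hdom (suc i) (suc_mem_omega hio)
    obtain ⟨n'', -, -, h'⟩ := hcoh (suc m) (suc_mem_omega hm) (suc i)
      (mem_suc.2 (Or.inl (suc_mem_suc hm hi))) n' hn'.2.1 i (hin' i (by simp))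
    exact h'.symm

/-! ### The Löwenheim-Skolem theorem -/

theorem nat_bound {i j : V} (hi : i ∈ᵛ omega V) (hj : j ∈ᵛ omega V) :
    ∃ k, k ∈ᵛ omega V ∧ Sub i k ∧ Sub j k := by
  rcases nat_trichotomy hi hj with h | rfl | h
  · exact ⟨j, hj, isTransitive_nat hj i h, fun _ h => h⟩
  · exact ⟨i, hi, fun _ h => h, fun _ h => h⟩
  · exact ⟨i, hi, fun _ h => h, isTransitive_nat hi j h⟩

/-- The truth value of a formula depends on finitely many values of the assignment. -/
theorem finite_support (A : V) : ∀ c, c ∈ᵛ Fml V → ∃ k, k ∈ᵛ omega V ∧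
    ∀ s s', IsFun s (omega V) A → IsFun s' (omega V) A →
      (∀ j, j ∈ᵛ k → app s j = app s' j) → (Satisfies A c s ↔ Satisfies A c s') := by
  refine formula_induction (fun c => ∃ k, k ∈ᵛ omega V ∧
    ∀ s s', IsFun s (omega V) A → IsFun s' (omega V) A →
      (∀ j, j ∈ᵛ k → app s j = app s' j) → (Satisfies A c s ↔ Satisfies A c s')) ?_ ?_ ?_ ?_ ?_
  · intro i j hi hj
    obtain ⟨k, hk, hik, hjk⟩ := nat_bound (suc_mem_omega hi) (suc_mem_omega hj)
    refine ⟨k, hk, fun s s' hs hs' h => ?_⟩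
    rw [satisfies_cMem hs hi hj, satisfies_cMem hs' hi hj, h i (hik i (by simp)),
      h j (hjk j (by simp))]
  · intro i j hi hj
    obtain ⟨k, hk, hik, hjk⟩ := nat_bound (suc_mem_omega hi) (suc_mem_omega hj)
    refine ⟨k, hk, fun s s' hs hs' h => ?_⟩
    rw [satisfies_cEq hs hi hj, satisfies_cEq hs' hi hj, h i (hik i (by simp)),
      h j (hjk j (by simp))]
  · rintro a ha ⟨k, hk, ih⟩
    refine ⟨k, hk, fun s s' hs hs' h => ?_⟩
    rw [satisfies_cNot hs ha, satisfies_cNot hs' ha, ih s s' hs hs' h]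
  · rintro a b ha hb ⟨k, hk, iha⟩ ⟨l, hl, ihb⟩
    obtain ⟨m, hm, hkm, hlm⟩ := nat_bound hk hl
    refine ⟨m, hm, fun s s' hs hs' h => ?_⟩
    rw [satisfies_cAnd hs ha hb, satisfies_cAnd hs' ha hb,
      iha s s' hs hs' fun j hj => h j (hkm j hj), ihb s s' hs hs' fun j hj => h j (hlm j hj)]
  · rintro i a hi ha ⟨k, hk, ih⟩
    refine ⟨k, hk, fun s s' hs hs' h => ?_⟩
    rw [satisfies_cEx hs hi ha, satisfies_cEx hs' hi ha]
    refine exists_congr fun x => and_congr_right fun hx =>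
      ih _ _ (upd_isFun hs hx) (upd_isFun hs' hx) fun j hj => ?_
    have hjo := isTransitive_omega k hk j hj
    rw [app_upd hjo, app_upd hjo, h j hj]

/-- The Tarski-Vaught criterion. -/
theorem elementary_of_witness {M N : V} (hne : ∃ x, x ∈ᵛ M) (hMN : Sub M N)
    (h : ∀ c, c ∈ᵛ Fml V → ∀ i, i ∈ᵛ omega V → ∀ s, IsFun s (omega V) M →
      (∃ y, y ∈ᵛ N ∧ Satisfies N c (upd s i y)) → ∃ x, x ∈ᵛ M ∧ Satisfies N c (upd s i x)) :
    IsElementarySubmodel M N := by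
  refine ⟨hne, hMN, fun c s hc hs => ?_⟩
  rw [isFormula_iff] at hc
  rw [isAssignment_iff] at hs
  refine formula_induction (fun c => ∀ s, IsFun s (omega V) M →
    (Satisfies M c s ↔ Satisfies N c s)) ?_ ?_ ?_ ?_ ?_ c hc s hs
  · intro i j hi hj s hs
    rw [satisfies_cMem hs hi hj, satisfies_cMem (hs.mono hMN) hi hj]
  · intro i j hi hj s hs
    rw [satisfies_cEq hs hi hj, satisfies_cEq (hs.mono hMN) hi hj]
  · intro a ha ih s hs
    rw [satisfies_cNot hs ha, satisfies_cNot (hs.mono hMN) ha, ih s hs]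
  · intro a b ha hb iha ihb s hs
    rw [satisfies_cAnd hs ha hb, satisfies_cAnd (hs.mono hMN) ha hb, iha s hs, ihb s hs]
  · intro i a hi ha ih s hs
    rw [satisfies_cEx hs hi ha, satisfies_cEx (hs.mono hMN) hi ha]
    constructor
    · rintro ⟨x, hx, hxs⟩
      exact ⟨x, hMN x hx, (ih _ (upd_isFun hs hx)).1 hxs⟩
    · intro hy
      obtain ⟨x, hx, hxs⟩ := h a ha i hi s hs hy
      exact ⟨x, hx, (ih _ (upd_isFun hs hx)).2 hxs⟩

theorem graph_mem_HF (F : V → V) [hF : Dfn₁ F] (h : ∀ j, j ∈ᵛ omega V → F j ∈ᵛ HF V) :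
    ∀ k, k ∈ᵛ omega V → graph k F ∈ᵛ HF V := by
  have hF' : ∀ {E : Type u} [DefType V E] (f : E → V) [Dfn V f], Dfn V (fun e => F (f e)) :=
    fun f hf => Dfn₁.comp hF hf
  refine nat_induction (fun k => graph k F ∈ᵛ HF V) ?_ fun k hk ih => ?_
  · convert emp_mem_HF (V := V)
    exact eq_emp fun z hz => by simp at hz
  · convert insert_mem_HF ih (opair_mem_HF (omega_sub_HF k hk) (h k hk)) using 1
    refine ext fun z => ?_
    simp only [mem_graph, mem_suc, mem_bun, mem_sing]
    grind

/-- The assignment that arises from a sequence `t` of length `n` by reindexing with `σ`. -/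
noncomputable def reindexAsg (d n t σ : V) : V :=
  graph (omega V) (fun j => open Classical in if app σ j ∈ᵛ n then app t (app σ j) else d)

instance dfn_reindexAsg (d : V) (f g h : E → V) [Dfn V f] [Dfn V g] [Dfn V h] :
    Dfn V (fun e => reindexAsg d (f e) (g e) (h e)) :=
  Dfn.comp₃ (q := reindexAsg d) (by unfold reindexAsg; infer_instance) f g h

theorem reindexAsg_isFun {d n t σ A : V} (ht : IsFun t n A) (hd : d ∈ᵛ A) :
    IsFun (reindexAsg d n t σ) (omega V) A := by
  refine isFun_graph fun j _ => ?_
  split_ifs with h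
  · exact ht.app_mem h
  · exact hd

theorem app_reindexAsg {d n t σ j : V} (hj : j ∈ᵛ omega V) (h : app σ j ∈ᵛ n) :
    app (reindexAsg d n t σ) j = app t (app σ j) := by
  rw [reindexAsg, app_graph hj, if_pos h]

/-- The least index of an element is a choice-free section of the enumeration; the proof of
`lowenheim_skolem` needs it as a definable map. -/
theorem exists_isInj_of_range (s : V) : IsCountable (image (app s) (omega V)) ∧
    ∃ F : V → V, Dfn₁ F ∧ ∀ x, x ∈ᵛ image (app s) (omega V) →
      F x ∈ᵛ omega V ∧ app s (F x) = x := by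
  let F : V → V := fun x =>
    the (fun l => l ∈ᵛ omega V ∧ app s l = x ∧ ∀ m, m ∈ᵛ l → ¬ app s m = x)
  have hF : Dfn₁ F := by unfold F; infer_instance
  have hspec : ∀ x, x ∈ᵛ image (app s) (omega V) → F x ∈ᵛ omega V ∧ app s (F x) = x := by
    intro x hx
    obtain ⟨l, hl, hlx⟩ := mem_image.1 hx
    obtain ⟨n, hn, hnx, hmin⟩ := nat_least (fun l => app s l = x) ⟨l, hl, hlx.symm⟩
    have : F x = n := by
      refine the_eq (p := fun l => l ∈ᵛ omega V ∧ app s l = x ∧ ∀ m, m ∈ᵛ l → ¬ app s m = x)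
        ⟨hn, hnx, hmin⟩ ?_
      rintro m ⟨hm, hmx, hmin'⟩
      rcases nat_trichotomy hm hn with h | h | h
      · exact (hmin m h hmx).elim
      · exact h
      · exact (hmin' n h hnx).elim
    rw [this]
    exact ⟨hn, hnx⟩
  refine ⟨⟨omega V, graph (image (app s) (omega V)) F, isOmega_omega, isInj_iff.2
    ⟨isFun_graph fun x hx => (hspec x hx).1, fun x hx y hy hxy => ?_⟩⟩, F, hF, hspec⟩
  rw [app_graph hx, app_graph hy] at hxy
  rw [← (hspec x hx).2, ← (hspec y hy).2, hxy]

/-- Stages 0 and 1 of the Löwenheim-Skolem construction are not ordered pairs and so carry no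
witness request. They are free to receive the two prescribed elements. -/
theorem enum_emp_ne (a b : V) : app (enum V) (emp V) ≠ opair a b := by
  have h : app (enum V) (emp V) = emp V := exists_enum.choose_spec.1
  rw [h]
  exact (ne_emp (x := sing a) (by simp [opair])).symm

theorem enum_one_ne (a b : V) : app (enum V) (suc (emp V)) ≠ opair a b := by
  intro h
  have h1 : sing a ∈ᵛ app (enum V) (suc (emp V)) := by rw [h]; simp [opair]
  obtain ⟨m, hm, hma⟩ := exists_enum.choose_spec.2.1 _ (suc_mem_omega emp_mem_omega) _ h1
  rcases mem_suc.1 hm with hm | rfl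
  · exact mem_emp hm
  · have h2 : sing a = emp V := hma.trans exists_enum.choose_spec.1
    exact ne_emp (x := a) (by simp) h2

/-- The downward Löwenheim-Skolem theorem, from dependent choice. -/
theorem lowenheim_skolem (hDC : ModelsDC V) {H p q : V} (hp : p ∈ᵛ H) (hq : q ∈ᵛ H) :
    ∃ M, IsCountable M ∧ IsElementarySubmodel M H ∧ p ∈ᵛ M ∧ q ∈ᵛ M := by
  -- When the set with number `n` is $\langle c,\langle i,\sigma\rangle\rangle$, stage `n` must
  -- supply a witness for $\exists x_i\,c$, if there is one in `H`, under the assignment $j\mapsto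
  -- s(\sigma(j))$. Only values of `s` before `n` are consulted, and `p` is the default for the
  -- others.
  obtain ⟨s, hs, hQ⟩ := dc_history hDC H (fun n t x => (n = emp V → x = p) ∧
    (n = suc (emp V) → x = q) ∧
    ∀ c i σ, app (enum V) n = opair c (opair i σ) →
      (∃ y, y ∈ᵛ H ∧ Satisfies H c (upd (reindexAsg p n t σ) i y)) →
      Satisfies H c (upd (reindexAsg p n t σ) i x)) (by
    intro n hn t ht
    by_cases h0 : n = emp V
    · subst h0
      exact ⟨p, hp, fun _ => rfl, fun h => (suc_ne_emp _ h.symm).elim,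
        fun c i σ h => (enum_emp_ne _ _ h).elim⟩
    by_cases h1 : n = suc (emp V)
    · subst h1
      exact ⟨q, hq, fun h => (h0 h).elim, fun _ => rfl, fun c i σ h => (enum_one_ne _ _ h).elim⟩
    by_cases h2 : ∃ c i σ y, app (enum V) n = opair c (opair i σ) ∧ y ∈ᵛ H ∧
        Satisfies H c (upd (reindexAsg p n t σ) i y)
    · obtain ⟨c, i, σ, y, h, hy, hsat⟩ := h2
      refine ⟨y, hy, fun h => (h0 h).elim, fun h => (h1 h).elim, fun c' i' σ' h' _ => ?_⟩
      obtain ⟨rfl, h''⟩ := opair_inj.1 (h.symm.trans h')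
      obtain ⟨rfl, rfl⟩ := opair_inj.1 h''
      exact hsat
    · exact ⟨p, hp, fun h => (h0 h).elim, fun h => (h1 h).elim,
        fun c i σ h ⟨y, hy, hsat⟩ => (h2 ⟨c, i, σ, y, h, hy, hsat⟩).elim⟩)
  obtain ⟨hcount, F, hF, hFspec⟩ := exists_isInj_of_range s
  have hmem : ∀ n, n ∈ᵛ omega V → app s n ∈ᵛ image (app s) (omega V) :=
    fun n hn => mem_image.2 ⟨n, hn, rfl⟩
  have hpM : p ∈ᵛ image (app s) (omega V) := by
    rw [← (hQ _ emp_mem_omega).1 rfl]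
    exact hmem _ emp_mem_omega
  have hqM : q ∈ᵛ image (app s) (omega V) := by
    rw [← (hQ _ (suc_mem_omega emp_mem_omega)).2.1 rfl]
    exact hmem _ (suc_mem_omega emp_mem_omega)
  have hMH : Sub (image (app s) (omega V)) H := by
    intro x hx
    obtain ⟨n, hn, rfl⟩ := mem_image.1 hx
    exact hs.app_mem hn
  have hF' : ∀ {E : Type u} [DefType V E] (f : E → V) [Dfn V f], Dfn V (fun e => F (f e)) :=
    fun f hf => Dfn₁.comp hF hf
  refine ⟨_, hcount, elementary_of_witness ⟨p, hpM⟩ hMH fun c hc i hi a ha hy => ?_, hpM, hqM⟩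
  obtain ⟨y, hy, hsat⟩ := hy
  -- The whole assignment `a` is not hereditarily finite. Its values on the support `k`, replaced by
  -- their least indices in `s`, are coded by a finite `σ`.
  obtain ⟨k, hk, hsupp⟩ := finite_support H c hc
  have hσ : graph k (fun j => F (app a j)) ∈ᵛ HF V :=
    graph_mem_HF (fun j => F (app a j))
      (fun j hj => omega_sub_HF _ (hFspec _ (ha.app_mem hj)).1) k hk
  obtain ⟨n, hn, hn'⟩ := mem_HF.1 (opair_mem_HF (Fml_sub_HF c hc)
    (opair_mem_HF (omega_sub_HF i hi) hσ))
  have htr := enum_image_transitive hn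
  -- The values of `σ` lie in the transitive closure of set number `n`, hence are enumerated before
  -- `n`, hence are less than `n`. So they point to entries of `s` already chosen.
  have hlt : ∀ j, j ∈ᵛ k → F (app a j) ∈ᵛ n := by
    intro j hj
    refine nat_mem_of_mem_image hn (hFspec _ (ha.app_mem (isTransitive_omega k hk j hj))).1 ?_
    have h1 := enum_sub hn _ (hn' ▸ upair_mem_opair _ _)
    have h2 := htr _ h1 _ (mem_upair.2 (Or.inr rfl))
    have h3 := htr _ h2 _ (upair_mem_opair _ _)
    have h4 := htr _ h3 _ (mem_upair.2 (Or.inr rfl))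
    have h5 := htr _ h4 (opair j (F (app a j))) (opair_mem_graph.2 ⟨hj, rfl⟩)
    have h6 := htr _ h5 _ (upair_mem_opair _ _)
    exact htr _ h6 _ (mem_upair.2 (Or.inr rfl))
  have haH := ha.mono hMH
  have hrestr : IsFun (graph n (app s)) n H :=
    isFun_graph fun m hm => hs.app_mem (isTransitive_omega n hn m hm)
  have hra := reindexAsg_isFun (σ := graph k (fun j => F (app a j))) hrestr hp
  have hagree : ∀ x j, j ∈ᵛ k →
      app (upd a i x) j = app (upd (reindexAsg p n (graph n (app s))
        (graph k (fun j => F (app a j)))) i x) j := by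
    intro x j hj
    have hjo := isTransitive_omega k hk j hj
    have e1 : app (graph k (fun j => F (app a j))) j = F (app a j) := app_graph hj
    have e2 : app (reindexAsg p n (graph n (app s)) (graph k (fun j => F (app a j)))) j
        = app a j := by
      rw [app_reindexAsg hjo (by rw [e1]; exact hlt j hj), e1, app_graph (hlt j hj)]
      exact (hFspec _ (ha.app_mem hjo)).2
    rw [app_upd hjo, app_upd hjo, e2]
  have hsn := hmem n hn
  refine ⟨app s n, hsn, ?_⟩
  rw [hsupp _ _ (upd_isFun haH (hMH _ hsn)) (upd_isFun hra (hMH _ hsn)) (hagree _)]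
  refine (hQ n hn).2.2 c i _ hn'.symm ⟨y, hy, ?_⟩
  rwa [← hsupp _ _ (upd_isFun haH hy) (upd_isFun hra hy) (hagree _)]

end LS

/-! ### Standard formulas -/

/-- Formulas of the language of set theory, with named variables. -/
inductive Fm : Type
  | mem : ℕ → ℕ → Fm
  | eq : ℕ → ℕ → Fm
  | not : Fm → Fm
  | and : Fm → Fm → Fm
  | ex : ℕ → Fm → Fm

namespace Fm

variable {V : Type u} [SetModel V]

/-- Satisfaction of a standard formula in `(A, ∈)`. -/
def Sat (A : V) : Fm → (ℕ → V) → Prop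
  | mem i j, v => v i ∈ᵛ v j
  | eq i j, v => v i = v j
  | not φ, v => ¬ φ.Sat A v
  | and φ ψ, v => φ.Sat A v ∧ ψ.Sat A v
  | ex i φ, v => ∃ x, x ∈ᵛ A ∧ φ.Sat A (Function.update v i x)

def or (φ ψ : Fm) : Fm := not (and (not φ) (not ψ))
def imp (φ ψ : Fm) : Fm := not (and φ (not ψ))
def iff (φ ψ : Fm) : Fm := and (imp φ ψ) (imp ψ φ)
def all (i : ℕ) (φ : Fm) : Fm := not (ex i (not φ))

variable {A : V} {φ ψ : Fm} {v : ℕ → V} {i : ℕ}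

theorem sat_or : (or φ ψ).Sat A v ↔ (φ.Sat A v ∨ ψ.Sat A v) := by
  simp only [or, Sat]; tauto
theorem sat_imp : (imp φ ψ).Sat A v ↔ (φ.Sat A v → ψ.Sat A v) := by
  simp only [imp, Sat]; tauto
theorem sat_iff : (iff φ ψ).Sat A v ↔ (φ.Sat A v ↔ ψ.Sat A v) := by
  simp only [iff, Sat, sat_imp]; tauto
theorem sat_all : (all i φ).Sat A v ↔ ∀ x, x ∈ᵛ A → φ.Sat A (Function.update v i x) := by
  simp only [all, Sat]; push Not; rfl

end Fm

/-! ### Codes of standard formulas and witnesses in elementary submodels -/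

section Evaluation

variable {V : Type u} [SetModel V] [hZF : ZF V]

/-- Standard formulas have codes. -/
theorem Fm.exists_code (φ : Fm) : ∃ c : V, c ∈ᵛ Fml V ∧ ∀ (A s : V) (v : ℕ → V),
    IsFun s (omega V) A → (∀ i, app s (num V i) = v i) → (Satisfies A c s ↔ φ.Sat A v) := by
  induction φ with
  | mem i j =>
    refine ⟨_, cMem_mem (num_mem_omega i) (num_mem_omega j), fun A s v hs hv => ?_⟩
    rw [satisfies_cMem hs (num_mem_omega i) (num_mem_omega j), hv, hv, Sat]
  | eq i j =>
    refine ⟨_, cEq_mem (num_mem_omega i) (num_mem_omega j), fun A s v hs hv => ?_⟩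
    rw [satisfies_cEq hs (num_mem_omega i) (num_mem_omega j), hv, hv, Sat]
  | not φ ih =>
    obtain ⟨c, hc, h⟩ := ih
    refine ⟨_, cNot_mem hc, fun A s v hs hv => ?_⟩
    rw [satisfies_cNot hs hc, h A s v hs hv, Sat]
  | and φ ψ ih ih' =>
    obtain ⟨c, hc, h⟩ := ih
    obtain ⟨d, hd, h'⟩ := ih'
    refine ⟨_, cAnd_mem hc hd, fun A s v hs hv => ?_⟩
    rw [satisfies_cAnd hs hc hd, h A s v hs hv, h' A s v hs hv, Sat]
  | ex i φ ih =>
    obtain ⟨c, hc, h⟩ := ih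
    refine ⟨_, cEx_mem (num_mem_omega i) hc, fun A s v hs hv => ?_⟩
    rw [satisfies_cEx hs (num_mem_omega i) hc, Sat]
    refine exists_congr fun x => and_congr_right fun hx => h A _ _ (upd_isFun hs hx) fun j => ?_
    rw [app_upd (num_mem_omega j), Function.update_apply, hv]
    simp only [num_inj]

/-- Elementary submodels contain witnesses for standard formulas with two parameters, which are
the values of the variables `1` and `2`. -/
theorem IsElementarySubmodel.witness {M N : V} (hMN : IsElementarySubmodel M N) (φ : Fm)
    {a b : V} (ha : a ∈ᵛ M) (hb : b ∈ᵛ M)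
    (h : ∃ y, y ∈ᵛ N ∧ φ.Sat N (Function.update (Function.update (fun _ => a) 2 b) 0 y)) :
    ∃ y, y ∈ᵛ M ∧ φ.Sat N (Function.update (Function.update (fun _ => a) 2 b) 0 y) := by
  obtain ⟨c, hc, hcode⟩ := φ.exists_code (V := V)
  have hs : IsFun (upd (graph (omega V) (fun _ => a)) (num V 2) b) (omega V) M :=
    upd_isFun (isFun_graph fun _ _ => ha) hb
  have hv : ∀ y i, app (upd (upd (graph (omega V) (fun _ => a)) (num V 2) b) (num V 0) y) (num V i)
      = Function.update (Function.update (fun _ => a) 2 b) 0 y i := by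
    intro y i
    have hi := num_mem_omega (V := V) i
    rw [app_upd hi, app_upd hi, app_graph hi, Function.update_apply, Function.update_apply]
    simp only [num_inj]
  have h0 := num_mem_omega (V := V) 0
  have hsub := hMN.2.1
  have key : ∀ y, y ∈ᵛ N → (Satisfies N c
      (upd (upd (graph (omega V) (fun _ => a)) (num V 2) b) (num V 0) y) ↔
      φ.Sat N (Function.update (Function.update (fun _ => a) 2 b) 0 y)) := fun y hy =>
    hcode N _ _ (upd_isFun (hs.mono hsub) hy) (hv y)
  have hex : Satisfies N (cEx (num V 0) c) (upd (graph (omega V) (fun _ => a)) (num V 2) b) := by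
    rw [satisfies_cEx (hs.mono hsub) h0 hc]
    obtain ⟨y, hy, hsat⟩ := h
    exact ⟨y, hy, (key y hy).2 hsat⟩
  -- Elementarity is used twice: the existential formula passes down to `M`, and the formula at the
  -- witness found there passes back up to `N`.
  rw [← hMN.2.2 _ _ (isFormula_iff.2 (cEx_mem h0 hc)) (isAssignment_iff.2 hs),
    satisfies_cEx hs h0 hc] at hex
  obtain ⟨y, hy, hsat⟩ := hex
  rw [hMN.2.2 _ _ (isFormula_iff.2 hc) (isAssignment_iff.2 (upd_isFun hs hy))] at hsat
  exact ⟨y, hy, (key y (hsub y hy)).1 hsat⟩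

/-! ### Absolute formulas, evaluated in a transitive set -/

namespace Fm

/-- `x_i = ∅` -/
def isEmp (i : ℕ) : Fm := all 32 (not (mem 32 i))
/-- `x_j = x_i ∪ {x_i}` -/
def isSuc (i j : ℕ) : Fm := all 32 (iff (mem 32 j) (or (mem 32 i) (eq 32 i)))
/-- `x_k = {x_i, x_j}` -/
def isUpair (i j k : ℕ) : Fm := all 32 (iff (mem 32 k) (or (eq 32 i) (eq 32 j)))
/-- `x_k = ⟨x_i, x_j⟩` -/
def isOpair (i j k : ℕ) : Fm :=
  ex 30 (ex 31 (and (isUpair i i 30) (and (isUpair i j 31) (isUpair 30 31 k))))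
/-- `⟨x_i, x_j⟩ ∈ x_r` -/
def rel (r i j : ℕ) : Fm := ex 29 (and (isOpair i j 29) (mem 29 r))
/-- `x_i = ω` -/
def isOmega (i : ℕ) : Fm :=
  and (ex 27 (and (mem 27 i) (isEmp 27)))
    (and (all 27 (imp (mem 27 i) (ex 28 (and (mem 28 i) (isSuc 27 28)))))
      (all 27 (imp (mem 27 i) (or (isEmp 27) (ex 28 (and (mem 28 i) (isSuc 28 27)))))))

variable {h : V} {v : ℕ → V}

theorem update_mem {v : ℕ → V} (hv : ∀ i, v i ∈ᵛ h) (i : ℕ) {x : V} (hx : x ∈ᵛ h) :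
    ∀ j, Function.update v i x j ∈ᵛ h := by
  intro j
  rw [Function.update_apply]
  split_ifs
  · exact hx
  · exact hv j

/-- In this and the following evaluations, transitivity of `h` puts the elements of a parameter into
the range of the quantifiers. The bounds on indices keep the free variables away from the bound
variables 27 to 32. -/
theorem sat_isEmp (hh : IsTransitive h) (hv : ∀ i, v i ∈ᵛ h) {i : ℕ} (hi : i < 29) :
    (isEmp i).Sat h v ↔ v i = emp V := by
  simp only [isEmp, sat_all, Sat, Function.update_apply, if_true, (show i ≠ 32 by omega), if_false]
  constructor
  · exact fun H => eq_emp fun z hz => H z (hh _ (hv i) z hz) hz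
  · intro H z _
    rw [H]
    exact mem_emp

theorem sat_isSuc (hh : IsTransitive h) (hv : ∀ i, v i ∈ᵛ h) {i j : ℕ} (hi : i < 29) (hj : j < 29) :
    (isSuc i j).Sat h v ↔ v j = suc (v i) := by
  simp only [isSuc, sat_all, sat_iff, sat_or, Sat, Function.update_apply, if_true,
    (show i ≠ 32 by omega), (show j ≠ 32 by omega), if_false]
  constructor
  · intro H
    refine ext fun z => ?_
    rw [mem_suc]
    refine ⟨fun hz => (H z (hh _ (hv j) z hz)).1 hz, fun hz => (H z ?_).2 hz⟩
    rcases hz with hz | rfl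
    · exact hh _ (hv i) z hz
    · exact hv i
  · intro H z _
    rw [H, mem_suc]

theorem sat_isUpair (hh : IsTransitive h) (hv : ∀ i, v i ∈ᵛ h) {i j k : ℕ} (hi : i < 32)
    (hj : j < 32) (hk : k < 32) : (isUpair i j k).Sat h v ↔ v k = upair (v i) (v j) := by
  simp only [isUpair, sat_all, sat_iff, sat_or, Sat, Function.update_apply, if_true,
    (show i ≠ 32 by omega), (show j ≠ 32 by omega), (show k ≠ 32 by omega), if_false]
  constructor
  · intro H
    refine ext fun z => ?_
    rw [mem_upair]
    refine ⟨fun hz => (H z (hh _ (hv k) z hz)).1 hz, fun hz => (H z ?_).2 hz⟩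
    rcases hz with rfl | rfl
    · exact hv i
    · exact hv j
  · intro H z _
    rw [H, mem_upair]

theorem sat_isOpair (hh : IsTransitive h) (hv : ∀ i, v i ∈ᵛ h) {i j k : ℕ} (hi : i < 30)
    (hj : j < 30) (hk : k < 30) : (isOpair i j k).Sat h v ↔ v k = opair (v i) (v j) := by
  have key : ∀ a, a ∈ᵛ h → ∀ b, b ∈ᵛ h →
      ((and (isUpair i i 30) (and (isUpair i j 31) (isUpair 30 31 k))).Sat h
        (Function.update (Function.update v 30 a) 31 b) ↔
        (a = sing (v i) ∧ b = upair (v i) (v j) ∧ v k = upair a b)) := by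
    intro a ha b hb
    have hv' := update_mem (update_mem hv 30 ha) 31 hb
    rw [Sat, Sat, sat_isUpair hh hv' (by omega) (by omega) (by omega),
      sat_isUpair hh hv' (by omega) (by omega) (by omega),
      sat_isUpair hh hv' (by omega) (by omega) (by omega)]
    simp [(show i ≠ 31 by omega), (show j ≠ 31 by omega),
      (show k ≠ 31 by omega), (show i ≠ 30 by omega), (show j ≠ 30 by omega),
      (show k ≠ 30 by omega), sing]
  simp only [isOpair, Sat] at key ⊢
  constructor
  · rintro ⟨a, ha, b, hb, H⟩
    obtain ⟨rfl, rfl, H⟩ := (key a ha b hb).1 H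
    exact H
  · intro H
    have h1 : sing (v i) ∈ᵛ h := hh _ (hv k) _ (by rw [H, opair, mem_upair]; exact Or.inl rfl)
    have h2 : upair (v i) (v j) ∈ᵛ h := hh _ (hv k) _ (by rw [H]; exact upair_mem_opair _ _)
    exact ⟨_, h1, _, h2, (key _ h1 _ h2).2 ⟨rfl, rfl, H⟩⟩

theorem sat_rel (hh : IsTransitive h) (hv : ∀ i, v i ∈ᵛ h) {r i j : ℕ} (hr : r < 29) (hi : i < 29)
    (hj : j < 29) : (rel r i j).Sat h v ↔ opair (v i) (v j) ∈ᵛ v r := by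
  simp only [rel, Sat]
  constructor
  · rintro ⟨p, hp, H, H'⟩
    rw [sat_isOpair hh (update_mem hv 29 hp) (by omega) (by omega) (by omega)] at H
    simp only [Function.update_apply, if_true, (show i ≠ 29 by omega), (show j ≠ 29 by omega),
      (show r ≠ 29 by omega), if_false] at H H'
    rwa [← H]
  · intro H
    have hp := hh _ (hv r) _ H
    refine ⟨_, hp, ?_, ?_⟩
    · rw [sat_isOpair hh (update_mem hv 29 hp) (by omega) (by omega) (by omega)]
      simp [(show i ≠ 29 by omega), (show j ≠ 29 by omega)]
    · simpa [Function.update_apply, (show r ≠ 29 by omega)] using H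

/-- This describes `ω` by conditions on the elements of `w` alone, without comparison with other
inductive sets, so it can be checked in a transitive set. Foundation excludes further elements: a
minimal one outside `ω` would be the successor of a natural number. -/
theorem eq_omega {w : V} (h0 : emp V ∈ᵛ w) (hs : ∀ x, x ∈ᵛ w → suc x ∈ᵛ w)
    (hc : ∀ x, x ∈ᵛ w → x = emp V ∨ ∃ y, y ∈ᵛ w ∧ x = suc y) : w = omega V := by
  refine ext fun z => ⟨fun hz => ?_, fun hz => mem_omega.1 hz w (isInductive_iff.2 ⟨h0, hs⟩)⟩
  by_contra hn
  obtain ⟨x, hx, hmin⟩ := exists_minimal (sep w (fun x => ¬ x ∈ᵛ omega V))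
    ⟨z, mem_sep.2 ⟨hz, hn⟩⟩
  obtain ⟨hxw, hxo⟩ := mem_sep.1 hx
  rcases hc x hxw with rfl | ⟨y, hy, rfl⟩
  · exact hxo emp_mem_omega
  · refine hmin y (by simp) (mem_sep.2 ⟨hy, fun hyo => hxo (suc_mem_omega hyo)⟩)

theorem sat_isOmega (hh : IsTransitive h) (hv : ∀ i, v i ∈ᵛ h) {i : ℕ} (hi : i < 27) :
    (isOmega i).Sat h v ↔ v i = omega V := by
  have hsub := hh _ (hv i)
  have e1 : ∀ x, x ∈ᵛ h → ((isEmp 27).Sat h (Function.update v 27 x) ↔ x = emp V) := by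
    intro x hx
    rw [sat_isEmp hh (update_mem hv 27 hx) (by omega), Function.update_self]
  have e2 : ∀ x, x ∈ᵛ h → ∀ y, y ∈ᵛ h →
      ((isSuc 27 28).Sat h (Function.update (Function.update v 27 x) 28 y) ↔ y = suc x) := by
    intro x hx y hy
    rw [sat_isSuc hh (update_mem (update_mem hv 27 hx) 28 hy) (by omega) (by omega)]
    simp
  have e3 : ∀ x, x ∈ᵛ h → ∀ y, y ∈ᵛ h →
      ((isSuc 28 27).Sat h (Function.update (Function.update v 27 x) 28 y) ↔ x = suc y) := by
    intro x hx y hy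
    rw [sat_isSuc hh (update_mem (update_mem hv 27 hx) 28 hy) (by omega) (by omega)]
    simp
  simp only [isOmega, sat_all, sat_imp, sat_or, Sat]
  simp only [Function.update_apply, if_true, (show i ≠ 28 by omega), (show i ≠ 27 by omega),
    if_false] at e1 e2 e3 ⊢
  constructor
  · rintro ⟨⟨e, he, hei, he'⟩, h2, h3⟩
    rw [e1 e he] at he'
    subst he'
    refine eq_omega hei (fun x hx => ?_) fun x hx => ?_
    · obtain ⟨y, hy, hyi, hy'⟩ := h2 x (hsub x hx) hx
      rw [e2 x (hsub x hx) y hy] at hy'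
      rwa [← hy']
    · rcases h3 x (hsub x hx) hx with h4 | ⟨y, hy, hyi, hy'⟩
      · exact Or.inl ((e1 x (hsub x hx)).1 h4)
      · exact Or.inr ⟨y, hyi, (e3 x (hsub x hx) y hy).1 hy'⟩
  · intro H
    rw [H] at hsub ⊢
    refine ⟨⟨emp V, hsub _ emp_mem_omega, emp_mem_omega, (e1 _ (hsub _ emp_mem_omega)).2 rfl⟩,
      fun x hx hxo => ?_, fun x hx hxo => ?_⟩
    · have := hsub _ (suc_mem_omega hxo)
      exact ⟨suc x, this, suc_mem_omega hxo, (e2 x hx _ this).2 rfl⟩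
    · rcases nat_cases hxo with h1 | ⟨m, hm, h1⟩
      · exact Or.inl ((e1 x hx).2 h1)
      · exact Or.inr ⟨m, hsub m hm, hm, (e3 x hx m (hsub m hm)).2 h1⟩

end Fm

end Evaluation

/-! ### The two implications -/

section Main

variable {V : Type u} [SetModel V] [hZF : ZF V]

namespace Fm

/-- Every element of `x_3` has a lower bound, with respect to `x_5`, in common with an element
of `x_2` that `x_0` maps into `x_7`. -/
def predense : Fm :=
  all 8 (imp (mem 8 3) (ex 9 (and (mem 9 2) (ex 10 (and (mem 10 7) (and (rel 0 9 10)
    (ex 11 (and (mem 11 3) (and (rel 5 11 9) (rel 5 11 8))))))))))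

/-- `x_0` is injective. -/
def injective : Fm := all 8 (all 9 (all 10 (imp (and (rel 0 8 10) (rel 0 9 10)) (eq 8 9))))

/-- `x_0` injects a part of `x_2` which is predense in the forcing coded by `x_1` into `ω`. -/
def countablePredense : Fm :=
  ex 3 (ex 4 (ex 5 (ex 6 (ex 7 (and (isOpair 5 6 4) (and (isOpair 3 4 1) (and (isOmega 7)
    (and predense injective))))))))

variable {h : V} {v : ℕ → V}

theorem sat_predense (hh : IsTransitive h) (hv : ∀ i, v i ∈ᵛ h) : predense.Sat h v ↔
    ∀ p, p ∈ᵛ v 3 → ∃ d, d ∈ᵛ v 2 ∧ ∃ n, n ∈ᵛ v 7 ∧ opair d n ∈ᵛ v 0 ∧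
      ∃ r, r ∈ᵛ v 3 ∧ opair r d ∈ᵛ v 5 ∧ opair r p ∈ᵛ v 5 := by
  have hmem : ∀ {i x}, x ∈ᵛ v i → x ∈ᵛ h := fun {i x} hx => hh _ (hv i) x hx
  have e1 : ∀ p, p ∈ᵛ h → ∀ d, d ∈ᵛ h → ∀ n, n ∈ᵛ h → ((rel 0 9 10).Sat h (Function.update
      (Function.update (Function.update v 8 p) 9 d) 10 n) ↔ opair d n ∈ᵛ v 0) := by
    intro p hp d hd n hn
    rw [sat_rel hh (update_mem (update_mem (update_mem hv 8 hp) 9 hd) 10 hn) (by omega) (by omega)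
      (by omega)]
    simp
  have e2 : ∀ p, p ∈ᵛ h → ∀ d, d ∈ᵛ h → ∀ n, n ∈ᵛ h → ∀ r, r ∈ᵛ h →
      ((rel 5 11 9).Sat h (Function.update (Function.update (Function.update
        (Function.update v 8 p) 9 d) 10 n) 11 r) ↔ opair r d ∈ᵛ v 5) := by
    intro p hp d hd n hn r hr
    rw [sat_rel hh (update_mem (update_mem (update_mem (update_mem hv 8 hp) 9 hd) 10 hn) 11 hr)
      (by omega) (by omega) (by omega)]
    simp
  have e3 : ∀ p, p ∈ᵛ h → ∀ d, d ∈ᵛ h → ∀ n, n ∈ᵛ h → ∀ r, r ∈ᵛ h →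
      ((rel 5 11 8).Sat h (Function.update (Function.update (Function.update
        (Function.update v 8 p) 9 d) 10 n) 11 r) ↔ opair r p ∈ᵛ v 5) := by
    intro p hp d hd n hn r hr
    rw [sat_rel hh (update_mem (update_mem (update_mem (update_mem hv 8 hp) 9 hd) 10 hn) 11 hr)
      (by omega) (by omega) (by omega)]
    simp
  simp only [predense, sat_all, sat_imp, Sat]
  simp at e1 e2 e3 ⊢
  constructor
  · intro H p hp
    obtain ⟨d, hd, hd', n, hn, hn', hdn, r, hr, hr', h1, h2⟩ := H p (hmem hp) hp
    exact ⟨d, hd', n, hn', (e1 p (hmem hp) d hd n hn).1 hdn, r, hr',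
      (e2 p (hmem hp) d hd n hn r hr).1 h1, (e3 p (hmem hp) d hd n hn r hr).1 h2⟩
  · intro H p hp hp'
    obtain ⟨d, hd', n, hn', hdn, r, hr', h1, h2⟩ := H p hp'
    exact ⟨d, hmem hd', hd', n, hmem hn', hn', (e1 p hp d (hmem hd') n (hmem hn')).2 hdn, r,
      hmem hr', hr', (e2 p hp d (hmem hd') n (hmem hn') r (hmem hr')).2 h1,
      (e3 p hp d (hmem hd') n (hmem hn') r (hmem hr')).2 h2⟩

theorem sat_injective (hh : IsTransitive h) (hv : ∀ i, v i ∈ᵛ h) : injective.Sat h v ↔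
    ∀ d, d ∈ᵛ h → ∀ d', d' ∈ᵛ h → ∀ n, n ∈ᵛ h →
      opair d n ∈ᵛ v 0 → opair d' n ∈ᵛ v 0 → d = d' := by
  simp only [injective, sat_all, sat_imp, Sat, and_imp]
  refine forall_congr' fun d => forall_congr' fun hd => forall_congr' fun d' =>
    forall_congr' fun hd' => forall_congr' fun n => forall_congr' fun hn => ?_
  have hv' := update_mem (update_mem (update_mem hv 8 hd) 9 hd') 10 hn
  rw [sat_rel hh hv' (by omega) (by omega) (by omega),
    sat_rel hh hv' (by omega) (by omega) (by omega)]
  simp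

theorem sat_countablePredense (hh : IsTransitive h) (hv : ∀ i, v i ∈ᵛ h) {carrier le one y : V}
    (h1 : y = opair le one) (h2 : v 1 = opair carrier y) (hω : omega V ∈ᵛ h) :
    countablePredense.Sat h v ↔
      (∀ p, p ∈ᵛ carrier → ∃ d, d ∈ᵛ v 2 ∧ ∃ n, n ∈ᵛ omega V ∧ opair d n ∈ᵛ v 0 ∧
        ∃ r, r ∈ᵛ carrier ∧ opair r d ∈ᵛ le ∧ opair r p ∈ᵛ le) ∧
      ∀ d, d ∈ᵛ h → ∀ d', d' ∈ᵛ h → ∀ n, n ∈ᵛ h →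
        opair d n ∈ᵛ v 0 → opair d' n ∈ᵛ v 0 → d = d' := by
  have key : ∀ c, c ∈ᵛ h → ∀ y, y ∈ᵛ h → ∀ l, l ∈ᵛ h → ∀ o, o ∈ᵛ h → ∀ w, w ∈ᵛ h →
      ((and (isOpair 5 6 4) (and (isOpair 3 4 1) (and (isOmega 7)
        (and predense injective)))).Sat h (Function.update (Function.update (Function.update
          (Function.update (Function.update v 3 c) 4 y) 5 l) 6 o) 7 w) ↔
      (y = opair l o ∧ v 1 = opair c y ∧ w = omega V ∧
        (∀ p, p ∈ᵛ c → ∃ d, d ∈ᵛ v 2 ∧ ∃ n, n ∈ᵛ w ∧ opair d n ∈ᵛ v 0 ∧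
          ∃ r, r ∈ᵛ c ∧ opair r d ∈ᵛ l ∧ opair r p ∈ᵛ l) ∧
        ∀ d, d ∈ᵛ h → ∀ d', d' ∈ᵛ h → ∀ n, n ∈ᵛ h →
          opair d n ∈ᵛ v 0 → opair d' n ∈ᵛ v 0 → d = d')) := by
    intro c hc y hy l hl o ho w hw
    have hv' := update_mem (update_mem (update_mem (update_mem (update_mem hv 3 hc) 4 hy) 5 hl)
      6 ho) 7 hw
    simp only [Sat]
    rw [sat_isOpair hh hv' (by omega) (by omega) (by omega),
      sat_isOpair hh hv' (by omega) (by omega) (by omega), sat_isOmega hh hv' (by omega),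
      sat_predense hh hv', sat_injective hh hv']
    simp
  simp only [countablePredense]
  constructor
  · rintro ⟨c, hc, y', hy', l, hl, o, ho, w, hw, H⟩
    obtain ⟨g1, g2, g3, g4, g5⟩ := (key c hc y' hy' l hl o ho w hw).1 H
    obtain ⟨rfl, rfl⟩ := opair_inj.1 (h2.symm.trans g2)
    obtain ⟨rfl, rfl⟩ := opair_inj.1 (h1.symm.trans g1)
    subst g3
    exact ⟨g4, g5⟩
  · rintro ⟨g4, g5⟩
    -- The components of the forcing are found in `h` because `h` is transitive and contains the
    -- code of the forcing.
    have hpair : ∀ a b, opair a b ∈ᵛ h → a ∈ᵛ h ∧ b ∈ᵛ h := fun a b hab => by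
      have := hh _ hab _ (upair_mem_opair a b)
      exact ⟨hh _ this _ (by simp), hh _ this _ (by simp)⟩
    obtain ⟨hc, hy⟩ := hpair _ _ (h2 ▸ hv 1)
    obtain ⟨hl, ho⟩ := hpair _ _ (h1 ▸ hy)
    exact ⟨carrier, hc, y, hy, le, hl, one, ho, omega V, hω,
      (key _ hc _ hy _ hl _ ho _ hω).2 ⟨h1, h2, rfl, g4, g5⟩⟩

end Fm

/-- Elementary submodels of transitive sets that contain `ω` contain all natural numbers. -/
theorem IsElementarySubmodel.omega_sub {M h : V} (hM : IsElementarySubmodel M h)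
    (hh : IsTransitive h) (hω : omega V ∈ᵛ h) : Sub (omega V) M := by
  obtain ⟨a, ha⟩ := hM.1
  have hv : ∀ n y, n ∈ᵛ M → y ∈ᵛ h →
      ∀ i, Function.update (Function.update (fun _ => n) 2 n) 0 y i ∈ᵛ h := fun n y hn hy =>
    Fm.update_mem (Fm.update_mem (fun _ => hM.2.1 n hn) 2 (hM.2.1 n hn)) 0 hy
  -- Since `M` is an element of `V`, the induction is internal and reaches nonstandard numbers. In
  -- each case the witness found in `M` is the unique solution of the formula.
  refine nat_induction (fun n => n ∈ᵛ M) ?_ fun n hn hnM => ?_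
  · have he := hh _ hω _ emp_mem_omega
    obtain ⟨y, hy, hsat⟩ := hM.witness (Fm.isEmp 0) ha ha
      ⟨emp V, he, (Fm.sat_isEmp hh (hv a _ ha he) (by omega)).2 (by simp)⟩
    rw [Fm.sat_isEmp hh (hv a _ ha (hM.2.1 y hy)) (by omega), Function.update_self] at hsat
    rwa [← hsat]
  · have hs := hh _ hω _ (suc_mem_omega hn)
    obtain ⟨y, hy, hsat⟩ := hM.witness (Fm.isSuc 1 0) hnM hnM
      ⟨suc n, hs, (Fm.sat_isSuc hh (hv n _ hnM hs) (by omega) (by omega)).2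
        (by simp)⟩
    rw [Fm.sat_isSuc hh (hv n _ hnM (hM.2.1 y hy)) (by omega) (by omega)] at hsat
    have : y = suc n := by simpa [Function.update_apply] using hsat
    rwa [← this]

theorem Forcing.CCC3.mekler {P : Forcing V} (hP : P.CCC3) : P.Mekler := by
  obtain ⟨y, hy, hcode⟩ := P.code_eq
  rw [isOPair_iff] at hy hcode
  -- The power set is included so that every injection from a subset of the carrier into `ω` lies in
  -- `H_k`.
  obtain ⟨T, hT, hXT, -⟩ := exists_isTC
    (bun (upair P.code (omega V)) (pow (prod P.carrier (omega V))))
  have hωT : omega V ∈ᵛ T := hXT _ (by simp)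
  obtain ⟨k₀, hk₀, hns, hlarge⟩ := exists_isAleph T (hT _ hωT)
  refine ⟨k₀, hk₀, fun k hk hk₀k h M hh hMc hM hPM => ?_⟩
  have hk₀ne : omega V ∈ᵛ k₀ := hlarge _ isOrdinal_omega (hT _ hωT)
  have hTh : Sub T h := hh.sub_of_not_surj hk₀k ⟨_, hk₀ne⟩ hT hns
  have htr : IsTransitive h := hh.transitive ⟨_, hk₀k _ hk₀ne⟩
  have hωh := hTh _ hωT
  have hωM := hM.omega_sub htr hωh
  have hMh := hM.2.1
  intro D hDM hD
  obtain ⟨D₀, hD₀D, ⟨w, f, hw, hf⟩, hD₀⟩ := hP D hD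
  obtain rfl := isOmega_iff.1 hw
  rw [isInj_iff] at hf
  obtain ⟨hf, hinj⟩ := hf
  have hfh : f ∈ᵛ h := hTh _ (hXT _ (mem_bun.2 (Or.inr (mem_pow.2 fun z hz => by
    obtain ⟨a, b, ha, hb, rfl⟩ := mem_prod.1 (isRelOn_iff.1 hf.1 z hz)
    exact opair_mem_prod.2 ⟨hD.1 a (hD₀D a ha), hb⟩))))
  have hv : ∀ {a b c}, a ∈ᵛ M → b ∈ᵛ M → c ∈ᵛ h →
      ∀ i, Function.update (Function.update (fun _ => a) 2 b) 0 c i ∈ᵛ h := fun ha hb hc =>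
    Fm.update_mem (Fm.update_mem (fun _ => hMh _ ha) 2 (hMh _ hb)) 0 hc
  have hv1 : ∀ {a b c : V}, Function.update (Function.update (fun _ => a) 2 b) 0 c 1 = a := by
    simp
  have hv2 : ∀ {a b c : V}, Function.update (Function.update (fun _ => a) 2 b) 0 c 2 = b := by
    simp
  have hv0 : ∀ {a b c : V}, Function.update (Function.update (fun _ => a) 2 b) 0 c 0 = c := by
    simp
  -- The injection `f` shows that a witness exists in `h`. The `g` found in `M` need not be a
  -- function, but each value has at most one preimage.
  obtain ⟨g, hg, hsat⟩ := hM.witness Fm.countablePredense hPM hDM ⟨f, hfh, by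
    rw [Fm.sat_countablePredense htr (hv hPM hDM hfh) hy (hv1.trans hcode) hωh, hv2, hv0]
    refine ⟨fun p hp => ?_, fun d _ d' _ n _ h1 h2 => ?_⟩
    · obtain ⟨d, hd, r, hr, hrd, hrp⟩ := hD₀.2 p hp
      exact ⟨d, hD₀D d hd, app f d, hf.app_mem hd, hf.opair_app_mem hd, r, hr, rel_iff.1 hrd,
        rel_iff.1 hrp⟩
    · obtain ⟨hd, rfl⟩ := hf.opair_mem_iff.1 h1
      obtain ⟨hd', h3⟩ := hf.opair_mem_iff.1 h2
      exact hinj d hd d' hd' h3⟩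
  rw [Fm.sat_countablePredense htr (hv hPM hDM (hMh _ hg)) hy (hv1.trans hcode) hωh, hv2, hv0]
    at hsat
  refine ⟨sep D (fun d => d ∈ᵛ M), fun z => mem_sep, fun d hd => hD.1 d (mem_sep.1 hd).1,
    fun p hp _ => ?_⟩
  obtain ⟨d, hd, n, hn, hdn, r, hr, hrd, hrp⟩ := hsat.1 p hp
  have hdh : d ∈ᵛ h := htr _ (hMh _ hDM) d hd
  -- Both `g` and `n` are in `M`, so `M` contains a preimage of `n` under `g`; by injectivity it is
  -- `d`.
  obtain ⟨d', hd'M, hsat'⟩ := hM.witness (Fm.rel 1 0 2) hg (hωM n hn) ⟨d, hdh, by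
    rwa [Fm.sat_rel htr (hv hg (hωM n hn) hdh) (by omega) (by omega) (by omega), hv0, hv1, hv2]⟩
  rw [Fm.sat_rel htr (hv hg (hωM n hn) (hMh _ hd'M)) (by omega) (by omega) (by omega), hv0, hv1,
    hv2] at hsat'
  obtain rfl := hsat.2 d hdh d' (hMh _ hd'M) n (hMh _ (hωM n hn)) hdn hsat'
  exact ⟨d, mem_sep.2 ⟨hd, hd'M⟩, r, hr, rel_iff.2 hrd, rel_iff.2 hrp⟩

theorem IsCountable.mono {a b : V} (hb : IsCountable b) (hab : Sub a b) : IsCountable a := by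
  obtain ⟨w, f, hw, hf⟩ := hb
  rw [isInj_iff] at hf
  refine ⟨w, graph a (app f), hw, isInj_iff.2 ⟨isFun_graph fun x hx => hf.1.app_mem (hab x hx),
    fun x hx y hy hxy => ?_⟩⟩
  rw [app_graph hx, app_graph hy] at hxy
  exact hf.2 x (hab x hx) y (hab y hy) hxy

theorem Forcing.Mekler.ccc3 (hDC : ModelsDC V) {P : Forcing V} (hP : P.Mekler) : P.CCC3 := by
  intro D hD
  obtain ⟨k₀, hk₀, H⟩ := hP
  -- Including `k₀` makes the aleph `k` obtained from `T` larger than `k₀`, and `H_k` then contains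
  -- the forcing and `D`.
  obtain ⟨T, hT, hXT, -⟩ := exists_isTC (bun (upair P.code D) (bun (omega V) k₀))
  obtain ⟨k, hk, hns, hlarge⟩ := exists_isAleph T fun z hz => hXT z (by simp [hz])
  have hk₀k : k₀ ∈ᵛ k := hlarge k₀ hk₀.1 fun z hz => hXT z (by simp [hz])
  obtain ⟨h, hh⟩ := exists_isH k hk
  have hTh : Sub T h := hh.sub_of_not_surj (fun _ h => h) ⟨_, hk₀k⟩ hT hns
  obtain ⟨M, hMc, hM, hPM, hDM⟩ := lowenheim_skolem hDC (H := h) (p := P.code) (q := D)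
    (hTh _ (hXT _ (by simp))) (hTh _ (hXT _ (by simp)))
  obtain ⟨X, hX, hXsub, hXpre⟩ := H k hk (hk.1.1 _ hk₀k) h M hh hMc hM hPM D hDM hD
  -- The countable set is `D ∩ M`; every condition is below the maximum, so predense below it means
  -- predense.
  exact ⟨X, fun z hz => ((hX z).1 hz).1, hMc.mono fun z hz => ((hX z).1 hz).2, hXsub,
    fun p hp => hXpre p hp (P.le_one p hp)⟩

end Main
end ZFModel

theorem mainTheorem7 (V : Type*) [ZFModel.SetModel V]
    (hZF : ZFModel.ModelsZF V) (hDC : ZFModel.ModelsDC V) (P : ZFModel.Forcing V) :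
    P.CCC3 ↔ P.Mekler := by
  have : ZFModel.ZF V := ⟨hZF⟩
  exact ⟨fun h => h.mekler, fun h => h.ccc3 hDC⟩
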